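/- Let $d\ge 1$, let $X\neq\{0\}$ be a complex Banach space, $1<p_0,p_1\le\infty$, $q_0,q_1\in[1,\infty]$, $s_0,s_1\in\mathbb R$ and $\gamma_0,\gamma_1>-d$; put $w_i(x)=|x|^{\gamma_i}$ for $x\in\mathbb R^d$. For $p<\infty$ let $\|g\|_{L^p(\mathbb R^d,w;X)}=\big(\int_{\mathbb R^d}\|g(x)\|^p w(x)\,dx\big)^{1/p}$, let $L^\infty(\mathbb R^d,w;X)=L^\infty(\mathbb R^d;X)$, and read $a/\infty=0$. Write $\widehat f(\xi)=(2\pi)^{-d/2}\int_{\mathbb R^d} f(x)e^{-ix\cdot\xi}\,dx$ for the Fourier transform $\mathcal F$, extended to the space $\mathscr S'(\mathbb R^d;X)$ of $X$-valued tempered distributions. Fix any Schwartz functions $(\varphi_k)_{k\ge0}$ with $0\le\widehat\varphi_0\le1$, $\widehat\varphi_0(\xi)=1$ for $|\xi|\le1$, $\widehat\varphi_0(\xi)=0$ for $|\xi|\ge\frac32$, and $\widehat\varphi_k(\xi)=\widehat\varphi_0(2^{-k}\xi)-\widehat\varphi_0(2^{-k+1}\xi)$ for $k\ge1$. Let $S_kf=\mathcal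 F^{-1}[\widehat\varphi_k\widehat f]$, and let $B^s_{p,q}(\mathbb R^d,w;X)$ be the space of all $f\in\mathscr S'(\mathbb R^d;X)$ with $$\|f\|_{B^s_{p,q}(\mathbb R^d,w;X)}=\Big\|\big(2^{ks}\|S_kf\|_{L^p(\mathbb R^d,w;X)}\big)_{k\ge0}\Big\|_{\ell^q}<\infty .$$ Then the following are equivalent. (1) One has the continuous embedding $B^{s_0}_{p_0,q_0}(\mathbb R^d,w_0;X)\hookrightarrow B^{s_1}_{p_1,q_1}(\mathbb R^d,w_1;X)$, that is, the first space is contained in the second and there is a constant $C$ with $\|f\|_{B^{s_1}_{p_1,q_1}(\mathbb R^d,w_1;X)}\le C\|f\|_{B^{s_0}_{p_0,q_0}(\mathbb R^d,w_0;X)}$ for all $f$ in the first space. (2) One of the following holds: (a) $p_0=p_1$; moreover $\gamma_0=\gamma_1$ or $p_0=p_1=\infty$; and either $s_0>s_1$, or $s_0=s_1$ and $q_0\le q_1$; (b) $\frac{\gamma_1}{p_1}\le\frac{\gamma_0}{p_0}$, $\frac{d+\gamma_1}{p_1}<\frac{d+\gamma_0}{p_0}$ and $s_0-\frac{d+\gamma_0}{p_0}>s_1-\frac{d+\gamma_1}{p_1}$;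 (c) $\frac{\gamma_1}{p_1}\le\frac{\gamma_0}{p_0}$, $\frac{d+\gamma_1}{p_1}<\frac{d+\gamma_0}{p_0}$, $q_0\le q_1$ and $s_0-\frac{d+\gamma_0}{p_0}=s_1-\frac{d+\gamma_1}{p_1}$. -/

import Mathlib

open scoped SchwartzMap ENNReal NNReal

noncomputable section

namespace WeightedBesov

/-- The Euclidean space `ℝ^d`. -/
abbrev Rd (d : ℕ) : Type := EuclideanSpace ℝ (Fin d)

/-- The unitary Fourier transform
`φ̂(ξ) = (2π)^(-d/2) ∫ φ(x) e^(-i x·ξ) dx` of a Schwartz function. -/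
def hat {d : ℕ} (φ : 𝓢(Rd d, ℂ)) (ξ : Rd d) : ℂ :=
  (((2 * Real.pi) ^ (-(d : ℝ) / 2) : ℝ) : ℂ) *
    ∫ x : Rd d, φ x * Complex.exp (-(Complex.I * ((inner ℝ x ξ : ℝ) : ℂ)))

/-- The set `Φ` of Littlewood--Paley sequences: `0 ≤ φ̂₀ ≤ 1`, `φ̂₀ = 1` on `|ξ| ≤ 1`,
`φ̂₀ = 0` on `|ξ| ≥ 3/2`, and `φ̂ₖ(ξ) = φ̂₀(2^(-k) ξ) - φ̂₀(2^(-k+1) ξ)` for `k ≥ 1`. -/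
structure IsLittlewoodPaley {d : ℕ} (φ : ℕ → 𝓢(Rd d, ℂ)) : Prop where
  mem_unitInterval : ∀ ξ : Rd d, ∃ r : ℝ, 0 ≤ r ∧ r ≤ 1 ∧ hat (φ 0) ξ = (r : ℂ)
  eq_one : ∀ ξ : Rd d, ‖ξ‖ ≤ 1 → hat (φ 0) ξ = 1
  eq_zero : ∀ ξ : Rd d, 3 / 2 ≤ ‖ξ‖ → hat (φ 0) ξ = 0
  dyadic : ∀ k : ℕ, 1 ≤ k → ∀ ξ : Rd d,
    hat (φ k) ξ =
      hat (φ 0) ((2 : ℝ) ^ (-(k : ℤ)) • ξ) - hat (φ 0) ((2 : ℝ) ^ (-(k : ℤ) + 1) • ξ)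

/-- For a Schwartz function `φ` and a point `x`, the Schwartz function `y ↦ φ (x - y)`. -/
def reflectTranslate {d : ℕ} (φ : 𝓢(Rd d, ℂ)) (x : Rd d) : 𝓢(Rd d, ℂ) :=
  SchwartzMap.compCLMOfAntilipschitz ℂ (K := 1) (g := fun y : Rd d => x - y) (by fun_prop)
    (fun y z => by simp [edist_sub_left]) φ

theorem reflectTranslate_apply {d : ℕ} (φ : 𝓢(Rd d, ℂ)) (x y : Rd d) :
    reflectTranslate φ x y = φ (x - y) := rfl

variable {d : ℕ} {X : Type*} [NormedAddCommGroup X] [NormedSpace ℂ X]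

/-- The Littlewood--Paley piece `S f = φ ∗ f = 𝓕⁻¹ [φ̂ f̂]` of an `X`-valued tempered
distribution `f`, which is a smooth function. The convolution of a Schwartz function with a
tempered distribution is `x ↦ f (φ (x - ·))`; the factor `(2π)^(-d/2)` is the one for which the
unitary Fourier transform turns the convolution into the product `φ̂ f̂`. -/
def lpPiece (φ : 𝓢(Rd d, ℂ)) (f : 𝓢'(Rd d, X)) (x : Rd d) : X :=
  (((2 * Real.pi) ^ (-(d : ℝ) / 2) : ℝ) : ℂ) • f (reflectTranslate φ x)

/-- The norm of `L^p(ℝ^d, |x|^γ; X)`, with value `∞` outside the space. For `p < ∞` it is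
`(∫ ‖g(x)‖^p |x|^γ dx)^(1/p)`; by convention `L^∞(ℝ^d, w; X) = L^∞(ℝ^d; X)`. -/
def weightedLpNorm (p : ℝ≥0∞) (γ : ℝ) (g : Rd d → X) : ℝ≥0∞ :=
  if p = ∞ then MeasureTheory.eLpNorm g ∞ MeasureTheory.volume
  else (∫⁻ x : Rd d, ‖g x‖ₑ ^ p.toReal * ENNReal.ofReal (‖x‖ ^ γ)) ^ (1 / p.toReal)

/-- The norm of `ℓ^q` for sequences in `[0, ∞]`. -/
def seqNorm (q : ℝ≥0∞) (a : ℕ → ℝ≥0∞) : ℝ≥0∞ :=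
  if q = ∞ then ⨆ k, a k else (∑' k, a k ^ q.toReal) ^ (1 / q.toReal)

/-- The norm of `f` in the Besov space `B^s_{p,q}(ℝ^d, |x|^γ; X)`, formed with the
sequence `φ`, with value `∞` outside the space. -/
def besovNorm (φ : ℕ → 𝓢(Rd d, ℂ)) (s : ℝ) (p q : ℝ≥0∞) (γ : ℝ) (f : 𝓢'(Rd d, X)) : ℝ≥0∞ :=
  seqNorm q fun k => (2 : ℝ≥0∞) ^ ((k : ℝ) * s) * weightedLpNorm p γ (lpPiece (φ k) f)

/-- The Besov space `B^s_{p,q}(ℝ^d, |x|^γ; X)`. -/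
def besovSpace (X : Type*) [NormedAddCommGroup X] [NormedSpace ℂ X]
    (φ : ℕ → 𝓢(Rd d, ℂ)) (s : ℝ) (p q : ℝ≥0∞) (γ : ℝ) : Set 𝓢'(Rd d, X) :=
  {f | besovNorm φ s p q γ f < ∞}

/-- The continuous embedding
`B^{s₀}_{p₀,q₀}(ℝ^d, |x|^γ₀; X) ↪ B^{s₁}_{p₁,q₁}(ℝ^d, |x|^γ₁; X)`. -/
def BesovEmbedding (X : Type*) [NormedAddCommGroup X] [NormedSpace ℂ X]
    (φ : ℕ → 𝓢(Rd d, ℂ)) (s₀ s₁ : ℝ) (p₀ p₁ q₀ q₁ : ℝ≥0∞) (γ₀ γ₁ : ℝ) : Prop :=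
  besovSpace X φ s₀ p₀ q₀ γ₀ ⊆ besovSpace X φ s₁ p₁ q₁ γ₁ ∧
    ∃ C : ℝ≥0, ∀ f ∈ besovSpace X φ s₀ p₀ q₀ γ₀,
      besovNorm φ s₁ p₁ q₁ γ₁ f ≤ C * besovNorm φ s₀ p₀ q₀ γ₀ f

/-- The quotient `a / p` for an exponent `p ∈ [1, ∞]`, where `a / ∞ = 0`. -/
def divExp (a : ℝ) (p : ℝ≥0∞) : ℝ := a * (p⁻¹).toReal

end WeightedBesov

end

noncomputable section

namespace WeightedBesov

open MeasureTheory

/-! Sufficiency is a weighted Nikolskii inequality. The `k`-th piece of `f` has its spectrum in a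
ball of radius comparable to `2 ^ k`, so after rescaling it is reproduced by one Schwartz kernel
that does not depend on `k` (`IsLittlewoodPaley.enorm_lpPiece_le`). For vector-valued distributions
this formula requires moving `f` under an integral, which Hahn-Banach reduces to Bochner integration
in Banach spaces (`apply_integral_translate`). Undoing the dilation in the unit-scale inequality
`weightedLpNorm_le_of_reproducing` produces `2 ^ (k δ)`, where `δ` is the difference of the
homogeneities `(d + γ) / p`; comparison of sequence norms does the rest.

The unit-scale inequality rests on the pointwise bound of `‖g x‖` by the `L^{p₀}` norm times `(1 +
‖x‖) ^ (-γ₀ / p₀)`. Hölder's inequality applied directly to the reproducing formula can meet a dual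
weight that is not locally integrable; a sub-mean value property for `‖g‖ ^ r` with small `r` avoids
this. Near the origin the bound is integrated against `‖x‖ ^ γ₁`. Far away, `p₀ ≤ p₁` uses `γ₁ / p₁
≤ γ₀ / p₀`, while `p₁ < p₀` uses Hölder and the strict inequality of homogeneities.

Necessity is tested on `g ⊗ v`. For spectrum in the unit ball the Besov norm is the weighted `L^p`
norm: dilations compare the homogeneities and translations the weights at infinity. For spectrum in
an annulus on which a single multiplier equals one and the others vanish, dilates compare the
smoothness and lacunary sums give `q₀ ≤ q₁` in the sharp case. When the homogeneities agree and the
exponents are finite, a sum of `n` normalized dilates of a nonnegative function has norm comparable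
to `n ^ (1 / p)`, whence `p₀ ≤ p₁`; the weight condition gives the reverse inequality, and only the
trivial case survives. -/

theorem ennreal_rpow_le_rpow_of_nonpos {x y : ℝ≥0∞} (h : x ≤ y) {s : ℝ} (hs : s ≤ 0) :
    y ^ s ≤ x ^ s := by
  rw [← neg_neg s, ENNReal.rpow_neg x, ENNReal.rpow_neg y, ENNReal.inv_le_inv]
  exact ENNReal.rpow_le_rpow h (by linarith)

/-! ### Peetre-type inequalities for `1 + ‖x‖` -/

section bracket
variable {E : Type*} [NormedAddCommGroup E]

theorem bracket_ne_zero (x : E) : 1 + ‖x‖ₑ ≠ 0 := by simp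
theorem bracket_ne_top (x : E) : 1 + ‖x‖ₑ ≠ ∞ := by simp

theorem bracket_rpow_ne_top (x : E) (s : ℝ) : (1 + ‖x‖ₑ) ^ s ≠ ∞ := by
  simp [ENNReal.rpow_eq_top_iff]

theorem one_le_bracket (x : E) : 1 ≤ 1 + ‖x‖ₑ := le_self_add

theorem bracket_le_mul (x y : E) : 1 + ‖x‖ₑ ≤ (1 + ‖y‖ₑ) * (1 + ‖x - y‖ₑ) := by
  have h : ‖x‖ₑ ≤ ‖y‖ₑ + ‖x - y‖ₑ := by
    calc ‖x‖ₑ = ‖y + (x - y)‖ₑ := by simp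
      _ ≤ _ := enorm_add_le _ _
  calc 1 + ‖x‖ₑ ≤ 1 + (‖y‖ₑ + ‖x - y‖ₑ) := by gcongr
    _ ≤ 1 + (‖y‖ₑ + ‖x - y‖ₑ) + ‖y‖ₑ * ‖x - y‖ₑ := le_self_add
    _ = _ := by ring

/-- Peetre's inequality. -/
theorem bracket_rpow_le (x y : E) (s : ℝ) :
    (1 + ‖x‖ₑ) ^ s ≤ (1 + ‖y‖ₑ) ^ s * (1 + ‖x - y‖ₑ) ^ |s| := by
  rcases le_total 0 s with hs | hs
  · rw [abs_of_nonneg hs, ← ENNReal.mul_rpow_of_nonneg _ _ hs]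
    exact ENNReal.rpow_le_rpow (bracket_le_mul x y) hs
  · rw [abs_of_nonpos hs]
    have h := ENNReal.rpow_le_rpow (bracket_le_mul y x) (neg_nonneg.2 hs)
    rw [ENNReal.mul_rpow_of_nonneg _ _ (neg_nonneg.2 hs), enorm_sub_rev y x] at h
    calc (1 + ‖x‖ₑ) ^ s = (1 + ‖x‖ₑ) ^ s * ((1 + ‖y‖ₑ) ^ s * (1 + ‖y‖ₑ) ^ (-s)) := by
          rw [← ENNReal.rpow_add _ _ (bracket_ne_zero y) (bracket_ne_top y)]; simp
      _ ≤ (1 + ‖x‖ₑ) ^ s * ((1 + ‖y‖ₑ) ^ s * ((1 + ‖x‖ₑ) ^ (-s) * (1 + ‖x - y‖ₑ) ^ (-s))) := by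
          gcongr
      _ = ((1 + ‖x‖ₑ) ^ s * (1 + ‖x‖ₑ) ^ (-s)) * ((1 + ‖y‖ₑ) ^ s * (1 + ‖x - y‖ₑ) ^ (-s)) := by
          ring
      _ = _ := by
          rw [← ENNReal.rpow_add _ _ (bracket_ne_zero x) (bracket_ne_top x)]; simp

theorem bracket_rpow_le_rpow (x : E) {s t : ℝ} (h : s ≤ t) :
    (1 + ‖x‖ₑ) ^ s ≤ (1 + ‖x‖ₑ) ^ t :=
  ENNReal.rpow_le_rpow_of_exponent_le (one_le_bracket x) h

theorem bracket_rpow_neg_mul_le (x y z : E) {s : ℝ} (hs : 0 ≤ s) :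
    (1 + ‖x - y‖ₑ) ^ (-s) * (1 + ‖y - z‖ₑ) ^ (-s) ≤ (1 + ‖x - z‖ₑ) ^ (-s) := by
  rw [← ENNReal.mul_rpow_of_ne_top (bracket_ne_top _) (bracket_ne_top _), ENNReal.rpow_neg,
    ENNReal.rpow_neg, ENNReal.inv_le_inv]
  refine ENNReal.rpow_le_rpow ?_ hs
  have := bracket_le_mul (x - z) (x - y)
  simpa using this

/-- Away from the origin the weights `‖x‖` and `1 + ‖x‖` are comparable. -/
theorem enorm_rpow_le_bracket {x : E} (hx : 1 ≤ ‖x‖ₑ) (γ : ℝ) :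
    ‖x‖ₑ ^ γ ≤ 2 ^ |γ| * (1 + ‖x‖ₑ) ^ γ := by
  have h2 : 1 + ‖x‖ₑ ≤ 2 * ‖x‖ₑ := by
    rw [two_mul]; gcongr
  have hx0 : ‖x‖ₑ ≠ 0 := (lt_of_lt_of_le one_pos hx).ne'
  have h2' : (1 : ℝ≥0∞) ≤ 2 ^ |γ| := by
    simpa using ENNReal.rpow_le_rpow (show (1 : ℝ≥0∞) ≤ 2 by norm_num) (abs_nonneg γ)
  rcases le_total 0 γ with hs | hs
  · calc ‖x‖ₑ ^ γ ≤ (1 + ‖x‖ₑ) ^ γ := ENNReal.rpow_le_rpow le_add_self hs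
      _ ≤ _ := le_mul_of_one_le_left' h2'
  · rw [abs_of_nonpos hs]
    calc ‖x‖ₑ ^ γ = 2 ^ (-γ) * (2 ^ γ * ‖x‖ₑ ^ γ) := by
          rw [← mul_assoc, ← ENNReal.rpow_add _ _ (by simp) (by simp)]; simp
      _ = 2 ^ (-γ) * (2 * ‖x‖ₑ) ^ γ := by
          rw [ENNReal.mul_rpow_of_ne_top (by simp) (by simp)]
      _ ≤ _ := by
          gcongr 2 ^ (-γ) * ?_
          exact ennreal_rpow_le_rpow_of_nonpos h2 hs

end bracket

/-! ### Power weights: integrability and scaling -/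

section weight
variable {d : ℕ}

/-- The two sides differ only at the origin: for `γ < 0` the real power of zero is `0` and the
extended one is `∞`. The origin is a null set because `1 ≤ d`. -/
theorem ofReal_norm_rpow_ae (hd : 1 ≤ d) (γ : ℝ) :
    ∀ᵐ x : Rd d, ENNReal.ofReal (‖x‖ ^ γ) = ‖x‖ₑ ^ γ := by
  have : Nontrivial (Rd d) := by
    have : Nonempty (Fin d) := ⟨⟨0, hd⟩⟩
    infer_instance
  filter_upwards [Measure.ae_ne volume (0 : Rd d)] with x hx
  rw [← ENNReal.ofReal_rpow_of_pos (norm_pos_iff.2 hx), ofReal_norm]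

theorem weightedLpNorm_of_ne_top {X : Type*} [NormedAddCommGroup X] [NormedSpace ℂ X]
    (hd : 1 ≤ d) {p : ℝ≥0∞} (hp : p ≠ ∞) (γ : ℝ) (g : Rd d → X) :
    weightedLpNorm p γ g = (∫⁻ x : Rd d, ‖g x‖ₑ ^ p.toReal * ‖x‖ₑ ^ γ) ^ (1 / p.toReal) := by
  rw [weightedLpNorm, if_neg hp]
  congr 1
  refine lintegral_congr_ae ?_
  filter_upwards [ofReal_norm_rpow_ae hd γ] with x hx
  rw [hx]

theorem lintegral_bracket_lt_top {N : ℝ} (hN : (d : ℝ) < N) :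
    ∫⁻ x : Rd d, (1 + ‖x‖ₑ) ^ (-N) < ∞ := by
  have h := finite_integral_one_add_norm (E := Rd d) (μ := volume) (r := N) (by simpa using hN)
  convert h using 3 with x
  rw [← ENNReal.ofReal_rpow_of_pos (by positivity), ENNReal.ofReal_add (by simp) (by simp),
    ofReal_norm, ENNReal.ofReal_one]

theorem setLIntegral_ball_enorm_rpow_lt_top (hd : 1 ≤ d) {γ : ℝ} (hγ : -(d : ℝ) < γ) :
    ∫⁻ x in Metric.ball (0 : Rd d) 2, ‖x‖ₑ ^ γ < ∞ := by
  have h := integrableOn_ball_of_norm_le_rpow (E := Rd d) (μ := volume) (f := fun x => ‖x‖ ^ γ)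
    (C := 1) (α := -γ) (r := 2) (by simpa using hd) (by simp; linarith)
    (ae_of_all _ fun x => by simp [abs_of_nonneg (Real.rpow_nonneg (norm_nonneg x) γ)])
    (Measurable.aestronglyMeasurable (by fun_prop))
  have h2 := h.2
  rw [hasFiniteIntegral_iff_enorm] at h2
  refine lt_of_eq_of_lt ?_ h2
  refine lintegral_congr_ae ?_
  filter_upwards [ae_restrict_of_ae (ofReal_norm_rpow_ae hd γ)] with x hx
  rw [← hx, Real.enorm_of_nonneg (Real.rpow_nonneg (norm_nonneg x) γ)]

/-- A rapidly decaying kernel centred at `a` integrates the weight `‖x‖ ^ γ` to at most a multiple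
of `(1 + ‖a‖) ^ γ`. -/
theorem lintegral_bracket_mul_weight_le (hd : 1 ≤ d) {γ N : ℝ} (hγ : -(d : ℝ) < γ)
    (hN : d + |γ| < N) :
    ∃ C : ℝ≥0∞, C ≠ ∞ ∧ ∀ a : Rd d,
      ∫⁻ x : Rd d, (1 + ‖x - a‖ₑ) ^ (-N) * ‖x‖ₑ ^ γ ≤ C * (1 + ‖a‖ₑ) ^ γ := by
  have hN0 : 0 ≤ N := by have := abs_nonneg γ; have : (0:ℝ) ≤ d := by positivity
                         linarith
  set B : ℝ≥0∞ := ∫⁻ x in Metric.ball (0 : Rd d) 2, ‖x‖ₑ ^ γ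
  set I : ℝ≥0∞ := ∫⁻ x : Rd d, (1 + ‖x‖ₑ) ^ (-(N - |γ|))
  have hB : B ≠ ∞ := (setLIntegral_ball_enorm_rpow_lt_top hd hγ).ne
  have hI : I ≠ ∞ := (lintegral_bracket_lt_top (by linarith)).ne
  -- On the ball the kernel is at most `3 ^ N (1 + ‖a‖) ^ (-N)`, and `-N ≤ γ`. Off the ball the
  -- weight is comparable to `(1 + ‖x‖) ^ γ`, which Peetre's inequality moves to `a` at the cost of
  -- `|γ|` powers of decay.
  refine ⟨3 ^ N * B + 2 ^ |γ| * I, ?_, fun a => ?_⟩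
  · finiteness
  rw [← lintegral_add_compl _ (Metric.isOpen_ball (x := (0 : Rd d)) (ε := 2)).measurableSet,
    add_mul]
  gcongr
  · calc ∫⁻ x in Metric.ball (0 : Rd d) 2, (1 + ‖x - a‖ₑ) ^ (-N) * ‖x‖ₑ ^ γ
        ≤ ∫⁻ x in Metric.ball (0 : Rd d) 2, (3 ^ N * (1 + ‖a‖ₑ) ^ γ) * ‖x‖ₑ ^ γ := by
          refine setLIntegral_mono' Metric.isOpen_ball.measurableSet fun x hx => ?_
          gcongr
          have h1 := bracket_rpow_le (x - a) (-a) (-N)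
          rw [abs_neg, abs_of_nonneg hN0, enorm_neg, sub_neg_eq_add, sub_add_cancel] at h1
          refine h1.trans ?_
          rw [mul_comm]
          gcongr
          · have : ‖x‖ₑ ≤ 2 := by
              rw [← ofReal_norm]
              refine (ENNReal.ofReal_le_ofReal (q := 2) ?_).trans (by simp)
              simpa using (Metric.mem_ball.1 hx).le
            calc 1 + ‖x‖ₑ ≤ 1 + 2 := by gcongr
              _ = 3 := by norm_num
          · exact le_add_right (le_refl _)
          · have := neg_abs_le γ; linarith [show (0:ℝ) ≤ d by positivity]
      _ = _ := by
          rw [lintegral_const_mul _ (by fun_prop)]; ring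
  · calc ∫⁻ x in (Metric.ball (0 : Rd d) 2)ᶜ, (1 + ‖x - a‖ₑ) ^ (-N) * ‖x‖ₑ ^ γ
        ≤ ∫⁻ x in (Metric.ball (0 : Rd d) 2)ᶜ,
            (2 ^ |γ| * (1 + ‖a‖ₑ) ^ γ) * (1 + ‖x - a‖ₑ) ^ (-(N - |γ|)) := by
          refine setLIntegral_mono' Metric.isOpen_ball.measurableSet.compl fun x hx => ?_
          have hx1 : 1 ≤ ‖x‖ₑ := by
            rw [← ofReal_norm, ← ENNReal.ofReal_one]
            refine ENNReal.ofReal_le_ofReal ?_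
            simp at hx; linarith
          calc (1 + ‖x - a‖ₑ) ^ (-N) * ‖x‖ₑ ^ γ
              ≤ (1 + ‖x - a‖ₑ) ^ (-N) * (2 ^ |γ| * ((1 + ‖a‖ₑ) ^ γ * (1 + ‖x - a‖ₑ) ^ |γ|)) := by
                gcongr
                exact (enorm_rpow_le_bracket hx1 γ).trans (by gcongr; exact bracket_rpow_le x a γ)
            _ = (2 ^ |γ| * (1 + ‖a‖ₑ) ^ γ) * ((1 + ‖x - a‖ₑ) ^ (-N) * (1 + ‖x - a‖ₑ) ^ |γ|) := by
                ring
            _ = _ := by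
                rw [← ENNReal.rpow_add _ _ (bracket_ne_zero _) (bracket_ne_top _)]
                ring_nf
      _ ≤ ∫⁻ x : Rd d, (2 ^ |γ| * (1 + ‖a‖ₑ) ^ γ) * (1 + ‖x - a‖ₑ) ^ (-(N - |γ|)) :=
          setLIntegral_le_lintegral _ _
      _ = _ := by
          rw [lintegral_const_mul _ (by fun_prop),
            lintegral_sub_right_eq_self (fun x : Rd d => (1 + ‖x‖ₑ) ^ (-(N - |γ|))) a]
          ring

theorem map_smul_volume {t : ℝ} (ht : 0 < t) :
    Measure.map (fun x : Rd d => t • x) volume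
      = ENNReal.ofReal t ^ (-(d : ℝ)) • (volume : Measure (Rd d)) := by
  rw [Measure.map_addHaar_smul _ ht.ne']
  congr 1
  rw [finrank_euclideanSpace_fin, abs_of_nonneg (by positivity), ENNReal.ofReal_inv_of_pos
    (by positivity), ENNReal.rpow_neg, ENNReal.rpow_natCast, ENNReal.ofReal_pow ht.le]

theorem measurableEmbedding_smul_Rd {t : ℝ} (ht : 0 < t) :
    MeasurableEmbedding (fun x : Rd d => t • x) :=
  (Homeomorph.smulOfNeZero t ht.ne').measurableEmbedding

theorem lintegral_comp_smul (f : Rd d → ℝ≥0∞) {t : ℝ} (ht : 0 < t) :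
    ∫⁻ x : Rd d, f (t • x) = ENNReal.ofReal t ^ (-(d : ℝ)) * ∫⁻ x : Rd d, f x := by
  rw [← (measurableEmbedding_smul_Rd ht).lintegral_map, map_smul_volume ht, lintegral_smul_measure,
    smul_eq_mul]

theorem enorm_smul_of_pos {X : Type*} [NormedAddCommGroup X] [NormedSpace ℝ X] {t : ℝ} (ht : 0 < t)
    (x : X) : ‖t • x‖ₑ = ENNReal.ofReal t * ‖x‖ₑ := by
  rw [enorm_smul, Real.enorm_of_nonneg ht.le]

theorem divExp_top (a : ℝ) : divExp a ∞ = 0 := by simp [divExp]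

theorem divExp_eq_div (a : ℝ) (p : ℝ≥0∞) : divExp a p = a / p.toReal := by
  simp [divExp, ENNReal.toReal_inv, div_eq_mul_inv]

/-- The Jacobian contributes `t ^ (-d)` and the weight `t ^ (-γ)`, both under the `p`-th root. For
`p = ∞` a dilation multiplies the measure by a nonzero constant, which does not change an essential
supremum. -/
theorem weightedLpNorm_comp_smul {X : Type*} [NormedAddCommGroup X] [NormedSpace ℂ X]
    (hd : 1 ≤ d) {p : ℝ≥0∞} (hp : p ≠ 0) (γ : ℝ) (g : Rd d → X) {t : ℝ} (ht : 0 < t) :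
    weightedLpNorm p γ (fun x => g (t • x))
      = ENNReal.ofReal t ^ (-divExp (d + γ) p) * weightedLpNorm p γ g := by
  have ht0 : ENNReal.ofReal t ≠ 0 := by simpa using ht
  by_cases hp' : p = ∞
  · subst hp'
    simp only [weightedLpNorm, if_true, divExp_top, neg_zero, ENNReal.rpow_zero, one_mul,
      eLpNorm_exponent_top]
    rw [show (fun x => g (t • x)) = g ∘ fun x => t • x from rfl,
      ← (measurableEmbedding_smul_Rd ht).eLpNormEssSup_map_measure, map_smul_volume ht,
      eLpNormEssSup, eLpNormEssSup, essSup_ennreal_smul_measure]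
    simp [ENNReal.rpow_eq_zero_iff, ht0]
  · have hp0 : 0 < p.toReal := ENNReal.toReal_pos hp hp'
    rw [weightedLpNorm_of_ne_top hd hp', weightedLpNorm_of_ne_top hd hp']
    have h : ∀ x : Rd d, ‖g (t • x)‖ₑ ^ p.toReal * ‖x‖ₑ ^ γ = ENNReal.ofReal t ^ (-γ) *
        ((fun y => ‖g y‖ₑ ^ p.toReal * ‖y‖ₑ ^ γ) (t • x)) := by
      intro x
      simp only
      have h1 : ‖x‖ₑ ^ γ = ENNReal.ofReal t ^ (-γ) * ‖t • x‖ₑ ^ γ := by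
        rw [enorm_smul_of_pos ht, ENNReal.mul_rpow_of_ne_top (by simp) (by simp), ← mul_assoc,
          ← ENNReal.rpow_add _ _ ht0 (by simp)]
        simp
      rw [h1]; ring
    simp_rw [h]
    rw [lintegral_const_mul' _ _ (by simp [ENNReal.rpow_eq_top_iff, ht.not_ge]),
      lintegral_comp_smul (fun y => ‖g y‖ₑ ^ p.toReal * ‖y‖ₑ ^ γ) ht,
      ← mul_assoc, ← ENNReal.rpow_add _ _ ht0 (by simp),
      ENNReal.mul_rpow_of_nonneg _ _ (by positivity), ← ENNReal.rpow_mul, divExp_eq_div]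
    congr 2
    ring

end weight

/-! ### Translates in the Schwartz space -/

section translation
variable {d : ℕ} {F : Type*} [NormedAddCommGroup F] [NormedSpace ℝ F]

theorem one_add_norm_pow_mul_iteratedFDeriv_le (η : 𝓢(Rd d, F)) (k l : ℕ) :
    ∃ K : ℝ, 0 ≤ K ∧ ∀ x, (1 + ‖x‖) ^ k * ‖iteratedFDeriv ℝ l η x‖ ≤ K :=
  ⟨_, by positivity, fun x => SchwartzMap.one_add_le_sup_seminorm_apply (𝕜 := ℝ) (m := (k, l))
    le_rfl le_rfl η x⟩

theorem norm_pow_mul_iteratedFDeriv_sub_le (η : 𝓢(Rd d, F)) (k l : ℕ) :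
    ∃ K : ℝ, 0 ≤ K ∧ ∀ z x, ‖x‖ ^ k * ‖iteratedFDeriv ℝ l η (x - z)‖ ≤ K * (1 + ‖z‖) ^ k := by
  obtain ⟨K, hK, h⟩ := one_add_norm_pow_mul_iteratedFDeriv_le η k l
  refine ⟨K, hK, fun z x => ?_⟩
  have h1 : ‖x‖ ≤ (1 + ‖z‖) * (1 + ‖x - z‖) := by
    have : ‖x‖ ≤ ‖z‖ + ‖x - z‖ := by simpa using norm_add_le z (x - z)
    nlinarith [norm_nonneg z, norm_nonneg (x - z), mul_nonneg (norm_nonneg z) (norm_nonneg (x - z))]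
  calc ‖x‖ ^ k * ‖iteratedFDeriv ℝ l η (x - z)‖
      ≤ ((1 + ‖z‖) * (1 + ‖x - z‖)) ^ k * ‖iteratedFDeriv ℝ l η (x - z)‖ := by gcongr
    _ = (1 + ‖z‖) ^ k * ((1 + ‖x - z‖) ^ k * ‖iteratedFDeriv ℝ l η (x - z)‖) := by
        rw [mul_pow]; ring
    _ ≤ (1 + ‖z‖) ^ k * K := by gcongr; exact h _
    _ = _ := mul_comm _ _

/-- The mean value inequality on the ball of radius `‖z' - z‖ ≤ 1` about `x - z`: there `‖x‖ ≤ (2 +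
‖z‖) (1 + ‖w‖)`, so the decay of the derivative of order `l + 1` absorbs the factor `‖x‖ ^ k`. This
yields continuity of translation in the Schwartz topology. -/
theorem norm_pow_mul_iteratedFDeriv_sub_sub_le (η : 𝓢(Rd d, F)) (k l : ℕ) :
    ∃ K : ℝ, 0 ≤ K ∧ ∀ z z' x, ‖z' - z‖ ≤ 1 →
      ‖x‖ ^ k * ‖iteratedFDeriv ℝ l η (x - z') - iteratedFDeriv ℝ l η (x - z)‖
        ≤ K * (2 + ‖z‖) ^ k * ‖z' - z‖ := by
  obtain ⟨K, hK, h⟩ := one_add_norm_pow_mul_iteratedFDeriv_le η k (l + 1)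
  refine ⟨K, hK, fun z z' x hz => ?_⟩
  have hdiff : Differentiable ℝ (iteratedFDeriv ℝ l η) :=
    (η.smooth ⊤).differentiable_iteratedFDeriv (by exact_mod_cast WithTop.coe_lt_top l)
  have key := Convex.norm_image_sub_le_of_norm_fderiv_le (𝕜 := ℝ)
    (f := fun w => ‖x‖ ^ k • iteratedFDeriv ℝ l η w) (C := K * (2 + ‖z‖) ^ k)
    (s := Metric.closedBall (x - z) ‖z' - z‖) (x := x - z) (y := x - z')
    (fun w _ => (hdiff w).fun_const_smul _) ?_ (convex_closedBall _ _)
    (Metric.mem_closedBall_self (norm_nonneg _)) ?_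
  · rw [← smul_sub, norm_smul, norm_pow, norm_norm] at key
    convert key using 2
    rw [← norm_neg]; congr 1; abel
  · intro w hw
    rw [fderiv_fun_const_smul (hdiff w), norm_smul, norm_pow, norm_norm, norm_fderiv_iteratedFDeriv]
    have hw' : ‖w - (x - z)‖ ≤ 1 := (mem_closedBall_iff_norm.1 hw).trans hz
    have h1 : ‖x‖ ≤ (2 + ‖z‖) * (1 + ‖w‖) := by
      have : ‖x‖ ≤ ‖w‖ + ‖z‖ + ‖w - (x - z)‖ := by
        calc ‖x‖ = ‖w + z - (w - (x - z))‖ := by congr 1; abel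
          _ ≤ _ := (norm_sub_le _ _).trans (by gcongr; exact norm_add_le _ _)
      nlinarith [norm_nonneg z, norm_nonneg w, mul_nonneg (norm_nonneg z) (norm_nonneg w)]
    calc ‖x‖ ^ k * ‖iteratedFDeriv ℝ (l + 1) η w‖
        ≤ ((2 + ‖z‖) * (1 + ‖w‖)) ^ k * ‖iteratedFDeriv ℝ (l + 1) η w‖ := by gcongr
      _ = (2 + ‖z‖) ^ k * ((1 + ‖w‖) ^ k * ‖iteratedFDeriv ℝ (l + 1) η w‖) := by
          rw [mul_pow]; ring
      _ ≤ (2 + ‖z‖) ^ k * K := by gcongr; exact h _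
      _ = _ := mul_comm _ _
  · rw [mem_closedBall_iff_norm, ← norm_neg]
    apply le_of_eq; congr 1; abel

theorem seminorm_translate_le (η : 𝓢(Rd d, ℂ)) (k l : ℕ) :
    ∃ K : ℝ, 0 ≤ K ∧ ∀ z, SchwartzMap.seminorm ℂ k l (η.compSubConstCLM ℂ z)
      ≤ K * (1 + ‖z‖) ^ k := by
  obtain ⟨K, hK, h⟩ := norm_pow_mul_iteratedFDeriv_sub_le η k l
  refine ⟨K, hK, fun z => SchwartzMap.seminorm_le_bound _ _ _ _ (by positivity) fun x => ?_⟩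
  have := iteratedFDeriv_comp_sub (𝕜 := ℝ) (f := η) l z x
  change ‖x‖ ^ k * ‖iteratedFDeriv ℝ l (fun y => η (y - z)) x‖ ≤ _
  rw [this]
  exact h z x

theorem continuous_translate (η : 𝓢(Rd d, ℂ)) :
    Continuous fun z : Rd d => η.compSubConstCLM ℂ z := by
  rw [continuous_iff_continuousAt]
  intro z
  refine ((schwartz_withSeminorms ℂ (Rd d) ℂ).tendsto_nhds _ _).2 ?_
  rintro ⟨k, l⟩ ε hε
  obtain ⟨K, hK, h⟩ := norm_pow_mul_iteratedFDeriv_sub_sub_le η k l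
  have hlim : Filter.Tendsto (fun z' => K * (2 + ‖z‖) ^ k * ‖z' - z‖) (nhds z) (nhds 0) := by
    have : Continuous fun z' => K * (2 + ‖z‖) ^ k * ‖z' - z‖ := by fun_prop
    simpa using this.tendsto z
  have hball : ∀ᶠ z' in nhds z, ‖z' - z‖ ≤ 1 := by
    filter_upwards [Metric.closedBall_mem_nhds z one_pos] with z' hz'
    simpa [dist_eq_norm] using hz'
  filter_upwards [hlim.eventually_lt_const hε, hball] with z' h1 h2
  refine lt_of_le_of_lt ?_ h1
  refine SchwartzMap.seminorm_le_bound _ _ _ _ (by positivity) fun x => ?_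
  have h3 := iteratedFDeriv_comp_sub (𝕜 := ℝ) (f := η) l z x
  have h4 := iteratedFDeriv_comp_sub (𝕜 := ℝ) (f := η) l z' x
  have h5 : iteratedFDeriv ℝ l (η.compSubConstCLM ℂ z' - η.compSubConstCLM ℂ z : 𝓢(Rd d, ℂ)) x
      = iteratedFDeriv ℝ l (fun y => η (y - z')) x - iteratedFDeriv ℝ l (fun y => η (y - z)) x := by
    have := iteratedFDeriv_sub_apply (𝕜 := ℝ) (i := l) (x := x)
      (f := (η.compSubConstCLM ℂ z' : 𝓢(Rd d, ℂ))) (g := (η.compSubConstCLM ℂ z : 𝓢(Rd d, ℂ)))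
      ((η.compSubConstCLM ℂ z').contDiffAt l) ((η.compSubConstCLM ℂ z).contDiffAt l)
    rw [← FunLike.coe_sub] at this
    exact this
  rw [h5, h3, h4]
  exact h z z' x h2

theorem integrable_one_add_norm_pow_mul (ψ : 𝓢(Rd d, ℂ)) (k : ℕ) :
    Integrable (fun z => (1 + ‖z‖) ^ k * ‖ψ z‖) := by
  have h0 := ψ.integrable_pow_mul volume 0
  have h1 := ψ.integrable_pow_mul volume k
  refine ((h0.add h1).const_mul (2 ^ k)).mono' (by fun_prop) (ae_of_all _ fun z => ?_)
  rw [Real.norm_of_nonneg (by positivity)]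
  simp only [Pi.add_apply, pow_zero, one_mul]
  have : (1 + ‖z‖) ^ k ≤ 2 ^ k * (1 + ‖z‖ ^ k) := by
    refine (add_pow_le (by norm_num) (norm_nonneg z) k).trans ?_
    rw [one_pow]
    gcongr
    · norm_num
    · omega
  calc _ ≤ 2 ^ k * (1 + ‖z‖ ^ k) * ‖ψ z‖ := by gcongr
    _ = _ := by ring

end translation

/-! ### Differentiating a convolution under the integral -/

section integral

theorem integrable_smul_iteratedFDeriv {d : ℕ} {F : Type*} [NormedAddCommGroup F]
    [NormedSpace ℝ F] [NormedSpace ℂ F] [SMulCommClass ℝ ℂ F] (ψ : 𝓢(Rd d, ℂ)) (η : 𝓢(Rd d, F))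
    (l : ℕ) (y : Rd d) : Integrable (fun z => ψ z • iteratedFDeriv ℝ l η (y + z)) := by
  obtain ⟨K, hK, h⟩ := one_add_norm_pow_mul_iteratedFDeriv_le η 0 l
  have hc : Continuous (iteratedFDeriv ℝ l η) :=
    (η.smooth ⊤).continuous_iteratedFDeriv (by exact_mod_cast le_top)
  refine (ψ.integrable.norm.mul_const K).mono' ?_ (ae_of_all _ fun z => ?_)
  · exact (ψ.continuous.smul (hc.comp (by fun_prop))).aestronglyMeasurable
  · rw [norm_smul]
    gcongr
    simpa using h (y + z)

theorem hasFDerivAt_integral_smul_translate {d : ℕ} {F : Type*} [NormedAddCommGroup F]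
    [NormedSpace ℝ F] [NormedSpace ℂ F] [SMulCommClass ℝ ℂ F] (ψ : 𝓢(Rd d, ℂ)) (η : 𝓢(Rd d, F))
    (y : Rd d) :
    HasFDerivAt (fun y => ∫ z, ψ z • η (y + z))
      (∫ z, ψ z • SchwartzMap.fderivCLM ℝ (Rd d) F η (y + z)) y := by
  obtain ⟨K, hK, h⟩ := one_add_norm_pow_mul_iteratedFDeriv_le
    (SchwartzMap.fderivCLM ℝ (Rd d) F η) 0 0
  have h' : ∀ x, ‖fderiv ℝ η x‖ ≤ K := fun x => by simpa using h x
  refine hasFDerivAt_integral_of_dominated_of_fderiv_le (𝕜 := ℝ) (s := Set.univ)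
    (bound := fun z => ‖ψ z‖ * K)
    (F' := fun y z => ψ z • SchwartzMap.fderivCLM ℝ (Rd d) F η (y + z))
    Filter.univ_mem (Filter.Eventually.of_forall fun y => ?_) ?_ ?_
    (ae_of_all _ fun z x _ => ?_) (ψ.integrable.norm.mul_const K)
    (ae_of_all _ fun z x _ => ?_)
  · exact (ψ.continuous.smul (η.continuous.comp (by fun_prop))).aestronglyMeasurable
  · obtain ⟨K₀, hK₀, h₀⟩ := one_add_norm_pow_mul_iteratedFDeriv_le η 0 0
    refine (ψ.integrable.norm.mul_const K₀).mono' ?_ (ae_of_all _ fun z => ?_)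
    · exact (ψ.continuous.smul (η.continuous.comp (by fun_prop))).aestronglyMeasurable
    · rw [norm_smul]
      gcongr
      simpa using h₀ (y + z)
  · exact (ψ.continuous.smul ((SchwartzMap.fderivCLM ℝ (Rd d) F η).continuous.comp
      (by fun_prop))).aestronglyMeasurable
  · rw [norm_smul]
    gcongr
    exact h' _
  · have := (η.differentiableAt (x := x + z)).hasFDerivAt
    have h2 := this.comp x ((hasFDerivAt_id x).add_const z)
    refine (h2.const_smul (ψ z)).congr_fderiv ?_
    ext v
    simp [SchwartzMap.fderivCLM_apply]

/-- Induction on the order: one derivative under the integral replaces `η` by its Fréchet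
derivative, whose values lie in another space. For this reason `F` is quantified after `l`. -/
theorem iteratedFDeriv_integral_smul_translate {d : ℕ} (ψ : 𝓢(Rd d, ℂ)) (l : ℕ) :
    ∀ {F : Type} [NormedAddCommGroup F] [NormedSpace ℝ F] [NormedSpace ℂ F] [SMulCommClass ℝ ℂ F]
      [CompleteSpace F] (η : 𝓢(Rd d, F)) (y : Rd d),
    iteratedFDeriv ℝ l (fun y => ∫ z, ψ z • η (y + z)) y
      = ∫ z, ψ z • iteratedFDeriv ℝ l η (y + z) := by
  induction l with
  | zero =>
    intro F _ _ _ _ _ η y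
    ext m
    rw [ContinuousMultilinearMap.integral_apply (integrable_smul_iteratedFDeriv ψ η 0 y)]
    simp
  | succ l ih =>
    intro F _ _ _ _ _ η y
    ext m
    rw [ContinuousMultilinearMap.integral_apply (integrable_smul_iteratedFDeriv ψ η (l + 1) y),
      iteratedFDeriv_succ_apply_right]
    have h1 : (fun y => fderiv ℝ (fun y => ∫ z, ψ z • η (y + z)) y)
        = fun y => ∫ z, ψ z • SchwartzMap.fderivCLM ℝ (Rd d) F η (y + z) := by
      ext1 y
      exact (hasFDerivAt_integral_smul_translate ψ η y).fderiv
    have h_integrable := integrable_smul_iteratedFDeriv ψ (SchwartzMap.fderivCLM ℝ (Rd d) F η) l y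
    rw [h1, ih, ContinuousMultilinearMap.integral_apply h_integrable, ContinuousLinearMap.integral_apply]
    · refine integral_congr_ae (ae_of_all _ fun z => ?_)
      simp only [smul_apply]
      rw [iteratedFDeriv_succ_apply_right]
      rfl
    · exact (ContinuousMultilinearMap.apply ℝ _ _ (Fin.init m)).integrable_comp h_integrable

end integral

/-! ### Applying a tempered distribution under an integral -/

section pairing
open BoundedContinuousFunction

variable {d : ℕ}

/-- The Banach space of bounded continuous functions whose values are `l`-linear forms. -/
def BoundedForms (d l : ℕ) : Type :=
  Rd d →ᵇ (ContinuousMultilinearMap ℝ (fun _ : Fin l => Rd d) ℂ)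

instance (d l : ℕ) : NormedAddCommGroup (BoundedForms d l) :=
  inferInstanceAs (NormedAddCommGroup
    (Rd d →ᵇ (ContinuousMultilinearMap ℝ (fun _ : Fin l => Rd d) ℂ)))

instance (d l : ℕ) : NormedSpace ℂ (BoundedForms d l) :=
  inferInstanceAs (NormedSpace ℂ (Rd d →ᵇ (ContinuousMultilinearMap ℝ (fun _ : Fin l => Rd d) ℂ)))

instance (d l : ℕ) : CompleteSpace (BoundedForms d l) :=
  inferInstanceAs (CompleteSpace (Rd d →ᵇ (ContinuousMultilinearMap ℝ (fun _ : Fin l => Rd d) ℂ)))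

instance (d l : ℕ) : FunLike (BoundedForms d l) (Rd d)
    (ContinuousMultilinearMap ℝ (fun _ : Fin l => Rd d) ℂ) :=
  inferInstanceAs (FunLike (Rd d →ᵇ (ContinuousMultilinearMap ℝ (fun _ : Fin l => Rd d) ℂ)) _ _)

theorem BoundedForms.norm_apply_le {l : ℕ} (u : BoundedForms d l) (x : Rd d) : ‖u x‖ ≤ ‖u‖ :=
  BoundedContinuousFunction.norm_coe_le_norm (β := ContinuousMultilinearMap ℝ _ ℂ) u x

theorem BoundedForms.norm_le_of_forall {l : ℕ} (u : BoundedForms d l) {C : ℝ} (hC : 0 ≤ C)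
    (h : ∀ x, ‖u x‖ ≤ C) : ‖u‖ ≤ C :=
  (BoundedContinuousFunction.norm_le (β := ContinuousMultilinearMap ℝ _ ℂ) hC).2 h

/-- Evaluation at a point. -/
def BoundedForms.evalCLM {l : ℕ} (x : Rd d) :
    BoundedForms d l →L[ℂ] (ContinuousMultilinearMap ℝ (fun _ : Fin l => Rd d) ℂ) :=
  LinearMap.mkContinuous
    { toFun := fun u => u x
      map_add' := fun _ _ => rfl
      map_smul' := fun _ _ => rfl } 1 (fun u => (u.norm_apply_le x).trans (one_mul _).ge)

/-- The function `x ↦ ‖x‖ ^ k • D ^ l g x`, whose supremum norm is the Schwartz seminorm. -/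
def weightedDerivCLM (d k l : ℕ) :
    𝓢(Rd d, ℂ) →L[ℂ] BoundedForms d l :=
  SchwartzMap.mkCLMtoNormedSpace
    (fun g => ofNormedAddCommGroup (fun x => ‖x‖ ^ k • iteratedFDeriv ℝ l g x)
      ((continuous_norm.pow k).smul
        ((g.smooth ⊤).continuous_iteratedFDeriv (by exact_mod_cast le_top)))
      (SchwartzMap.seminorm ℂ k l g)
      (fun x => by rw [norm_smul, norm_pow, norm_norm]; exact SchwartzMap.le_seminorm ℂ k l g x))
    (fun f g => by
      refine DFunLike.ext _ _ fun x => ?_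
      have := iteratedFDeriv_add_apply (𝕜 := ℝ) (i := l) (x := x) (f.contDiffAt l) (g.contDiffAt l)
      rw [← FunLike.coe_add] at this
      change ‖x‖ ^ k • iteratedFDeriv ℝ l (f + g : 𝓢(Rd d, ℂ)) x = _
      rw [this, smul_add]
      rfl)
    (fun a f => by
      refine DFunLike.ext _ _ fun x => ?_
      have := iteratedFDeriv_const_smul_apply (𝕜 := ℝ) (a := a) (i := l) (x := x)
        (f.contDiffAt l)
      rw [← FunLike.coe_smul] at this
      change ‖x‖ ^ k • iteratedFDeriv ℝ l (a • f : 𝓢(Rd d, ℂ)) x = _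
      rw [this, smul_comm]
      rfl)
    ⟨{(k, l)}, 1, zero_le_one, fun f => by
      simp only [Finset.sup_singleton, one_mul]
      refine BoundedForms.norm_le_of_forall _ (apply_nonneg _ _) fun x => ?_
      change ‖‖x‖ ^ k • iteratedFDeriv ℝ l f x‖ ≤ _
      rw [norm_smul, norm_pow, norm_norm]
      exact SchwartzMap.le_seminorm ℂ k l f x⟩

theorem weightedDerivCLM_apply (k l : ℕ) (g : 𝓢(Rd d, ℂ)) (x : Rd d) :
    weightedDerivCLM d k l g x = ‖x‖ ^ k • iteratedFDeriv ℝ l g x := rfl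

theorem seminorm_le_norm_weightedDerivCLM (k l : ℕ) (g : 𝓢(Rd d, ℂ)) :
    SchwartzMap.seminorm ℂ k l g ≤ ‖weightedDerivCLM d k l g‖ := by
  refine SchwartzMap.seminorm_le_bound _ _ _ _ (norm_nonneg _) fun x => ?_
  have := (weightedDerivCLM d k l g).norm_apply_le x
  rwa [weightedDerivCLM_apply, norm_smul, norm_pow, norm_norm] at this

theorem norm_weightedDerivCLM_le (k l : ℕ) (g : 𝓢(Rd d, ℂ)) :
    ‖weightedDerivCLM d k l g‖ ≤ SchwartzMap.seminorm ℂ k l g := by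
  refine BoundedForms.norm_le_of_forall _ (apply_nonneg _ _) fun x => ?_
  rw [weightedDerivCLM_apply, norm_smul, norm_pow, norm_norm]
  exact SchwartzMap.le_seminorm ℂ k l g x

/-- As a Bochner integral in a Banach space the convolution commutes with continuous linear maps.
Seminorms of translates grow polynomially and `ψ` decays faster, which gives integrability; the
identity is checked by evaluating at each point. -/
theorem weightedDerivCLM_integral (ψ η θ : 𝓢(Rd d, ℂ)) (hθ : ∀ y, θ y = ∫ z, ψ z * η (y + z))
    (k l : ℕ) :
    Integrable (fun z => ψ z • weightedDerivCLM d k l (η.compSubConstCLM ℂ (-z))) ∧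
    weightedDerivCLM d k l θ
      = ∫ z, ψ z • weightedDerivCLM d k l (η.compSubConstCLM ℂ (-z)) := by
  have h_integrable : Integrable (fun z => ψ z • weightedDerivCLM d k l (η.compSubConstCLM ℂ (-z))) := by
    obtain ⟨K, hK, h⟩ := seminorm_translate_le η k l
    refine ((integrable_one_add_norm_pow_mul ψ k).const_mul K).mono' ?_ (ae_of_all _ fun z => ?_)
    · exact (ψ.continuous.smul ((weightedDerivCLM d k l).continuous.comp
        ((continuous_translate η).comp continuous_neg))).aestronglyMeasurable
    · rw [norm_smul]
      calc ‖ψ z‖ * _ ≤ ‖ψ z‖ * (K * (1 + ‖-z‖) ^ k) := by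
            gcongr; exact (norm_weightedDerivCLM_le _ _ _).trans (h (-z))
        _ = _ := by rw [norm_neg]; ring
  refine ⟨h_integrable, ?_⟩
  refine DFunLike.ext _ _ fun x => ?_
  have h1 := (BoundedForms.evalCLM x).integral_comp_comm h_integrable
  have h2 : BoundedForms.evalCLM x (∫ z, ψ z • weightedDerivCLM d k l (η.compSubConstCLM ℂ (-z)))
      = (∫ z, ψ z • weightedDerivCLM d k l (η.compSubConstCLM ℂ (-z))) x := rfl
  rw [← h2, ← h1, weightedDerivCLM_apply]
  have h3 : (θ : Rd d → ℂ) = fun y => ∫ z, ψ z • η (y + z) := funext hθ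
  rw [h3, iteratedFDeriv_integral_smul_translate ψ l η x, ← integral_smul]
  refine integral_congr_ae (ae_of_all _ fun z => ?_)
  have h4 := iteratedFDeriv_comp_sub (𝕜 := ℝ) (f := η) l (-z) x
  change _ = ψ z • (‖x‖ ^ k • iteratedFDeriv ℝ l (fun y => η (y - -z)) x)
  rw [h4, sub_neg_eq_add, smul_comm]

variable {X : Type*} [NormedAddCommGroup X] [NormedSpace ℂ X]

theorem exists_seminorm_bound (f : 𝓢'(Rd d, X)) :
    ∃ (s : Finset (ℕ × ℕ)) (C : ℝ≥0), ∀ g, ‖f g‖ ≤ C * s.sup (schwartzSeminormFamily ℂ (Rd d) ℂ) g := by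
  obtain ⟨s, C, -, h⟩ := Seminorm.bound_of_continuous (schwartz_withSeminorms ℂ (Rd d) ℂ)
    ((normSeminorm ℂ X).comp (f : 𝓢(Rd d, ℂ) →ₗ[ℂ] X)) (continuous_norm.comp (map_continuous f))
  exact ⟨s, C, fun g => h g⟩

theorem exists_norm_translate_le (f : 𝓢'(Rd d, X)) (η : 𝓢(Rd d, ℂ)) :
    ∃ (K : ℝ) (m : ℕ), 0 ≤ K ∧ ∀ z, ‖f (η.compSubConstCLM ℂ z)‖ ≤ K * (1 + ‖z‖) ^ m := by
  obtain ⟨s, C, h⟩ := exists_seminorm_bound f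
  choose K hK hKle using fun i : ℕ × ℕ => seminorm_translate_le η i.1 i.2
  refine ⟨C * ∑ i ∈ s, K i, s.sup Prod.fst, mul_nonneg C.2 (Finset.sum_nonneg fun i _ => hK i),
    fun z => (h _).trans ?_⟩
  rw [mul_assoc]
  gcongr
  have h0 : 0 ≤ (∑ i ∈ s, K i) * (1 + ‖z‖) ^ (s.sup Prod.fst) :=
    mul_nonneg (Finset.sum_nonneg fun i _ => hK i) (by positivity)
  refine Seminorm.finset_sup_apply_le h0 fun i hi => (hKle i z).trans ?_
  have h1 : 1 ≤ 1 + ‖z‖ := by simp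
  have h2 : i.1 ≤ s.sup Prod.fst := Finset.le_sup (f := Prod.fst) hi
  have h3 : K i ≤ ∑ i ∈ s, K i := Finset.single_le_sum (fun i _ => hK i) hi
  exact mul_le_mul h3 (pow_le_pow_right₀ h1 h2) (by positivity) ((hK i).trans h3)

theorem continuous_pairing_translate (f : 𝓢'(Rd d, X)) (η : 𝓢(Rd d, ℂ)) :
    Continuous fun z => f (η.compSubConstCLM ℂ z) :=
  (map_continuous f).comp (continuous_translate η)

/-- A scalar tempered distribution may be applied under the integral sign of a convolution. -/
theorem apply_integral_translate_scalar (f : 𝓢(Rd d, ℂ) →ₗ[ℂ] ℂ) (s : Finset (ℕ × ℕ)) (C : ℝ≥0)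
    (hf : ∀ g, ‖f g‖ ≤ C * s.sup (schwartzSeminormFamily ℂ (Rd d) ℂ) g) (ψ η θ : 𝓢(Rd d, ℂ))
    (hθ : ∀ y, θ y = ∫ z, ψ z * η (y + z)) :
    f θ = ∫ z, ψ z * f (η.compSubConstCLM ℂ (-z)) := by
  -- `J` records the finitely many seminorms that control `f`, so `f` factors through the range of
  -- `J` and is bounded there in the product norm.
  let J : 𝓢(Rd d, ℂ) →L[ℂ] ((i : s) → BoundedForms d i.1.2) :=
    ContinuousLinearMap.pi fun i : s => weightedDerivCLM d i.1.1 i.1.2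
  have hJ : ∀ g, ‖f g‖ ≤ C * ‖J g‖ := fun g => (hf g).trans <| by
    gcongr
    refine Seminorm.finset_sup_apply_le (norm_nonneg _) fun i hi => ?_
    exact (seminorm_le_norm_weightedDerivCLM i.1 i.2 g).trans (norm_le_pi_norm (J g) ⟨i, hi⟩)
  have hker : LinearMap.ker J.toLinearMap ≤ LinearMap.ker f := fun g hg => by
    have h0 : J g = 0 := hg
    have := hJ g
    rw [h0, norm_zero, mul_zero] at this
    simpa using this
  let f' : LinearMap.range J.toLinearMap →ₗ[ℂ] ℂ :=
    (LinearMap.ker J.toLinearMap).liftQ f hker ∘ₗ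
      (LinearMap.quotKerEquivRange J.toLinearMap).symm.toLinearMap
  have hf' : ∀ g, f' ⟨J g, ⟨g, rfl⟩⟩ = f g := fun g => by
    have : (LinearMap.quotKerEquivRange J.toLinearMap).symm ⟨J g, ⟨g, rfl⟩⟩
        = (LinearMap.ker J.toLinearMap).mkQ g :=
      LinearMap.quotKerEquivRange_symm_apply_image _ g _
    simp only [f', LinearMap.comp_apply, LinearEquiv.coe_coe]
    rw [this, Submodule.mkQ_apply, Submodule.liftQ_apply]
  -- Hahn-Banach extends the factored functional to the whole product of Banach spaces, where it
  -- commutes with the Bochner integral. This is why the values are scalar.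
  obtain ⟨L, hL, -⟩ := exists_extension_norm_eq _ (f'.mkContinuous C (by
    rintro ⟨_, g, rfl⟩
    exact (congrArg norm (hf' g)).le.trans (hJ g)))
  have hLJ : ∀ g, L (J g) = f g := fun g => (hL ⟨J g, ⟨g, rfl⟩⟩).trans (hf' g)
  have h_integrable : Integrable (fun z => ψ z • J (η.compSubConstCLM ℂ (-z))) :=
    Integrable.of_eval fun i => (weightedDerivCLM_integral ψ η θ hθ i.1.1 i.1.2).1
  have hJθ : J θ = ∫ z, ψ z • J (η.compSubConstCLM ℂ (-z)) := by
    ext i : 1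
    rw [eval_integral]
    · exact (weightedDerivCLM_integral ψ η θ hθ i.1.1 i.1.2).2
    · exact fun i => (weightedDerivCLM_integral ψ η θ hθ i.1.1 i.1.2).1
  rw [← hLJ, hJθ, ← L.integral_comp_comm h_integrable]
  refine integral_congr_ae (ae_of_all _ fun z => ?_)
  simp only [map_smul, hLJ, smul_eq_mul]

theorem integrable_smul_pairing_translate (f : 𝓢'(Rd d, X)) (ψ η : 𝓢(Rd d, ℂ)) :
    Integrable fun z => ψ z • f (η.compSubConstCLM ℂ (-z)) := by
  obtain ⟨K, m, hK, h⟩ := exists_norm_translate_le f η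
  refine ((integrable_one_add_norm_pow_mul ψ m).const_mul K).mono' ?_ (ae_of_all _ fun z => ?_)
  · exact (ψ.continuous.smul ((continuous_pairing_translate f η).comp
      continuous_neg)).aestronglyMeasurable
  · rw [norm_smul]
    calc ‖ψ z‖ * _ ≤ ‖ψ z‖ * (K * (1 + ‖-z‖) ^ m) := by gcongr; exact h (-z)
      _ = _ := by rw [norm_neg]; ring

/-- A tempered distribution may be applied under the integral sign of a convolution. -/
theorem apply_integral_translate [CompleteSpace X] (f : 𝓢'(Rd d, X)) (ψ η θ : 𝓢(Rd d, ℂ))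
    (hθ : ∀ y, θ y = ∫ z, ψ z * η (y + z)) :
    f θ = ∫ z, ψ z • f (η.compSubConstCLM ℂ (-z)) := by
  -- Continuous functionals separate the points of `X`, so the scalar case suffices.
  refine (SeparatingDual.eq_iff_forall_dual_eq (R := ℂ)).2 fun Λ => ?_
  rw [← Λ.integral_comp_comm (integrable_smul_pairing_translate f ψ η)]
  obtain ⟨s, C, h⟩ := exists_seminorm_bound f
  have := apply_integral_translate_scalar ((Λ : X →ₗ[ℂ] ℂ) ∘ₗ (f : 𝓢(Rd d, ℂ) →ₗ[ℂ] X)) s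
    (‖Λ‖₊ * C) (fun g => by
      refine (Λ.le_opNorm (f g)).trans ?_
      rw [NNReal.coe_mul, mul_assoc]
      gcongr
      · exact le_rfl
      · exact h g) ψ η θ hθ
  refine this.trans (integral_congr_ae (ae_of_all _ fun z => ?_))
  simp

end pairing

/-! ### The unitary Fourier transform and its symmetries -/

section fourier
open scoped FourierTransform
variable {d : ℕ}

/-- The normalizing constant of the unitary Fourier transform. -/
def unitaryConst (d : ℕ) : ℂ := (((2 * Real.pi) ^ (-(d : ℝ) / 2) : ℝ) : ℂ)

theorem unitaryConst_ne_zero (d : ℕ) : unitaryConst d ≠ 0 := by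
  rw [unitaryConst, Complex.ofReal_ne_zero]
  positivity

theorem hat_eq (φ : 𝓢(Rd d, ℂ)) (ξ : Rd d) :
    hat φ ξ = unitaryConst d * 𝓕 φ ((2 * Real.pi)⁻¹ • ξ) := by
  rw [hat, unitaryConst, SchwartzMap.fourier_coe, Real.fourier_eq']
  congr 1
  refine integral_congr_ae (ae_of_all _ fun x => ?_)
  simp only [smul_eq_mul]
  rw [mul_comm]
  congr 2
  rw [inner_smul_right]
  have : (Real.pi : ℂ) ≠ 0 := by exact_mod_cast Real.pi_ne_zero
  push_cast
  field_simp

theorem fourier_eq_hat (φ : 𝓢(Rd d, ℂ)) (ξ : Rd d) :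
    𝓕 φ ξ = (unitaryConst d)⁻¹ * hat φ ((2 * Real.pi) • ξ) := by
  rw [hat_eq, inv_mul_cancel_left₀ (unitaryConst_ne_zero d), smul_smul,
    inv_mul_cancel₀ (by positivity), one_smul]

/-- Convolution with `φ` acts as multiplication by `m` on functions on whose spectrum `φ̂ = m`. -/
theorem unitaryConst_mul_convolution_eq (φ g : 𝓢(Rd d, ℂ)) (m : ℂ)
    (h : ∀ ξ, hat φ ξ * hat g ξ = m * hat g ξ) (x : Rd d) :
    unitaryConst d * ∫ y, g y * φ (x - y) = m * g x := by
  have key : unitaryConst d • SchwartzMap.convolution (ContinuousLinearMap.mul ℂ ℂ) g φ = m • g := by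
    have hinj : Function.Injective (𝓕 : 𝓢(Rd d, ℂ) → 𝓢(Rd d, ℂ)) := fun a b hab => by
      simpa using congrArg (fun u : 𝓢(Rd d, ℂ) => 𝓕⁻ u) hab
    apply hinj
    rw [FourierTransform.fourier_smul, FourierTransform.fourier_smul,
      SchwartzMap.fourier_convolution]
    ext ξ
    have := h ((2 * Real.pi) • ξ)
    simp only [smul_apply, SchwartzMap.pairing_apply_apply, ContinuousLinearMap.mul_apply',
      smul_eq_mul]
    rw [fourier_eq_hat, fourier_eq_hat]
    have hc := unitaryConst_ne_zero d
    field_simp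
    linear_combination this
  have h2 := congrArg (fun u : 𝓢(Rd d, ℂ) => u x) key
  simp only [smul_apply, SchwartzMap.convolution_apply, smul_eq_mul] at h2
  exact h2

/-- The dilation `x ↦ φ (t x)` of a Schwartz function. -/
def dilate (t : ℝ) (ht : t ≠ 0) (φ : 𝓢(Rd d, ℂ)) : 𝓢(Rd d, ℂ) :=
  SchwartzMap.compCLMOfContinuousLinearEquiv ℂ
    (ContinuousLinearEquiv.smulLeft (Units.mk0 t ht)) φ

theorem dilate_apply (t : ℝ) (ht : t ≠ 0) (φ : 𝓢(Rd d, ℂ)) (x : Rd d) :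
    dilate t ht φ x = φ (t • x) := rfl

theorem hat_dilate {t : ℝ} (ht : 0 < t) (φ : 𝓢(Rd d, ℂ)) (ξ : Rd d) :
    hat (dilate t ht.ne' φ) ξ = ((t ^ d)⁻¹ : ℝ) * hat φ (t⁻¹ • ξ) := by
  have h := Measure.integral_comp_smul volume
    (fun x : Rd d => φ x * Complex.exp (-(Complex.I * ((inner ℝ x (t⁻¹ • ξ) : ℝ) : ℂ)))) t
  rw [finrank_euclideanSpace_fin, abs_of_nonneg (by positivity)] at h
  rw [Complex.real_smul] at h
  rw [hat, hat, mul_left_comm, ← h]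
  congr 1
  refine integral_congr_ae (ae_of_all _ fun x => ?_)
  simp only [dilate_apply, inner_smul_left, inner_smul_right]
  have : (t : ℂ) ≠ 0 := by exact_mod_cast ht.ne'
  simp [inv_mul_cancel_left₀ this]

theorem hat_smul (a : ℂ) (φ : 𝓢(Rd d, ℂ)) (ξ : Rd d) : hat (a • φ) ξ = a * hat φ ξ := by
  have : (∫ x, (a • φ) x * Complex.exp (-(Complex.I * ((inner ℝ x ξ : ℝ) : ℂ))))
      = a * ∫ x, φ x * Complex.exp (-(Complex.I * ((inner ℝ x ξ : ℝ) : ℂ))) := by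
    rw [← integral_const_mul]
    simp [mul_assoc]
  rw [hat, hat, this, mul_left_comm]

theorem hat_translate (a : Rd d) (φ : 𝓢(Rd d, ℂ)) (ξ : Rd d) :
    hat (φ.compSubConstCLM ℂ a) ξ
      = Complex.exp (-(Complex.I * ((inner ℝ a ξ : ℝ) : ℂ))) * hat φ ξ := by
  rw [hat, hat, mul_left_comm]
  congr 1
  rw [← integral_const_mul, ← integral_sub_right_eq_self (fun x => _ * (φ x * _)) a]
  refine integral_congr_ae (ae_of_all _ fun x => ?_)
  simp only [SchwartzMap.compSubConstCLM_apply, inner_sub_left]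
  rw [mul_left_comm, ← Complex.exp_add]
  congr 2
  push_cast
  ring

theorem enorm_le_bracket (ψ : 𝓢(Rd d, ℂ)) (M : ℝ) :
    ∃ A : ℝ≥0∞, A ≠ ∞ ∧ ∀ x, ‖ψ x‖ₑ ≤ A * (1 + ‖x‖ₑ) ^ (-M) := by
  obtain ⟨n, hn⟩ := exists_nat_ge M
  obtain ⟨K, hK, h⟩ := one_add_norm_pow_mul_iteratedFDeriv_le ψ n 0
  refine ⟨ENNReal.ofReal K, by simp, fun x => ?_⟩
  have h1 : (1 + ‖x‖ₑ) ^ (n : ℝ) * ‖ψ x‖ₑ ≤ ENNReal.ofReal K := by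
    have h2 := ENNReal.ofReal_le_ofReal (h x)
    rwa [norm_iteratedFDeriv_zero, ENNReal.ofReal_mul (by positivity), ENNReal.ofReal_pow
      (by positivity), ENNReal.ofReal_add zero_le_one (by positivity), ofReal_norm, ofReal_norm,
      ENNReal.ofReal_one, ← ENNReal.rpow_natCast] at h2
  calc ‖ψ x‖ₑ = (1 + ‖x‖ₑ) ^ (-(n : ℝ)) * ((1 + ‖x‖ₑ) ^ (n : ℝ) * ‖ψ x‖ₑ) := by
        rw [← mul_assoc, ← ENNReal.rpow_add _ _ (bracket_ne_zero x) (bracket_ne_top x)]; simp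
    _ ≤ (1 + ‖x‖ₑ) ^ (-M) * ENNReal.ofReal K := by
        exact mul_le_mul' (bracket_rpow_le_rpow x (by linarith)) h1
    _ = _ := mul_comm _ _

end fourier

/-! ### Littlewood-Paley pieces and their reproducing formula -/

section pieces
variable {d : ℕ} {X : Type*} [NormedAddCommGroup X] [NormedSpace ℂ X]

theorem reflectTranslate_eq_translate (φ : 𝓢(Rd d, ℂ)) (x z : Rd d) :
    (reflectTranslate φ x).compSubConstCLM ℂ z = reflectTranslate φ (x + z) := by
  ext y
  simp only [SchwartzMap.compSubConstCLM_apply, reflectTranslate_apply]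
  congr 1
  abel

/-- The values of a piece are pairings with the translates of one fixed Schwartz function, so
continuity and polynomial growth follow from those of such pairings. -/
theorem lpPiece_eq (φ : 𝓢(Rd d, ℂ)) (f : 𝓢'(Rd d, X)) (x : Rd d) :
    lpPiece φ f x = unitaryConst d • f ((reflectTranslate φ 0).compSubConstCLM ℂ x) := by
  rw [reflectTranslate_eq_translate, zero_add]
  rfl

theorem continuous_lpPiece (φ : 𝓢(Rd d, ℂ)) (f : 𝓢'(Rd d, X)) : Continuous (lpPiece φ f) := by
  rw [show lpPiece φ f = fun x => _ from funext (lpPiece_eq φ f)]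
  exact (continuous_pairing_translate f _).const_smul _

theorem enorm_lpPiece_le (φ : 𝓢(Rd d, ℂ)) (f : 𝓢'(Rd d, X)) :
    ∃ (K : ℝ≥0∞) (m : ℝ), K ≠ ∞ ∧ 0 ≤ m ∧ ∀ x, ‖lpPiece φ f x‖ₑ ≤ K * (1 + ‖x‖ₑ) ^ m := by
  obtain ⟨K, m, hK, h⟩ := exists_norm_translate_le f (reflectTranslate φ 0)
  refine ⟨‖unitaryConst d‖ₑ * ENNReal.ofReal K, m, by finiteness, by positivity, fun x => ?_⟩
  rw [lpPiece_eq, enorm_smul, mul_assoc]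
  gcongr
  have h2 := ENNReal.ofReal_le_ofReal (h x)
  rwa [ofReal_norm, ENNReal.ofReal_mul (by positivity), ENNReal.ofReal_pow
      (by positivity), ENNReal.ofReal_add zero_le_one (by positivity), ofReal_norm,
      ENNReal.ofReal_one, ← ENNReal.rpow_natCast] at h2

/-- The reproducing formula for Littlewood--Paley pieces. -/
theorem lpPiece_reproducing [CompleteSpace X] (φ ψ : 𝓢(Rd d, ℂ)) (f : 𝓢'(Rd d, X))
    (h : ∀ ξ, hat ψ ξ * hat φ ξ = hat φ ξ) (x : Rd d) :
    lpPiece φ f x = ∫ z, (unitaryConst d * ψ z) • lpPiece φ f (x - z) := by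
  -- Since `ψ̂ φ̂ = φ̂`, the function `φ` is its own normalized convolution with `ψ`. This is that
  -- identity at `x - y`, with `z` substituted as the argument of `ψ`.
  have h1 : ∀ y, reflectTranslate φ x y
      = ∫ z, (unitaryConst d • ψ) z * reflectTranslate φ x (y + z) := by
    intro y
    have := unitaryConst_mul_convolution_eq ψ φ 1 (fun ξ => by rw [h, one_mul]) (x - y)
    rw [one_mul] at this
    rw [reflectTranslate_apply, ← this, ← integral_const_mul,
      ← integral_sub_left_eq_self _ volume (x - y)]
    refine integral_congr_ae (ae_of_all _ fun z => ?_)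
    simp only [smul_apply, smul_eq_mul, reflectTranslate_apply, sub_sub_cancel, sub_add_eq_sub_sub]
    ring
  have h2 := apply_integral_translate f _ _ _ h1
  rw [lpPiece, h2, ← integral_smul]
  refine integral_congr_ae (ae_of_all _ fun z => ?_)
  simp only [smul_apply, smul_eq_mul]
  rw [reflectTranslate_eq_translate, ← sub_eq_add_neg, smul_comm]
  rfl

theorem enorm_lpPiece_le_lintegral [CompleteSpace X] (φ ψ : 𝓢(Rd d, ℂ)) (f : 𝓢'(Rd d, X))
    (h : ∀ ξ, hat ψ ξ * hat φ ξ = hat φ ξ) (x : Rd d) :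
    ‖lpPiece φ f x‖ₑ ≤ ∫⁻ z, ‖unitaryConst d * ψ z‖ₑ * ‖lpPiece φ f (x - z)‖ₑ := by
  conv_lhs => rw [lpPiece_reproducing φ ψ f h x]
  refine (enorm_integral_le_lintegral_enorm _).trans (le_of_eq ?_)
  simp only [enorm_smul]

theorem IsLittlewoodPaley.hat_eq_zero {φ : ℕ → 𝓢(Rd d, ℂ)} (hφ : IsLittlewoodPaley φ) (k : ℕ)
    {ξ : Rd d} (hξ : 3 / 2 * 2 ^ k ≤ ‖ξ‖) : hat (φ k) ξ = 0 := by
  rcases Nat.eq_zero_or_pos k with rfl | hk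
  · exact hφ.eq_zero ξ (by simpa using hξ)
  · have h2 : (0 : ℝ) < 2 ^ k := by positivity
    have h1 : 3 / 2 ≤ ‖(2 : ℝ) ^ (-(k : ℤ)) • ξ‖ := by
      rw [norm_smul, zpow_neg, zpow_natCast, Real.norm_of_nonneg (by positivity), inv_mul_eq_div,
        le_div_iff₀ h2]
      exact hξ
    have h3 : ‖(2 : ℝ) ^ (-(k : ℤ) + 1) • ξ‖ = 2 * ‖(2 : ℝ) ^ (-(k : ℤ)) • ξ‖ := by
      rw [norm_smul, norm_smul, zpow_add₀ two_ne_zero, norm_mul]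
      simp; ring
    rw [hφ.dyadic k hk, hφ.eq_zero _ h1, hφ.eq_zero _ (by rw [h3]; linarith), sub_zero]

/-- The kernel that reproduces the dilated Littlewood--Paley pieces. -/
def reproducingKernel (φ : ℕ → 𝓢(Rd d, ℂ)) : 𝓢(Rd d, ℂ) :=
  (unitaryConst d * 2 ^ d) • dilate 2 two_ne_zero (φ 0)

/-- The multiplier `φ̂₀(2 ^ (-(k + 1)) ξ)` equals one for `‖ξ‖ ≤ 2 ^ (k + 1)`, hence on the support
of `φ̂ₖ`. Its kernel is a dilate of `φ₀` by `2 ^ (k + 1)`; rescaling by `2 ^ (-k)` leaves a dilation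
by `2`, so the final kernel, and every constant drawn from it, is independent of `k`. -/
theorem IsLittlewoodPaley.enorm_lpPiece_le [CompleteSpace X] {φ : ℕ → 𝓢(Rd d, ℂ)}
    (hφ : IsLittlewoodPaley φ) (f : 𝓢'(Rd d, X)) (k : ℕ) (x : Rd d) :
    ‖lpPiece (φ k) f (((2 : ℝ) ^ k)⁻¹ • x)‖ₑ ≤ ∫⁻ w, ‖reproducingKernel φ w‖ₑ *
      ‖lpPiece (φ k) f (((2 : ℝ) ^ k)⁻¹ • (x - w))‖ₑ := by
  have h2 : (0 : ℝ) < 2 ^ (k + 1) := by positivity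
  have h2k : (0 : ℝ) < 2 ^ k := by positivity
  set t : ℝ := ((2 : ℝ) ^ k)⁻¹ with ht_def
  have ht : 0 < t := by positivity
  set ψ : 𝓢(Rd d, ℂ) := ((((2 : ℝ) ^ (k + 1)) ^ d : ℝ) : ℂ) • dilate (2 ^ (k + 1)) h2.ne' (φ 0)
    with hψ_def
  have hψ : ∀ ξ, hat ψ ξ = hat (φ 0) (((2 : ℝ) ^ (k + 1))⁻¹ • ξ) := fun ξ => by
    rw [hψ_def, hat_smul, hat_dilate h2, ← mul_assoc, ← Complex.ofReal_mul,
      mul_inv_cancel₀ (by positivity), Complex.ofReal_one, one_mul]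
  have hrep : ∀ ξ, hat ψ ξ * hat (φ k) ξ = hat (φ k) ξ := fun ξ => by
    rcases le_total (3 / 2 * 2 ^ k) ‖ξ‖ with h | h
    · rw [hφ.hat_eq_zero k h, mul_zero]
    · rw [hψ, hφ.eq_one, one_mul]
      rw [norm_smul, norm_inv, Real.norm_of_nonneg h2.le, inv_mul_le_iff₀ h2, pow_succ]
      linarith
  refine (enorm_lpPiece_le_lintegral (φ k) ψ f hrep (t • x)).trans (le_of_eq ?_)
  have ht0 : ENNReal.ofReal t ≠ 0 := by simpa using ht
  have hscale := lintegral_comp_smul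
    (fun z => ‖unitaryConst d * ψ z‖ₑ * ‖lpPiece (φ k) f (t • x - z)‖ₑ) ht
  have hscale' : ∫⁻ z, ‖unitaryConst d * ψ z‖ₑ * ‖lpPiece (φ k) f (t • x - z)‖ₑ
      = ENNReal.ofReal t ^ (d : ℝ) *
        ∫⁻ w, ‖unitaryConst d * ψ (t • w)‖ₑ * ‖lpPiece (φ k) f (t • x - t • w)‖ₑ := by
    rw [hscale, ← mul_assoc, ← ENNReal.rpow_add _ _ ht0 (by simp)]
    simp
  rw [hscale', ← lintegral_const_mul' _ _ (by simp)]
  refine lintegral_congr fun w => ?_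
  rw [← smul_sub, ← mul_assoc]
  congr 1
  rw [reproducingKernel, hψ_def]
  simp only [smul_apply, smul_eq_mul, dilate_apply, enorm_mul, smul_smul]
  rw [show (2 : ℝ) ^ (k + 1) * t = 2 by rw [ht_def, pow_succ]; field_simp]
  have h4 : ENNReal.ofReal t ^ (d : ℝ) * ‖((((2 : ℝ) ^ (k + 1)) ^ d : ℝ) : ℂ)‖ₑ
      = ‖(2 ^ d : ℂ)‖ₑ := by
    have e1 : ‖(2 ^ d : ℂ)‖ₑ = ENNReal.ofReal (2 ^ d) := by
      rw [← ofReal_norm]; simp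
    have e2 : ‖((((2 : ℝ) ^ (k + 1)) ^ d : ℝ) : ℂ)‖ₑ = ENNReal.ofReal (((2 : ℝ) ^ (k + 1)) ^ d) := by
      rw [← ofReal_norm, Complex.norm_real, Real.norm_of_nonneg (by positivity)]
    rw [e1, e2, ENNReal.rpow_natCast, ← ENNReal.ofReal_pow ht.le, ← ENNReal.ofReal_mul
      (by positivity), ← mul_pow]
    congr 2
    rw [ht_def, pow_succ]; field_simp
  rw [← h4]
  ring

end pieces

/-! ### Sub-mean value property and weighted pointwise bounds -/

section nikolskii
variable {d : ℕ}

theorem bracket_rpow_le_enorm {E : Type*} [NormedAddCommGroup E] {x : E} (hx : 1 ≤ ‖x‖ₑ) (γ : ℝ) :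
    (1 + ‖x‖ₑ) ^ γ ≤ 2 ^ |γ| * ‖x‖ₑ ^ γ := by
  have h := enorm_rpow_le_bracket hx (-γ)
  have hx0 : ‖x‖ₑ ≠ 0 := (lt_of_lt_of_le one_pos hx).ne'
  rw [abs_neg] at h
  calc (1 + ‖x‖ₑ) ^ γ = (1 + ‖x‖ₑ) ^ γ * (‖x‖ₑ ^ (-γ) * ‖x‖ₑ ^ γ) := by
        rw [← ENNReal.rpow_add _ _ hx0 (by simp)]; simp
    _ ≤ (1 + ‖x‖ₑ) ^ γ * (2 ^ |γ| * (1 + ‖x‖ₑ) ^ (-γ) * ‖x‖ₑ ^ γ) := by gcongr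
    _ = ((1 + ‖x‖ₑ) ^ γ * (1 + ‖x‖ₑ) ^ (-γ)) * (2 ^ |γ| * ‖x‖ₑ ^ γ) := by ring
    _ = _ := by
        rw [← ENNReal.rpow_add _ _ (bracket_ne_zero x) (bracket_ne_top x)]; simp

/-- The sub-mean value property: a function that is controlled by an average of itself is
controlled by the corresponding average of its `r`-th power, `0 < r ≤ 1`. -/
theorem rpow_le_lintegral_of_le_lintegral {u : Rd d → ℝ≥0∞} (hu : Measurable u) {r N : ℝ}
    (hr0 : 0 < r) (hr1 : r ≤ 1) (hN : 0 ≤ N) {A : ℝ≥0∞}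
    (hrep : ∀ y, u y ≤ A * ∫⁻ z, (1 + ‖y - z‖ₑ) ^ (-(N / r)) * u z) (x : Rd d) {K : ℝ≥0∞}
    (hK : K ≠ ∞) (hgrowth : ∀ y, u y ≤ K * (1 + ‖x - y‖ₑ) ^ (N / r)) :
    u x ^ r ≤ A * ∫⁻ z, (1 + ‖x - z‖ₑ) ^ (-N) * u z ^ r := by
  set s := N / r with hs_def
  have hs : 0 ≤ s := by positivity
  have hsr : s * r = N := by rw [hs_def]; field_simp
  have hcancel : ∀ y : Rd d, (1 + ‖x - y‖ₑ) ^ s * (1 + ‖x - y‖ₑ) ^ (-s) = 1 := fun y => by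
    rw [← ENNReal.rpow_add _ _ (bracket_ne_zero _) (bracket_ne_top _)]; simp
  -- `M` is a Peetre maximal function, finite by the growth hypothesis. Splitting `u = u ^ r u ^ (1
  -- - r)` and bounding the second factor through `M` gives `M ≤ A M ^ (1 - r) I`, and division by
  -- `M ^ (1 - r)` is allowed unless `M = 0`.
  set M : ℝ≥0∞ := ⨆ y, u y * (1 + ‖x - y‖ₑ) ^ (-s) with hM_def
  have hMK : M ≤ K := iSup_le fun y => by
    calc _ ≤ K * (1 + ‖x - y‖ₑ) ^ s * (1 + ‖x - y‖ₑ) ^ (-s) := by gcongr; exact hgrowth y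
      _ = K := by rw [mul_assoc, hcancel, mul_one]
  have hMtop : M ≠ ∞ := ne_top_of_le_ne_top hK hMK
  have huM : ∀ y, u y ≤ M * (1 + ‖x - y‖ₑ) ^ s := fun y => by
    calc u y = u y * (1 + ‖x - y‖ₑ) ^ (-s) * (1 + ‖x - y‖ₑ) ^ s := by
          rw [mul_assoc, mul_comm (_ ^ (-s)), hcancel, mul_one]
      _ ≤ _ := by gcongr; exact le_iSup (fun y => u y * (1 + ‖x - y‖ₑ) ^ (-s)) y
  have hux : u x ≤ M := by simpa using huM x
  set I : ℝ≥0∞ := ∫⁻ z, (1 + ‖x - z‖ₑ) ^ (-N) * u z ^ r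
  have hMle : M ≤ A * (M ^ (1 - r) * I) := iSup_le fun y => by
    calc u y * (1 + ‖x - y‖ₑ) ^ (-s)
        ≤ A * (∫⁻ z, (1 + ‖y - z‖ₑ) ^ (-s) * u z) * (1 + ‖x - y‖ₑ) ^ (-s) := by
          gcongr; exact hrep y
      _ = A * ∫⁻ z, (1 + ‖x - y‖ₑ) ^ (-s) * ((1 + ‖y - z‖ₑ) ^ (-s) * u z) := by
          rw [lintegral_const_mul _ (by fun_prop)]; ring
      _ ≤ A * ∫⁻ z, M ^ (1 - r) * ((1 + ‖x - z‖ₑ) ^ (-N) * u z ^ r) := by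
          refine mul_le_mul' le_rfl (lintegral_mono fun z => ?_)
          calc (1 + ‖x - y‖ₑ) ^ (-s) * ((1 + ‖y - z‖ₑ) ^ (-s) * u z)
              ≤ (1 + ‖x - z‖ₑ) ^ (-s) * u z := by
                rw [← mul_assoc]; gcongr; exact bracket_rpow_neg_mul_le x y z hs
            _ = (1 + ‖x - z‖ₑ) ^ (-s) * (u z ^ r * u z ^ (1 - r)) := by
                rw [← ENNReal.rpow_add_of_nonneg _ _ hr0.le (by linarith)]; simp
            _ ≤ (1 + ‖x - z‖ₑ) ^ (-s) * (u z ^ r * (M * (1 + ‖x - z‖ₑ) ^ s) ^ (1 - r)) := by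
                have : 0 ≤ 1 - r := by linarith
                gcongr
                exact huM z
            _ = M ^ (1 - r) * (((1 + ‖x - z‖ₑ) ^ (-s) * (1 + ‖x - z‖ₑ) ^ (s * (1 - r)))
                  * u z ^ r) := by
                rw [ENNReal.mul_rpow_of_nonneg _ _ (by linarith), ← ENNReal.rpow_mul]; ring
            _ = _ := by
                rw [← ENNReal.rpow_add _ _ (bracket_ne_zero _) (bracket_ne_top _)]
                rw [show -s + s * (1 - r) = -N by linear_combination -hsr]
      _ = _ := by rw [lintegral_const_mul _ (by fun_prop)]
  rcases eq_or_ne M 0 with hM0 | hM0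
  · have : u x = 0 := le_antisymm (hM0 ▸ hux) zero_le
    rw [this, ENNReal.zero_rpow_of_pos hr0]
    exact zero_le
  · calc u x ^ r ≤ M ^ r := by gcongr
      _ = M * M ^ (-(1 - r)) := by
          conv_rhs => rw [← ENNReal.rpow_one M, ← ENNReal.rpow_mul,
            ← ENNReal.rpow_add _ _ hM0 hMtop]
          congr 1; ring
      _ ≤ A * (M ^ (1 - r) * I) * M ^ (-(1 - r)) := by gcongr
      _ = (M ^ (1 - r) * M ^ (-(1 - r))) * (A * I) := by ring
      _ = A * I := by rw [← ENNReal.rpow_add _ _ hM0 hMtop]; simp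

/-- The growth exponent `m` depends on `u` and may exceed `N / r`, but the constant must not depend
on it. With the larger decay `N'` the maximal argument applies with a crude constant `B` depending
on `m`; when `I` is finite, this shows that `u` grows at most like the power `N / r`, and a second
application gives the constant `A`. -/
theorem rpow_le_lintegral_of_growth {u : Rd d → ℝ≥0∞} (hu : Measurable u) {r N : ℝ}
    (hr0 : 0 < r) (hr1 : r ≤ 1) (hN : 0 ≤ N) {A : ℝ≥0∞}
    (hrep : ∀ y, u y ≤ A * ∫⁻ z, (1 + ‖y - z‖ₑ) ^ (-(N / r)) * u z)
    (hrep' : ∀ s : ℝ, ∃ B : ℝ≥0∞, B ≠ ∞ ∧ ∀ y, u y ≤ B * ∫⁻ z, (1 + ‖y - z‖ₑ) ^ (-s) * u z)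
    {K : ℝ≥0∞} {m : ℝ} (hK : K ≠ ∞) (hm : 0 ≤ m) (hgrowth : ∀ y, u y ≤ K * (1 + ‖y‖ₑ) ^ m)
    (x : Rd d) :
    u x ^ r ≤ A * ∫⁻ z, (1 + ‖x - z‖ₑ) ^ (-N) * u z ^ r := by
  set I : ℝ≥0∞ := ∫⁻ z, (1 + ‖x - z‖ₑ) ^ (-N) * u z ^ r with hI_def
  rcases eq_or_ne A 0 with rfl | hA
  · have : u x = 0 := le_antisymm (by simpa using hrep x) zero_le
    rw [this, ENNReal.zero_rpow_of_pos hr0]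
    exact zero_le
  rcases eq_or_ne I ∞ with hI | hI
  · rw [hI, ENNReal.mul_top hA]; exact le_top
  set N' := max N (r * m) with hN'
  obtain ⟨B, hB, hrepB⟩ := hrep' (N' / r)
  have hN'0 : 0 ≤ N' := hN.trans (le_max_left _ _)
  have hcrude : ∀ y, u y ^ r ≤ B * ∫⁻ z, (1 + ‖y - z‖ₑ) ^ (-N') * u z ^ r := fun y => by
    refine rpow_le_lintegral_of_le_lintegral hu hr0 hr1 hN'0 hrepB y
      (K := K * (1 + ‖y‖ₑ) ^ m) (ENNReal.mul_ne_top hK (bracket_rpow_ne_top _ _)) fun z => ?_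
    have hmN : m ≤ N' / r := by
      rw [le_div_iff₀ hr0, mul_comm]; exact le_max_right _ _
    calc u z ≤ K * (1 + ‖z‖ₑ) ^ m := hgrowth z
      _ ≤ K * ((1 + ‖y‖ₑ) ^ m * (1 + ‖y - z‖ₑ) ^ (N' / r)) := by
          gcongr
          refine (bracket_rpow_le z y m).trans ?_
          rw [abs_of_nonneg hm, enorm_sub_rev z y]
          gcongr
          exact one_le_bracket _
      _ = _ := by ring
  refine rpow_le_lintegral_of_le_lintegral hu hr0 hr1 hN hrep x (K := (B * I) ^ (1 / r))
    (ENNReal.rpow_ne_top_of_nonneg (by positivity) (ENNReal.mul_ne_top hB hI)) fun y => ?_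
  have h1 : u y ^ r ≤ B * I * (1 + ‖x - y‖ₑ) ^ N := by
    calc u y ^ r ≤ B * ∫⁻ z, (1 + ‖y - z‖ₑ) ^ (-N') * u z ^ r := hcrude y
      _ ≤ B * ∫⁻ z, (1 + ‖x - y‖ₑ) ^ N * ((1 + ‖x - z‖ₑ) ^ (-N) * u z ^ r) := by
          refine mul_le_mul' le_rfl (lintegral_mono fun z => ?_)
          simp only
          rw [← mul_assoc]
          gcongr
          calc (1 + ‖y - z‖ₑ) ^ (-N') ≤ (1 + ‖y - z‖ₑ) ^ (-N) :=
                bracket_rpow_le_rpow _ (neg_le_neg (le_max_left _ _))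
            _ ≤ (1 + ‖x - z‖ₑ) ^ (-N) * (1 + ‖y - z - (x - z)‖ₑ) ^ |-N| := bracket_rpow_le _ _ _
            _ = _ := by
                rw [abs_neg, abs_of_nonneg hN, sub_sub_sub_cancel_right, enorm_sub_rev y x,
                  mul_comm]
      _ = _ := by rw [lintegral_const_mul _ (by fun_prop), mul_assoc, mul_comm I]
  calc u y = (u y ^ r) ^ (1 / r) := by rw [← ENNReal.rpow_mul]; simp [hr0.ne']
    _ ≤ (B * I * (1 + ‖x - y‖ₑ) ^ N) ^ (1 / r) := by gcongr
    _ = _ := by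
        rw [ENNReal.mul_rpow_of_nonneg _ _ (by positivity), ← ENNReal.rpow_mul, mul_one_div]

/-- Functions reproduced by a Schwartz kernel are bounded pointwise by weighted `L^p` norms. -/
theorem le_lintegral_rpow_mul_bracket (hd : 1 ≤ d) (χ : 𝓢(Rd d, ℂ)) {p γ : ℝ} (hp : 1 < p) :
    ∃ C : ℝ≥0∞, C ≠ ∞ ∧ ∀ u : Rd d → ℝ≥0∞, Measurable u →
      (∃ (K : ℝ≥0∞) (m : ℝ), K ≠ ∞ ∧ 0 ≤ m ∧ ∀ y, u y ≤ K * (1 + ‖y‖ₑ) ^ m) →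
      (∀ x, u x ≤ ∫⁻ w, ‖χ w‖ₑ * u (x - w)) →
      ∀ x, u x ≤ C * (∫⁻ z, u z ^ p * ‖z‖ₑ ^ γ) ^ (1 / p) * (1 + ‖x‖ₑ) ^ (-(γ / p)) := by
  have hd0 : (0 : ℝ) < d := by exact_mod_cast hd
  have hp0 : 0 < p := by linarith
  -- The choice gives `r (d + |γ|) = d < d p`, which is what keeps the dual weight exponent `γ' = -γ
  -- r / (p - r)` above `-d`.
  set r : ℝ := d / (d + |γ|) with hr_def
  have hγ0 := abs_nonneg γ
  have hr0 : 0 < r := by positivity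
  have hr1 : r ≤ 1 := by rw [hr_def, div_le_one (by positivity)]; linarith
  have hpr : 0 < p - r := by linarith
  set q : ℝ := p / (p - r) with hq_def
  have hq1 : 1 ≤ q := by rw [hq_def, one_le_div hpr]; linarith
  have hq0 : 0 < q := by linarith
  set γ' : ℝ := -(γ * r / p) * q with hγ'_def
  have hγ' : -(d : ℝ) < γ' := by
    have h1 : γ' = -(γ * r / (p - r)) := by rw [hγ'_def, hq_def]; field_simp
    rw [h1, neg_lt_neg_iff, div_lt_iff₀ hpr]
    have h2 : r * (d + |γ|) = d := by rw [hr_def]; field_simp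
    have h3 : γ * r ≤ |γ| * r := by gcongr; exact le_abs_self γ
    nlinarith
  set N : ℝ := d + |γ'| + 1 with hN_def
  have hN0 : 0 ≤ N := by have := abs_nonneg γ'; linarith
  obtain ⟨C₁, hC₁, hK⟩ := lintegral_bracket_mul_weight_le hd hγ' (N := N * q)
    (by have := abs_nonneg γ'; nlinarith)
  have hker : ∀ s : ℝ, ∃ B : ℝ≥0∞, B ≠ ∞ ∧ ∀ u : Rd d → ℝ≥0∞, Measurable u →
      (∀ x, u x ≤ ∫⁻ w, ‖χ w‖ₑ * u (x - w)) →
      ∀ y, u y ≤ B * ∫⁻ z, (1 + ‖y - z‖ₑ) ^ (-s) * u z := fun s => by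
    obtain ⟨B, hB, h⟩ := enorm_le_bracket χ s
    refine ⟨B, hB, fun u hu hrep y => (hrep y).trans ?_⟩
    calc ∫⁻ w, ‖χ w‖ₑ * u (y - w) ≤ ∫⁻ w, B * ((1 + ‖w‖ₑ) ^ (-s) * u (y - w)) := by
          refine lintegral_mono fun w => ?_
          simp only
          rw [← mul_assoc]
          gcongr
          exact h w
      _ = B * ∫⁻ w, (1 + ‖w‖ₑ) ^ (-s) * u (y - w) := by
          rw [lintegral_const_mul' _ _ hB]
      _ = B * ∫⁻ z, (1 + ‖y - z‖ₑ) ^ (-s) * u z := by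
          rw [← lintegral_sub_left_eq_self _ y]; simp
  obtain ⟨A, hA, hAu⟩ := hker (N / r)
  refine ⟨(A * C₁ ^ (1 / q)) ^ (1 / r), by finiteness, fun u hu ⟨K, m, hKtop, hm, hgr⟩ hrep x => ?_⟩
  set T : ℝ≥0∞ := ∫⁻ z, u z ^ p * ‖z‖ₑ ^ γ with hT
  have h1 := rpow_le_lintegral_of_growth hu hr0 hr1 hN0 (hAu u hu hrep)
    (fun s => (hker s).imp fun B hB => ⟨hB.1, hB.2 u hu hrep⟩) hKtop hm hgr x
  have hconj : (p / r).HolderConjugate q := by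
    rw [Real.holderConjugate_iff]
    refine ⟨by rw [lt_div_iff₀ hr0]; linarith, ?_⟩
    rw [hq_def]; field_simp; ring
  -- Hölder with exponents `p / r` and `q = p / (p - r)`: the weight is split so that the first
  -- factor reproduces the `L^p` integral and the second is the kernel tested on the dual weight.
  have h2 := ENNReal.lintegral_mul_le_Lp_mul_Lq volume hconj
    (f := fun z : Rd d => u z ^ r * ‖z‖ₑ ^ (γ * r / p))
    (g := fun z : Rd d => ‖z‖ₑ ^ (-(γ * r / p)) * (1 + ‖x - z‖ₑ) ^ (-N)) (by fun_prop) (by fun_prop)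
  have hnt : Nontrivial (Rd d) := by
    have : Nonempty (Fin d) := ⟨⟨0, hd⟩⟩
    infer_instance
  have e1 : ∫⁻ z, (1 + ‖x - z‖ₑ) ^ (-N) * u z ^ r
      = ∫⁻ z, ((fun z : Rd d => u z ^ r * ‖z‖ₑ ^ (γ * r / p)) *
        (fun z : Rd d => ‖z‖ₑ ^ (-(γ * r / p)) * (1 + ‖x - z‖ₑ) ^ (-N))) z := by
    refine lintegral_congr_ae ?_
    filter_upwards [Measure.ae_ne volume (0 : Rd d)] with z hz
    simp only [Pi.mul_apply]
    have hz0 : ‖z‖ₑ ^ (γ * r / p) * ‖z‖ₑ ^ (-(γ * r / p)) = 1 := by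
      rw [← ENNReal.rpow_add _ _ (by simpa using hz) (by simp)]; simp
    calc (1 + ‖x - z‖ₑ) ^ (-N) * u z ^ r
        = (‖z‖ₑ ^ (γ * r / p) * ‖z‖ₑ ^ (-(γ * r / p))) * ((1 + ‖x - z‖ₑ) ^ (-N) * u z ^ r) := by
          rw [hz0, one_mul]
      _ = _ := by ring
  have e2 : ∫⁻ z, (u z ^ r * ‖z‖ₑ ^ (γ * r / p)) ^ (p / r) = T := by
    refine lintegral_congr fun z => ?_
    rw [ENNReal.mul_rpow_of_nonneg _ _ (by positivity), ← ENNReal.rpow_mul, ← ENNReal.rpow_mul]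
    congr 2 <;> field_simp
  have e3 : ∫⁻ z : Rd d, (‖z‖ₑ ^ (-(γ * r / p)) * (1 + ‖x - z‖ₑ) ^ (-N)) ^ q
      ≤ C₁ * (1 + ‖x‖ₑ) ^ γ' := by
    refine le_trans (le_of_eq (lintegral_congr fun z => ?_)) (hK x)
    rw [ENNReal.mul_rpow_of_nonneg _ _ hq0.le, ← ENNReal.rpow_mul, ← ENNReal.rpow_mul,
      enorm_sub_rev z x, mul_comm, neg_mul]
  have h3 : u x ^ r ≤ A * C₁ ^ (1 / q) * T ^ (1 / p * r) * (1 + ‖x‖ₑ) ^ (-(γ / p) * r) := by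
    calc u x ^ r ≤ A * (T ^ (1 / (p / r)) * (C₁ * (1 + ‖x‖ₑ) ^ γ') ^ (1 / q)) := by
          refine h1.trans ?_
          gcongr
          rw [e1]
          refine h2.trans ?_
          rw [e2]
          gcongr
      _ = _ := by
          rw [ENNReal.mul_rpow_of_nonneg _ _ (by positivity), ← ENNReal.rpow_mul,
            show γ' * (1 / q) = -(γ / p) * r by rw [hγ'_def]; field_simp,
            show 1 / (p / r) = 1 / p * r by field_simp]
          ring
  calc u x = (u x ^ r) ^ (1 / r) := by rw [← ENNReal.rpow_mul]; simp [hr0.ne']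
    _ ≤ (A * C₁ ^ (1 / q) * T ^ (1 / p * r) * (1 + ‖x‖ₑ) ^ (-(γ / p) * r)) ^ (1 / r) := by gcongr
    _ = _ := by
        rw [ENNReal.mul_rpow_of_nonneg _ _ (by positivity),
          ENNReal.mul_rpow_of_nonneg _ _ (by positivity), ← ENNReal.rpow_mul, ← ENNReal.rpow_mul]
        congr 3 <;> field_simp

end nikolskii

/-! ### Weighted Nikolskii inequality -/

section nikolskii
variable {d : ℕ}

theorem one_le_enorm_of_notMem_ball {x : Rd d} (hx : x ∈ (Metric.ball (0 : Rd d) 2)ᶜ) :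
    1 ≤ ‖x‖ₑ := by
  rw [← ofReal_norm, ← ENNReal.ofReal_one]
  refine ENNReal.ofReal_le_ofReal ?_
  simp at hx; linarith

/-- On the ball `1 + ‖x‖` lies between `1` and `3`, so the pointwise bound is constant up to a
factor, and `‖x‖ ^ γ₁` is integrable there because `-d < γ₁`. -/
theorem setLIntegral_ball_rpow_le (hd : 1 ≤ d) {p₀ p₁ γ₀ γ₁ : ℝ} (hp₁ : 0 < p₁)
    (hγ₁ : -(d : ℝ) < γ₁) {C : ℝ≥0∞} (hC : C ≠ ∞) :
    ∃ C' : ℝ≥0∞, C' ≠ ∞ ∧ ∀ (u : Rd d → ℝ≥0∞) (T : ℝ≥0∞),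
      (∀ x, u x ≤ C * T ^ (1 / p₀) * (1 + ‖x‖ₑ) ^ (-(γ₀ / p₀))) →
      ∫⁻ x in Metric.ball (0 : Rd d) 2, u x ^ p₁ * ‖x‖ₑ ^ γ₁ ≤ C' * T ^ (p₁ / p₀) := by
  set B : ℝ≥0∞ := ∫⁻ x in Metric.ball (0 : Rd d) 2, ‖x‖ₑ ^ γ₁
  have hB : B ≠ ∞ := (setLIntegral_ball_enorm_rpow_lt_top hd hγ₁).ne
  refine ⟨(C * 3 ^ |γ₀ / p₀|) ^ p₁ * B, by finiteness, fun u T hu => ?_⟩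
  calc ∫⁻ x in Metric.ball (0 : Rd d) 2, u x ^ p₁ * ‖x‖ₑ ^ γ₁
      ≤ ∫⁻ x in Metric.ball (0 : Rd d) 2, (C * T ^ (1 / p₀) * 3 ^ |γ₀ / p₀|) ^ p₁ * ‖x‖ₑ ^ γ₁ := by
        refine setLIntegral_mono' Metric.isOpen_ball.measurableSet fun x hx => ?_
        gcongr
        refine (hu x).trans ?_
        gcongr
        have hx3 : 1 + ‖x‖ₑ ≤ 3 := by
          have : ‖x‖ₑ ≤ 2 := by
            rw [← ofReal_norm]
            refine (ENNReal.ofReal_le_ofReal (q := 2) ?_).trans (by simp)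
            simpa using (Metric.mem_ball.1 hx).le
          calc 1 + ‖x‖ₑ ≤ 1 + 2 := by gcongr
            _ = 3 := by norm_num
        calc (1 + ‖x‖ₑ) ^ (-(γ₀ / p₀)) ≤ (1 + ‖x‖ₑ) ^ |γ₀ / p₀| :=
              bracket_rpow_le_rpow x (neg_le_abs _)
          _ ≤ 3 ^ |γ₀ / p₀| := by gcongr
    _ = _ := by
        rw [lintegral_const_mul _ (by fun_prop), mul_right_comm,
          ENNReal.mul_rpow_of_nonneg _ _ hp₁.le, ← ENNReal.rpow_mul, one_div_mul_eq_div]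
        ring

/-- Write `u ^ p₁ = u ^ (p₁ - p₀) u ^ p₀` and use the pointwise bound on the first factor. The
resulting power of `‖x‖` is at most `γ₀` precisely because `γ₁ / p₁ ≤ γ₀ / p₀`. -/
theorem setLIntegral_compl_ball_rpow_le_of_le {p₀ p₁ γ₀ γ₁ : ℝ} (hp₀ : 0 < p₀)
    (hp : p₀ ≤ p₁) (hγ : γ₁ / p₁ ≤ γ₀ / p₀) {C : ℝ≥0∞} (hC : C ≠ ∞) :
    ∃ C' : ℝ≥0∞, C' ≠ ∞ ∧ ∀ (u : Rd d → ℝ≥0∞),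
      (∀ x, u x ≤ C * (∫⁻ x, u x ^ p₀ * ‖x‖ₑ ^ γ₀) ^ (1 / p₀) * (1 + ‖x‖ₑ) ^ (-(γ₀ / p₀))) →
      ∫⁻ x in (Metric.ball (0 : Rd d) 2)ᶜ, u x ^ p₁ * ‖x‖ₑ ^ γ₁
        ≤ C' * (∫⁻ x, u x ^ p₀ * ‖x‖ₑ ^ γ₀) ^ (p₁ / p₀) := by
  have hp₁ : 0 < p₁ := by linarith
  have hpp : 0 ≤ p₁ - p₀ := by linarith
  set e := -(γ₀ / p₀) * (p₁ - p₀) with he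
  have hexp : e + γ₁ ≤ γ₀ := by
    have h1 : γ₁ ≤ γ₀ / p₀ * p₁ := by rwa [div_le_iff₀ hp₁] at hγ
    have h2 : γ₀ / p₀ * p₀ = γ₀ := by field_simp
    rw [he]; linarith
  refine ⟨C ^ (p₁ - p₀) * 2 ^ |e|, by finiteness, fun u hu => ?_⟩
  set T : ℝ≥0∞ := ∫⁻ x, u x ^ p₀ * ‖x‖ₑ ^ γ₀
  have hc : (T ^ (1 / p₀)) ^ (p₁ - p₀) * T = T ^ (p₁ / p₀) := by
    conv_lhs => rw [← ENNReal.rpow_mul]; enter [2]; rw [← ENNReal.rpow_one T]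
    rw [← ENNReal.rpow_add_of_nonneg _ _ (by positivity) zero_le_one]
    congr 1; field_simp; ring
  -- For `T = ∞` the claim is trivial unless `C = 0`; then `0 * ∞ = 0` in the hypothesis forces `u =
  -- 0`.
  rcases eq_or_ne T ∞ with hT | hT
  · rcases eq_or_ne C 0 with rfl | hC0
    · have hu0 : ∀ x, u x = 0 := fun x => le_antisymm (by simpa using hu x) zero_le
      simp [hu0, ENNReal.zero_rpow_of_pos hp₁]
    · rw [hT, ENNReal.top_rpow_of_pos (by positivity), ENNReal.mul_top]
      · exact le_top
      · simp [ENNReal.rpow_eq_zero_iff, hC0, hC]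
  calc ∫⁻ x in (Metric.ball (0 : Rd d) 2)ᶜ, u x ^ p₁ * ‖x‖ₑ ^ γ₁
      ≤ ∫⁻ x in (Metric.ball (0 : Rd d) 2)ᶜ,
          ((C * T ^ (1 / p₀)) ^ (p₁ - p₀) * 2 ^ |e|) * (u x ^ p₀ * ‖x‖ₑ ^ γ₀) := by
        refine setLIntegral_mono' Metric.isOpen_ball.measurableSet.compl fun x hx => ?_
        have hx1 := one_le_enorm_of_notMem_ball hx
        have hx0 : ‖x‖ₑ ≠ 0 := (lt_of_lt_of_le one_pos hx1).ne'
        calc u x ^ p₁ * ‖x‖ₑ ^ γ₁ = u x ^ (p₁ - p₀) * u x ^ p₀ * ‖x‖ₑ ^ γ₁ := by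
              rw [← ENNReal.rpow_add_of_nonneg _ _ hpp hp₀.le, sub_add_cancel]
          _ ≤ (C * T ^ (1 / p₀) * (1 + ‖x‖ₑ) ^ (-(γ₀ / p₀))) ^ (p₁ - p₀) * u x ^ p₀
                * ‖x‖ₑ ^ γ₁ := by
              gcongr; exact hu x
          _ = (C * T ^ (1 / p₀)) ^ (p₁ - p₀) * (1 + ‖x‖ₑ) ^ e * u x ^ p₀ * ‖x‖ₑ ^ γ₁ := by
              rw [ENNReal.mul_rpow_of_nonneg _ _ hpp, ← ENNReal.rpow_mul]
          _ ≤ (C * T ^ (1 / p₀)) ^ (p₁ - p₀) * (2 ^ |e| * ‖x‖ₑ ^ e) * u x ^ p₀ * ‖x‖ₑ ^ γ₁ := by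
              gcongr; exact bracket_rpow_le_enorm hx1 e
          _ = ((C * T ^ (1 / p₀)) ^ (p₁ - p₀) * 2 ^ |e|) * (u x ^ p₀ * ‖x‖ₑ ^ (e + γ₁)) := by
              rw [ENNReal.rpow_add _ _ hx0 (by simp)]; ring
          _ ≤ _ := by gcongr
    _ ≤ ∫⁻ x, ((C * T ^ (1 / p₀)) ^ (p₁ - p₀) * 2 ^ |e|) * (u x ^ p₀ * ‖x‖ₑ ^ γ₀) :=
        setLIntegral_le_lintegral _ _
    _ = C ^ (p₁ - p₀) * 2 ^ |e| * T ^ (p₁ / p₀) := by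
        rw [lintegral_const_mul' _ _ (by finiteness), ← hc, ENNReal.mul_rpow_of_nonneg _ _ hpp]
        ring

/-- Hölder with exponent `p₀ / p₁` leaves the weight `‖x‖ ^ (-κ)`, and `κ > d` is equivalent to the
strict inequality of homogeneities. No pointwise bound is needed. -/
theorem setLIntegral_compl_ball_rpow_le_of_lt {p₀ p₁ γ₀ γ₁ : ℝ} (hp₁ : 0 < p₁)
    (hp : p₁ < p₀) (hγ : (d + γ₁) / p₁ < (d + γ₀) / p₀) :
    ∃ C' : ℝ≥0∞, C' ≠ ∞ ∧ ∀ (u : Rd d → ℝ≥0∞), Measurable u →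
      ∫⁻ x in (Metric.ball (0 : Rd d) 2)ᶜ, u x ^ p₁ * ‖x‖ₑ ^ γ₁
        ≤ C' * (∫⁻ x, u x ^ p₀ * ‖x‖ₑ ^ γ₀) ^ (p₁ / p₀) := by
  have hp₀ : 0 < p₀ := by linarith
  have hpp : 0 < p₀ - p₁ := by linarith
  set q := p₀ / (p₀ - p₁) with hq
  have hq0 : 0 < q := by positivity
  set a := γ₀ * p₁ / p₀ with ha
  set κ := (a - γ₁) * q with hκ
  have hκd : (d : ℝ) < κ := by
    rw [div_lt_div_iff₀ hp₁ hp₀] at hγ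
    rw [hκ, hq, ha, ← mul_div_assoc, lt_div_iff₀ hpp]
    have : (γ₀ * p₁ / p₀ - γ₁) * p₀ = γ₀ * p₁ - γ₁ * p₀ := by field_simp
    rw [this]; linarith
  set I : ℝ≥0∞ := ∫⁻ x : Rd d, (1 + ‖x‖ₑ) ^ (-κ)
  have hI : I ≠ ∞ := (lintegral_bracket_lt_top hκd).ne
  refine ⟨(2 ^ |-κ| * I) ^ (1 / q), by finiteness, fun u hu => ?_⟩
  have hconj : (p₀ / p₁).HolderConjugate q := by
    rw [Real.holderConjugate_iff]
    refine ⟨by rw [lt_div_iff₀ hp₁]; linarith, ?_⟩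
    rw [hq]; field_simp; ring
  have h2 := ENNReal.lintegral_mul_le_Lp_mul_Lq (volume.restrict (Metric.ball (0 : Rd d) 2)ᶜ) hconj
    (f := fun z : Rd d => u z ^ p₁ * ‖z‖ₑ ^ a)
    (g := fun z : Rd d => ‖z‖ₑ ^ (γ₁ - a)) (by fun_prop) (by fun_prop)
  have e1 : ∫⁻ x in (Metric.ball (0 : Rd d) 2)ᶜ, u x ^ p₁ * ‖x‖ₑ ^ γ₁
      = ∫⁻ x in (Metric.ball (0 : Rd d) 2)ᶜ, ((fun z : Rd d => u z ^ p₁ * ‖z‖ₑ ^ a) *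
        (fun z : Rd d => ‖z‖ₑ ^ (γ₁ - a))) x := by
    refine setLIntegral_congr_fun Metric.isOpen_ball.measurableSet.compl fun x hx => ?_
    have hx1 := one_le_enorm_of_notMem_ball hx
    have hx0 : ‖x‖ₑ ≠ 0 := (lt_of_lt_of_le one_pos hx1).ne'
    simp only [Pi.mul_apply]
    rw [mul_assoc, ← ENNReal.rpow_add _ _ hx0 (by simp), add_sub_cancel]
  have e2 : ∫⁻ x in (Metric.ball (0 : Rd d) 2)ᶜ, (u x ^ p₁ * ‖x‖ₑ ^ a) ^ (p₀ / p₁)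
      ≤ ∫⁻ x, u x ^ p₀ * ‖x‖ₑ ^ γ₀ := by
    refine (setLIntegral_le_lintegral _ _).trans (le_of_eq (lintegral_congr fun z => ?_))
    rw [ENNReal.mul_rpow_of_nonneg _ _ (by positivity), ← ENNReal.rpow_mul, ← ENNReal.rpow_mul,
      ha]
    congr 2 <;> field_simp
  have e3 : ∫⁻ x in (Metric.ball (0 : Rd d) 2)ᶜ, (‖x‖ₑ ^ (γ₁ - a)) ^ q ≤ 2 ^ |-κ| * I := by
    calc _ ≤ ∫⁻ x in (Metric.ball (0 : Rd d) 2)ᶜ, 2 ^ |-κ| * (1 + ‖x‖ₑ) ^ (-κ) := by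
          refine setLIntegral_mono' Metric.isOpen_ball.measurableSet.compl fun x hx => ?_
          rw [← ENNReal.rpow_mul, show (γ₁ - a) * q = -κ by rw [hκ]; ring]
          exact enorm_rpow_le_bracket (one_le_enorm_of_notMem_ball hx) _
      _ ≤ ∫⁻ x : Rd d, 2 ^ |-κ| * (1 + ‖x‖ₑ) ^ (-κ) := setLIntegral_le_lintegral _ _
      _ = _ := by rw [lintegral_const_mul _ (by fun_prop)]
  rw [e1]
  refine h2.trans ?_
  rw [mul_comm]
  refine mul_le_mul' (by gcongr) ?_
  rw [one_div_div]
  gcongr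

/-- The weighted Plancherel--Polya--Nikolskii inequality at unit scale. -/
theorem weightedLpNorm_le_of_reproducing {X : Type*} [NormedAddCommGroup X] [NormedSpace ℂ X]
    (hd : 1 ≤ d) (χ : 𝓢(Rd d, ℂ)) {p₀ p₁ : ℝ≥0∞} {γ₀ γ₁ : ℝ} (hp₀ : 1 < p₀) (hp₀' : p₀ ≠ ∞)
    (hp₁ : 1 < p₁) (hγ₁ : -(d : ℝ) < γ₁) (hγ : divExp γ₁ p₁ ≤ divExp γ₀ p₀)
    (hδ : divExp (d + γ₁) p₁ < divExp (d + γ₀) p₀) :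
    ∃ C : ℝ≥0∞, C ≠ ∞ ∧ ∀ g : Rd d → X, Continuous g →
      (∃ (K : ℝ≥0∞) (m : ℝ), K ≠ ∞ ∧ 0 ≤ m ∧ ∀ y, ‖g y‖ₑ ≤ K * (1 + ‖y‖ₑ) ^ m) →
      (∀ x, ‖g x‖ₑ ≤ ∫⁻ w, ‖χ w‖ₑ * ‖g (x - w)‖ₑ) →
      weightedLpNorm p₁ γ₁ g ≤ C * weightedLpNorm p₀ γ₀ g := by
  have hP₀ : 1 < p₀.toReal := by
    rw [← ENNReal.toReal_one]; exact (ENNReal.toReal_lt_toReal (by simp) hp₀').2 hp₀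
  have hP₀0 : 0 < p₀.toReal := by linarith
  obtain ⟨C, hC, hsup⟩ := le_lintegral_rpow_mul_bracket hd χ (γ := γ₀) hP₀
  by_cases hp₁' : p₁ = ∞
  · subst hp₁'
    refine ⟨C, hC, fun g hg hgr hrep => ?_⟩
    rw [weightedLpNorm_of_ne_top hd hp₀', weightedLpNorm, if_pos rfl, eLpNorm_exponent_top]
    rw [divExp_top, divExp_eq_div] at hγ
    refine eLpNormEssSup_le_of_ae_enorm_bound (ae_of_all _ fun x => ?_)
    refine (hsup (fun x => ‖g x‖ₑ) hg.enorm.measurable hgr hrep x).trans ?_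
    -- For `p₁ = ∞` the weight condition reads `0 ≤ γ₀ / p₀`, so the bracket factor is at most one.
    refine mul_le_of_le_one_right' ?_
    calc (1 + ‖x‖ₑ) ^ (-(γ₀ / p₀.toReal)) ≤ (1 + ‖x‖ₑ) ^ (0 : ℝ) :=
          bracket_rpow_le_rpow x (by linarith)
      _ = 1 := by simp
  have hP₁ : 0 < p₁.toReal := ENNReal.toReal_pos (by positivity) hp₁'
  rw [divExp_eq_div, divExp_eq_div] at hγ hδ
  obtain ⟨C₁, hC₁, h₁⟩ := setLIntegral_ball_rpow_le hd (p₀ := p₀.toReal) (γ₀ := γ₀) hP₁ hγ₁ hC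
  have hout : ∃ C' : ℝ≥0∞, C' ≠ ∞ ∧ ∀ (u : Rd d → ℝ≥0∞), Measurable u →
      (∀ x, u x ≤ C * (∫⁻ x, u x ^ p₀.toReal * ‖x‖ₑ ^ γ₀) ^ (1 / p₀.toReal)
        * (1 + ‖x‖ₑ) ^ (-(γ₀ / p₀.toReal))) →
      ∫⁻ x in (Metric.ball (0 : Rd d) 2)ᶜ, u x ^ p₁.toReal * ‖x‖ₑ ^ γ₁
        ≤ C' * (∫⁻ x, u x ^ p₀.toReal * ‖x‖ₑ ^ γ₀) ^ (p₁.toReal / p₀.toReal) := by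
    rcases le_or_gt p₀.toReal p₁.toReal with h | h
    · obtain ⟨C', hC', h'⟩ := setLIntegral_compl_ball_rpow_le_of_le (d := d) hP₀0 h hγ hC
      exact ⟨C', hC', fun u _ hu => h' u hu⟩
    · obtain ⟨C', hC', h'⟩ := setLIntegral_compl_ball_rpow_le_of_lt hP₁ h hδ
      exact ⟨C', hC', fun u hu _ => h' u hu⟩
  obtain ⟨C₂, hC₂, h₂⟩ := hout
  refine ⟨(C₁ + C₂) ^ (1 / p₁.toReal), by finiteness, fun g hg hgr hrep => ?_⟩
  have hmeas : Measurable fun x => ‖g x‖ₑ := hg.enorm.measurable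
  have hb := hsup _ hmeas hgr hrep
  rw [weightedLpNorm_of_ne_top hd hp₀', weightedLpNorm_of_ne_top hd hp₁']
  calc (∫⁻ x, ‖g x‖ₑ ^ p₁.toReal * ‖x‖ₑ ^ γ₁) ^ (1 / p₁.toReal)
      ≤ ((C₁ + C₂) * (∫⁻ x, ‖g x‖ₑ ^ p₀.toReal * ‖x‖ₑ ^ γ₀) ^ (p₁.toReal / p₀.toReal))
          ^ (1 / p₁.toReal) := by
        gcongr
        rw [← lintegral_add_compl _ (Metric.isOpen_ball (x := (0 : Rd d)) (ε := 2)).measurableSet,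
          add_mul]
        exact add_le_add (h₁ _ _ hb) (h₂ _ hmeas hb)
    _ = _ := by
        rw [ENNReal.mul_rpow_of_nonneg _ _ (by positivity), ← ENNReal.rpow_mul]
        congr 2
        field_simp

/-- The weighted Plancherel--Polya--Nikolskii inequality for Littlewood--Paley pieces. -/
theorem IsLittlewoodPaley.weightedLpNorm_lpPiece_le {X : Type*} [NormedAddCommGroup X]
    [NormedSpace ℂ X] [CompleteSpace X] (hd : 1 ≤ d) {φ : ℕ → 𝓢(Rd d, ℂ)}
    (hφ : IsLittlewoodPaley φ) {p₀ p₁ : ℝ≥0∞} {γ₀ γ₁ : ℝ} (hp₀ : 1 < p₀) (hp₀' : p₀ ≠ ∞)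
    (hp₁ : 1 < p₁) (hγ₁ : -(d : ℝ) < γ₁) (hγ : divExp γ₁ p₁ ≤ divExp γ₀ p₀)
    (hδ : divExp (d + γ₁) p₁ < divExp (d + γ₀) p₀) :
    ∃ C : ℝ≥0∞, C ≠ ∞ ∧ ∀ (f : 𝓢'(Rd d, X)) (k : ℕ),
      weightedLpNorm p₁ γ₁ (lpPiece (φ k) f) ≤
        C * 2 ^ ((k : ℝ) * (divExp (d + γ₀) p₀ - divExp (d + γ₁) p₁))
          * weightedLpNorm p₀ γ₀ (lpPiece (φ k) f) := by
  obtain ⟨C, hC, h⟩ := weightedLpNorm_le_of_reproducing (X := X) hd (reproducingKernel φ) hp₀ hp₀'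
    hp₁ hγ₁ hγ hδ
  refine ⟨C, hC, fun f k => ?_⟩
  have ht : (0 : ℝ) < ((2 : ℝ) ^ k)⁻¹ := by positivity
  -- The unit-scale inequality is applied to the piece dilated by `2 ^ (-k)`; the two scaling
  -- factors combine to the power of `2` in the claim.
  have hk := h (fun x => lpPiece (φ k) f (((2 : ℝ) ^ k)⁻¹ • x))
    ((continuous_lpPiece _ _).comp (continuous_const_smul _)) ?_ (hφ.enorm_lpPiece_le f k)
  · rw [weightedLpNorm_comp_smul hd (by positivity) _ _ ht,
      weightedLpNorm_comp_smul hd (by positivity) _ _ ht] at hk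
    have e : ∀ a : ℝ, ENNReal.ofReal (((2 : ℝ) ^ k)⁻¹) ^ (-a) = 2 ^ ((k : ℝ) * a) := fun a => by
      rw [ENNReal.ofReal_inv_of_pos (by positivity), ENNReal.ofReal_pow (by norm_num),
        ENNReal.inv_rpow, ENNReal.rpow_neg, inv_inv, ← ENNReal.rpow_natCast, ← ENNReal.rpow_mul]
      simp
    rw [e, e] at hk
    calc weightedLpNorm p₁ γ₁ (lpPiece (φ k) f)
        = 2 ^ ((k : ℝ) * -divExp (d + γ₁) p₁) *
          (2 ^ ((k : ℝ) * divExp (d + γ₁) p₁) * weightedLpNorm p₁ γ₁ (lpPiece (φ k) f)) := by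
          rw [← mul_assoc, ← ENNReal.rpow_add _ _ (by simp) (by simp)]; simp
      _ ≤ 2 ^ ((k : ℝ) * -divExp (d + γ₁) p₁) *
          (C * (2 ^ ((k : ℝ) * divExp (d + γ₀) p₀) * weightedLpNorm p₀ γ₀ (lpPiece (φ k) f))) := by
          gcongr
      _ = C * (2 ^ ((k : ℝ) * -divExp (d + γ₁) p₁) * 2 ^ ((k : ℝ) * divExp (d + γ₀) p₀))
            * weightedLpNorm p₀ γ₀ (lpPiece (φ k) f) := by ring
      _ = _ := by
          rw [← ENNReal.rpow_add _ _ (by simp) (by simp)]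
          ring_nf
  · obtain ⟨K, m, hK, hm, hKm⟩ := WeightedBesov.enorm_lpPiece_le (φ k) f
    refine ⟨K, m, hK, hm, fun y => (hKm _).trans ?_⟩
    gcongr
    rw [enorm_smul_of_pos ht]
    refine mul_le_of_le_one_left' ?_
    rw [← ENNReal.ofReal_one]
    exact ENNReal.ofReal_le_ofReal (inv_le_one_of_one_le₀ (one_le_pow₀ (by norm_num)))

end nikolskii

/-! ### Sequence norms -/

section sequences

theorem seqNorm_of_ne_top {q : ℝ≥0∞} (hq : q ≠ ∞) (a : ℕ → ℝ≥0∞) :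
    seqNorm q a = (∑' k, a k ^ q.toReal) ^ (1 / q.toReal) := by
  rw [seqNorm, if_neg hq]

theorem seqNorm_top (a : ℕ → ℝ≥0∞) : seqNorm ∞ a = ⨆ k, a k := by
  rw [seqNorm, if_pos rfl]

theorem seqNorm_mono {q : ℝ≥0∞} {a b : ℕ → ℝ≥0∞} (h : ∀ k, a k ≤ b k) :
    seqNorm q a ≤ seqNorm q b := by
  by_cases hq : q = ∞
  · subst hq
    rw [seqNorm_top, seqNorm_top]
    exact iSup_mono h
  · rw [seqNorm_of_ne_top hq, seqNorm_of_ne_top hq]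
    gcongr with k
    exact h k

theorem seqNorm_const_mul {q : ℝ≥0∞} (hq : q ≠ 0) (c : ℝ≥0∞) (a : ℕ → ℝ≥0∞) :
    seqNorm q (fun k => c * a k) = c * seqNorm q a := by
  by_cases hq' : q = ∞
  · subst hq'
    rw [seqNorm_top, seqNorm_top, ENNReal.mul_iSup]
  · have h0 : 0 < q.toReal := ENNReal.toReal_pos hq hq'
    rw [seqNorm_of_ne_top hq', seqNorm_of_ne_top hq']
    simp_rw [ENNReal.mul_rpow_of_nonneg _ _ h0.le]
    rw [ENNReal.tsum_mul_left, ENNReal.mul_rpow_of_nonneg _ _ (by positivity), ← ENNReal.rpow_mul]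
    simp [h0.ne']

theorem le_seqNorm {q : ℝ≥0∞} (hq : q ≠ 0) (a : ℕ → ℝ≥0∞) (k : ℕ) : a k ≤ seqNorm q a := by
  by_cases hq' : q = ∞
  · subst hq'
    rw [seqNorm_top]
    exact le_iSup a k
  · have h0 : 0 < q.toReal := ENNReal.toReal_pos hq hq'
    rw [seqNorm_of_ne_top hq']
    calc a k = (a k ^ q.toReal) ^ (1 / q.toReal) := by rw [← ENNReal.rpow_mul]; simp [h0.ne']
      _ ≤ _ := by gcongr; exact ENNReal.le_tsum (f := fun k => a k ^ q.toReal) k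

/-- Each term is at most the `ℓ^{q₀}` norm, so `a ^ q₁` is at most that norm to the power `q₁ - q₀`
times `a ^ q₀`. -/
theorem seqNorm_anti {q₀ q₁ : ℝ≥0∞} (hq₀ : q₀ ≠ 0) (h : q₀ ≤ q₁) (a : ℕ → ℝ≥0∞) :
    seqNorm q₁ a ≤ seqNorm q₀ a := by
  by_cases hq₁ : q₁ = ∞
  · subst hq₁
    rw [seqNorm_top]
    exact iSup_le (le_seqNorm hq₀ a)
  have hq₀' : q₀ ≠ ∞ := ne_top_of_le_ne_top hq₁ h
  have h0 : 0 < q₀.toReal := ENNReal.toReal_pos hq₀ hq₀'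
  have h01 : q₀.toReal ≤ q₁.toReal := ENNReal.toReal_mono hq₁ h
  have h1 : 0 < q₁.toReal := by linarith
  have hS : seqNorm q₀ a ^ q₀.toReal = ∑' k, a k ^ q₀.toReal := by
    rw [seqNorm_of_ne_top hq₀', ← ENNReal.rpow_mul]
    simp [h0.ne']
  rw [seqNorm_of_ne_top hq₁]
  calc (∑' k, a k ^ q₁.toReal) ^ (1 / q₁.toReal)
      ≤ (∑' k, seqNorm q₀ a ^ (q₁.toReal - q₀.toReal) * a k ^ q₀.toReal) ^ (1 / q₁.toReal) := by
        refine ENNReal.rpow_le_rpow (ENNReal.tsum_le_tsum fun k => ?_) (by positivity)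
        calc a k ^ q₁.toReal = a k ^ (q₁.toReal - q₀.toReal) * a k ^ q₀.toReal := by
              rw [← ENNReal.rpow_add_of_nonneg _ _ (by linarith) h0.le, sub_add_cancel]
          _ ≤ _ := by
              have := le_seqNorm hq₀ a k
              have : 0 ≤ q₁.toReal - q₀.toReal := by linarith
              gcongr
    _ = _ := by
        rw [ENNReal.tsum_mul_left, ← hS, ← ENNReal.rpow_add_of_nonneg _ _ (by linarith) h0.le,
          sub_add_cancel, ← ENNReal.rpow_mul]
        simp [h1.ne']

theorem seqNorm_geometric_ne_top {q : ℝ≥0∞} (hq : 1 ≤ q) {ε : ℝ} (hε : 0 < ε) :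
    seqNorm q (fun k : ℕ => (2 : ℝ≥0∞) ^ ((k : ℝ) * -ε)) ≠ ∞ := by
  refine ne_top_of_le_ne_top ?_ (seqNorm_anti one_ne_zero hq _)
  rw [seqNorm_of_ne_top (by simp)]
  simp only [ENNReal.toReal_one, ENNReal.rpow_one, div_one]
  have : ∀ k : ℕ, (2 : ℝ≥0∞) ^ ((k : ℝ) * -ε) = ((2 : ℝ≥0∞) ^ (-ε)) ^ k := fun k => by
    rw [mul_comm, ENNReal.rpow_mul, ENNReal.rpow_natCast]
  simp_rw [this]
  rw [ENNReal.tsum_geometric]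
  refine ENNReal.inv_ne_top.2 (tsub_pos_of_lt ?_).ne'
  rw [ENNReal.rpow_neg, ENNReal.inv_lt_one]
  exact ENNReal.one_lt_rpow (by norm_num) hε

end sequences

/-! ### Sufficiency of the conditions -/

section sufficiency
variable {d : ℕ} {X : Type*} [NormedAddCommGroup X] [NormedSpace ℂ X]

/-- Estimates for the Littlewood--Paley pieces give embeddings of Besov spaces. -/
theorem besovEmbedding_of_pieces (φ : ℕ → 𝓢(Rd d, ℂ)) {p₀ p₁ q₀ q₁ : ℝ≥0∞} {s₀ s₁ γ₀ γ₁ δ : ℝ}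
    (hq₀ : 1 ≤ q₀) (hq₁ : 1 ≤ q₁) {C : ℝ≥0∞} (hC : C ≠ ∞)
    (h : ∀ (f : 𝓢'(Rd d, X)) (k : ℕ), weightedLpNorm p₁ γ₁ (lpPiece (φ k) f)
      ≤ C * 2 ^ ((k : ℝ) * δ) * weightedLpNorm p₀ γ₀ (lpPiece (φ k) f))
    (hs : s₁ + δ < s₀ ∨ (s₁ + δ = s₀ ∧ q₀ ≤ q₁)) :
    BesovEmbedding X φ s₀ s₁ p₀ p₁ q₀ q₁ γ₀ γ₁ := by
  have hq₀0 : q₀ ≠ 0 := (lt_of_lt_of_le one_pos hq₀).ne'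
  have hq₁0 : q₁ ≠ 0 := (lt_of_lt_of_le one_pos hq₁).ne'
  suffices H : ∃ D : ℝ≥0∞, D ≠ ∞ ∧ ∀ f : 𝓢'(Rd d, X),
      besovNorm φ s₁ p₁ q₁ γ₁ f ≤ D * besovNorm φ s₀ p₀ q₀ γ₀ f by
    obtain ⟨D, hD, H⟩ := H
    refine ⟨fun f hf => lt_of_le_of_lt (H f) (ENNReal.mul_lt_top hD.lt_top hf), D.toNNReal,
      fun f _ => ?_⟩
    rw [ENNReal.coe_toNNReal hD]
    exact H f
  have hterm : ∀ (f : 𝓢'(Rd d, X)) (k : ℕ),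
      (2 : ℝ≥0∞) ^ ((k : ℝ) * s₁) * weightedLpNorm p₁ γ₁ (lpPiece (φ k) f) ≤
        C * (2 ^ ((k : ℝ) * -(s₀ - (s₁ + δ))) *
          (2 ^ ((k : ℝ) * s₀) * weightedLpNorm p₀ γ₀ (lpPiece (φ k) f))) := fun f k => by
    calc _ ≤ (2 : ℝ≥0∞) ^ ((k : ℝ) * s₁) *
          (C * 2 ^ ((k : ℝ) * δ) * weightedLpNorm p₀ γ₀ (lpPiece (φ k) f)) := by
          gcongr; exact h f k
      _ = C * ((2 : ℝ≥0∞) ^ ((k : ℝ) * s₁) * 2 ^ ((k : ℝ) * δ)) *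
          weightedLpNorm p₀ γ₀ (lpPiece (φ k) f) := by ring
      _ = C * ((2 : ℝ≥0∞) ^ ((k : ℝ) * -(s₀ - (s₁ + δ))) * 2 ^ ((k : ℝ) * s₀)) *
          weightedLpNorm p₀ γ₀ (lpPiece (φ k) f) := by
          rw [← ENNReal.rpow_add _ _ (by simp) (by simp),
            ← ENNReal.rpow_add _ _ (by simp) (by simp)]
          ring_nf
      _ = _ := by ring
  rcases hs with hs | ⟨hs, hq⟩
  -- With room in the smoothness each term is bounded by the full source norm times a decaying
  -- geometric factor, so `q₀` and `q₁` need no relation.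
  · refine ⟨C * seqNorm q₁ (fun k : ℕ => (2 : ℝ≥0∞) ^ ((k : ℝ) * -(s₀ - (s₁ + δ)))),
      ENNReal.mul_ne_top hC (seqNorm_geometric_ne_top hq₁ (by linarith)), fun f => ?_⟩
    calc besovNorm φ s₁ p₁ q₁ γ₁ f
        ≤ seqNorm q₁ (fun k : ℕ => (C * besovNorm φ s₀ p₀ q₀ γ₀ f) *
            (2 : ℝ≥0∞) ^ ((k : ℝ) * -(s₀ - (s₁ + δ)))) := by
          refine seqNorm_mono fun k => (hterm f k).trans ?_
          rw [mul_assoc, mul_comm (besovNorm φ s₀ p₀ q₀ γ₀ f)]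
          gcongr
          exact le_seqNorm hq₀0
            (fun k => (2 : ℝ≥0∞) ^ ((k : ℝ) * s₀) * weightedLpNorm p₀ γ₀ (lpPiece (φ k) f)) k
      _ = _ := by rw [seqNorm_const_mul hq₁0]; ring
  · refine ⟨C, hC, fun f => ?_⟩
    calc besovNorm φ s₁ p₁ q₁ γ₁ f
        ≤ seqNorm q₁ (fun k : ℕ => C *
          ((2 : ℝ≥0∞) ^ ((k : ℝ) * s₀) * weightedLpNorm p₀ γ₀ (lpPiece (φ k) f))) := by
          refine seqNorm_mono fun k => (hterm f k).trans ?_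
          simp [hs]
      _ = C * seqNorm q₁ (fun k : ℕ =>
          ((2 : ℝ≥0∞) ^ ((k : ℝ) * s₀) * weightedLpNorm p₀ γ₀ (lpPiece (φ k) f))) :=
          seqNorm_const_mul hq₁0 _ _
      _ ≤ _ := by gcongr; exact seqNorm_anti hq₀0 hq _

theorem weightedLpNorm_eq_of_eq_or_top {Y : Type*} [NormedAddCommGroup Y] {p : ℝ≥0∞} {γ₀ γ₁ : ℝ}
    (h : γ₀ = γ₁ ∨ p = ∞) (g : Rd d → Y) : weightedLpNorm p γ₁ g = weightedLpNorm p γ₀ g := by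
  rcases h with rfl | rfl
  · rfl
  · simp [weightedLpNorm]

theorem IsLittlewoodPaley.besovEmbedding [CompleteSpace X] (hd : 1 ≤ d) {φ : ℕ → 𝓢(Rd d, ℂ)}
    (hφ : IsLittlewoodPaley φ) {p₀ p₁ q₀ q₁ : ℝ≥0∞} (hp₀ : 1 < p₀) (hp₁ : 1 < p₁) (hq₀ : 1 ≤ q₀)
    (hq₁ : 1 ≤ q₁) {s₀ s₁ γ₀ γ₁ : ℝ} (hγ₁ : -(d : ℝ) < γ₁)
    (hγ : divExp γ₁ p₁ ≤ divExp γ₀ p₀) (hδ : divExp (d + γ₁) p₁ < divExp (d + γ₀) p₀)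
    (hs : s₁ - divExp (d + γ₁) p₁ < s₀ - divExp (d + γ₀) p₀ ∨
      (s₁ - divExp (d + γ₁) p₁ = s₀ - divExp (d + γ₀) p₀ ∧ q₀ ≤ q₁)) :
    BesovEmbedding X φ s₀ s₁ p₀ p₁ q₀ q₁ γ₀ γ₁ := by
  -- Homogeneity zero, that of `p₀ = ∞`, cannot strictly exceed the nonnegative target homogeneity.
  have hp₀' : p₀ ≠ ∞ := by
    rintro rfl
    rw [divExp_top, divExp] at hδ
    have : 0 ≤ (d + γ₁) * (p₁⁻¹).toReal := mul_nonneg (by linarith) ENNReal.toReal_nonneg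
    linarith
  obtain ⟨C, hC, h⟩ := hφ.weightedLpNorm_lpPiece_le (X := X) hd hp₀ hp₀' hp₁ hγ₁ hγ hδ
  refine besovEmbedding_of_pieces φ hq₀ hq₁ hC h (hs.imp (fun h => by linarith) fun h => ?_)
  exact ⟨by linarith [h.1], h.2⟩

end sufficiency

/-! ### Elementary tensors and comparison of powers -/

section tensor
variable {d : ℕ} {X : Type*} [NormedAddCommGroup X] [NormedSpace ℂ X]

/-- The distribution `g ⊗ v` given by a Schwartz function and a vector. -/
def tensorDist (d : ℕ) (v : X) : 𝓢(Rd d, ℂ) →ₗ[ℂ] 𝓢'(Rd d, X) :=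
  (SchwartzMap.toTemperedDistributionCLM (Rd d) X volume).toLinearMap ∘ₗ
    (SchwartzMap.postcompCLM (ContinuousLinearMap.toSpanSingleton ℂ v)).toLinearMap

theorem tensorDist_apply (v : X) (g η : 𝓢(Rd d, ℂ)) :
    tensorDist d v g η = ∫ x, η x • g x • v := by
  simp [tensorDist, SchwartzMap.toTemperedDistributionCLM_apply_apply]

/-- When the multiplier is constant on the spectrum of `g`, the piece is explicit. All test
functions below have this property with `m` equal to zero or one. -/
theorem lpPiece_tensorDist [CompleteSpace X] (v : X) (φ g : 𝓢(Rd d, ℂ)) (m : ℂ)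
    (h : ∀ ξ, hat φ ξ * hat g ξ = m * hat g ξ) (x : Rd d) :
    lpPiece φ (tensorDist d v g) x = (m * g x) • v := by
  rw [← unitaryConst_mul_convolution_eq φ g m h x, lpPiece, tensorDist_apply, mul_smul]
  congr 1
  rw [← integral_smul_const]
  refine integral_congr_ae (ae_of_all _ fun y => ?_)
  simp only [reflectTranslate_apply, smul_smul]
  rw [mul_comm]

theorem lpPiece_sum {ι : Type*} (φ : 𝓢(Rd d, ℂ)) (S : Finset ι) (f : ι → 𝓢'(Rd d, X)) (x : Rd d) :
    lpPiece φ (∑ i ∈ S, f i) x = ∑ i ∈ S, lpPiece φ (f i) x := by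
  simp [lpPiece, Finset.smul_sum]

theorem weightedLpNorm_congr_enorm {Y Z : Type*} [NormedAddCommGroup Y] [NormedAddCommGroup Z]
    {p : ℝ≥0∞} {γ : ℝ} {g : Rd d → Y} {g' : Rd d → Z} (h : ∀ x, ‖g x‖ₑ = ‖g' x‖ₑ) :
    weightedLpNorm p γ g = weightedLpNorm p γ g' := by
  simp only [weightedLpNorm, eLpNorm_exponent_top, eLpNormEssSup, h]

theorem weightedLpNorm_zero {Y : Type*} [NormedAddCommGroup Y] {p : ℝ≥0∞} (hp : p ≠ 0) (γ : ℝ) :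
    weightedLpNorm p γ (fun _ : Rd d => (0 : Y)) = 0 := by
  by_cases hp' : p = ∞
  · simp [weightedLpNorm, hp', eLpNorm_exponent_top, eLpNormEssSup]
  · have := ENNReal.toReal_pos hp hp'
    simp [weightedLpNorm, hp', ENNReal.zero_rpow_of_pos this]
    positivity

theorem seqNorm_single {q : ℝ≥0∞} (hq : q ≠ 0) (k : ℕ) (b : ℝ≥0∞) :
    seqNorm q (fun j => if j = k then b else 0) = b := by
  by_cases hq' : q = ∞
  · subst hq'
    rw [seqNorm_top]
    refine le_antisymm (iSup_le fun j => ?_) ((le_iSup (fun j => if j = k then b else 0) k).trans' ?_)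
    · split_ifs <;> simp
    · simp
  · have h0 : 0 < q.toReal := ENNReal.toReal_pos hq hq'
    rw [seqNorm_of_ne_top hq', tsum_eq_single k]
    · rw [if_pos rfl, ← ENNReal.rpow_mul]; simp [h0.ne']
    · intro j hj
      rw [if_neg hj, ENNReal.zero_rpow_of_pos h0]

theorem seqNorm_indicator {q : ℝ≥0∞} (hq : q ≠ 0) {n : ℕ} (hn : 1 ≤ n) :
    seqNorm q (fun j => if j < n then 1 else 0) = (n : ℝ≥0∞) ^ (q⁻¹).toReal := by
  by_cases hq' : q = ∞
  · subst hq'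
    rw [seqNorm_top]
    simp only [ENNReal.inv_top, ENNReal.toReal_zero, ENNReal.rpow_zero]
    refine le_antisymm (iSup_le fun j => ?_)
      ((le_iSup (fun j => if j < n then (1 : ℝ≥0∞) else 0) 0).trans' ?_)
    · split_ifs <;> simp
    · simp [Nat.pos_of_ne_zero (by omega : n ≠ 0)]
  · have h0 : 0 < q.toReal := ENNReal.toReal_pos hq hq'
    rw [seqNorm_of_ne_top hq', tsum_eq_sum (s := Finset.range n)]
    · rw [Finset.sum_congr rfl (g := fun _ => 1)]
      · simp [ENNReal.toReal_inv]
      · intro j hj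
        rw [if_pos (Finset.mem_range.1 hj), ENNReal.one_rpow]
    · intro j hj
      rw [if_neg (by simpa using hj), ENNReal.zero_rpow_of_pos h0]

/-- A power function dominated by a multiple of another one has the smaller exponent. -/
theorem le_of_forall_rpow_le {t : ℕ → ℝ} (ht : Filter.Tendsto t Filter.atTop Filter.atTop)
    {a b : ℝ} {A D : ℝ≥0∞} (hA : A ≠ 0) (hD : D ≠ ∞)
    (h : ∀ᶠ n in Filter.atTop, A * ENNReal.ofReal (t n) ^ a ≤ D * ENNReal.ofReal (t n) ^ b) :
    a ≤ b := by
  by_contra! hab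
  have hlim : Filter.Tendsto (fun n => t n ^ (a - b)) Filter.atTop Filter.atTop :=
    (tendsto_rpow_atTop (by linarith)).comp ht
  have hDA : D / A ≠ ∞ := ENNReal.div_ne_top hD hA
  obtain ⟨n, h1, h2, h3⟩ := (h.and ((ht.eventually_gt_atTop 0).and
    (hlim.eventually_gt_atTop (D / A).toReal))).exists
  have ht0 : ENNReal.ofReal (t n) ≠ 0 := by simpa using h2
  have h4 : A * ENNReal.ofReal (t n) ^ (a - b) ≤ D := by
    calc A * ENNReal.ofReal (t n) ^ (a - b)
        = A * ENNReal.ofReal (t n) ^ a * ENNReal.ofReal (t n) ^ (-b) := by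
          rw [mul_assoc, ← ENNReal.rpow_add _ _ ht0 (by simp), sub_eq_add_neg]
      _ ≤ D * ENNReal.ofReal (t n) ^ b * ENNReal.ofReal (t n) ^ (-b) := by gcongr
      _ = D := by rw [mul_assoc, ← ENNReal.rpow_add _ _ ht0 (by simp)]; simp
  have h5 : ENNReal.ofReal (t n) ^ (a - b) ≤ D / A := by
    rw [ENNReal.le_div_iff_mul_le (Or.inl hA) (Or.inr hD), mul_comm]
    exact h4
  rw [ENNReal.ofReal_rpow_of_pos h2] at h5
  exact absurd ((ENNReal.ofReal_le_iff_le_toReal hDA).1 h5) (not_le.2 h3)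

end tensor

/-! ### Weighted norms of translated test functions -/

section testNorms
variable {d : ℕ}

/-- A rapidly decaying bump centred at `a` sees the weight at size `(1 + ‖a‖) ^ γ`; the assumption
`-d < γ` covers `a` near the origin. -/
theorem weightedLpNorm_translate_le (hd : 1 ≤ d) (g : 𝓢(Rd d, ℂ)) {p : ℝ≥0∞} (hp : p ≠ 0) {γ : ℝ}
    (hγ : -(d : ℝ) < γ) :
    ∃ C : ℝ≥0∞, C ≠ ∞ ∧ ∀ a : Rd d,
      weightedLpNorm p γ (fun x => g (x - a)) ≤ C * (1 + ‖a‖ₑ) ^ divExp γ p := by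
  by_cases hp' : p = ∞
  · subst hp'
    refine ⟨eLpNorm g ∞ volume, (g.eLpNorm_lt_top ∞ volume).ne, fun a => ?_⟩
    rw [divExp_top, ENNReal.rpow_zero, mul_one, weightedLpNorm, if_pos rfl]
    exact (eLpNorm_comp_measurePreserving g.continuous.aestronglyMeasurable
      (measurePreserving_sub_right volume a)).le
  have hP : 0 < p.toReal := ENNReal.toReal_pos hp hp'
  set M : ℝ := (d + |γ| + 1) / p.toReal with hM
  obtain ⟨A, hA, hAg⟩ := enorm_le_bracket g M
  obtain ⟨C, hC, h⟩ := lintegral_bracket_mul_weight_le hd hγ (N := d + |γ| + 1) (by linarith)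
  refine ⟨(A ^ p.toReal * C) ^ (1 / p.toReal), by finiteness, fun a => ?_⟩
  rw [weightedLpNorm_of_ne_top hd hp', divExp_eq_div]
  calc (∫⁻ x, ‖g (x - a)‖ₑ ^ p.toReal * ‖x‖ₑ ^ γ) ^ (1 / p.toReal)
      ≤ (A ^ p.toReal * (C * (1 + ‖a‖ₑ) ^ γ)) ^ (1 / p.toReal) := by
        gcongr
        calc ∫⁻ x, ‖g (x - a)‖ₑ ^ p.toReal * ‖x‖ₑ ^ γ
            ≤ ∫⁻ x, A ^ p.toReal * ((1 + ‖x - a‖ₑ) ^ (-(d + |γ| + 1)) * ‖x‖ₑ ^ γ) := by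
              refine lintegral_mono fun x => ?_
              simp only
              rw [← mul_assoc]
              gcongr
              calc ‖g (x - a)‖ₑ ^ p.toReal ≤ (A * (1 + ‖x - a‖ₑ) ^ (-M)) ^ p.toReal := by
                    gcongr; exact hAg _
                _ = _ := by
                    rw [ENNReal.mul_rpow_of_nonneg _ _ hP.le, ← ENNReal.rpow_mul,
                      show -M * p.toReal = -(d + |γ| + 1) by rw [hM]; field_simp]
          _ = A ^ p.toReal * ∫⁻ x, (1 + ‖x - a‖ₑ) ^ (-(d + |γ| + 1)) * ‖x‖ₑ ^ γ := by
              rw [lintegral_const_mul' _ _ (by finiteness)]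
          _ ≤ _ := by gcongr; exact h a
    _ = _ := by
        rw [← mul_assoc, ENNReal.mul_rpow_of_nonneg _ _ (by positivity), ← ENNReal.rpow_mul,
          mul_one_div]

theorem weightedLpNorm_schwartz_ne_top (hd : 1 ≤ d) (g : 𝓢(Rd d, ℂ)) {p : ℝ≥0∞} (hp : p ≠ 0)
    {γ : ℝ} (hγ : -(d : ℝ) < γ) : weightedLpNorm p γ g ≠ ∞ := by
  obtain ⟨C, hC, h⟩ := weightedLpNorm_translate_le hd g hp hγ
  refine ne_top_of_le_ne_top hC ?_
  simpa using h 0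

theorem weightedLpNorm_ne_zero (hd : 1 ≤ d) {g : Rd d → ℂ} (hg : Continuous g) {x₀ : Rd d}
    (hx₀ : g x₀ ≠ 0) {p : ℝ≥0∞} (hp : p ≠ 0) (γ : ℝ) : weightedLpNorm p γ g ≠ 0 := by
  intro h
  have hnt : Nontrivial (Rd d) := by
    have : Nonempty (Fin d) := ⟨⟨0, hd⟩⟩
    infer_instance
  have hae : g =ᵐ[volume] fun _ => 0 := by
    by_cases hp' : p = ∞
    · subst hp'
      rw [weightedLpNorm, if_pos rfl, eLpNorm_eq_zero_iff hg.aestronglyMeasurable (by simp)] at h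
      exact h
    · have hP : 0 < p.toReal := ENNReal.toReal_pos hp hp'
      rw [weightedLpNorm_of_ne_top hd hp', ENNReal.rpow_eq_zero_iff_of_pos (by positivity),
        lintegral_eq_zero_iff (by have := hg.measurable; fun_prop)] at h
      filter_upwards [h, Measure.ae_ne volume (0 : Rd d)] with x hx hx0
      have h1 : ‖x‖ₑ ^ γ ≠ 0 := by
        simp [ENNReal.rpow_eq_zero_iff, hx0]
      have h2 : ‖g x‖ₑ ^ p.toReal = 0 := by
        simpa [h1] using hx
      simpa [ENNReal.rpow_eq_zero_iff_of_pos hP] using h2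
  have := (hg.ae_eq_iff_eq volume continuous_const).1 hae
  exact hx₀ (congrFun this x₀)

/-- Only the unit ball about `a` is kept. Since `‖a‖ ≥ 2`, it stays at distance at least one from
the origin, where the weight is comparable to `(1 + ‖a‖) ^ γ`. -/
theorem le_weightedLpNorm_translate (hd : 1 ≤ d) (g : 𝓢(Rd d, ℂ)) (hg0 : g 0 ≠ 0) {p : ℝ≥0∞}
    (hp : p ≠ 0) (γ : ℝ) :
    ∃ c : ℝ≥0∞, c ≠ 0 ∧ ∀ a : Rd d, 2 ≤ ‖a‖ →
      c * (1 + ‖a‖ₑ) ^ divExp γ p ≤ weightedLpNorm p γ (fun x => g (x - a)) := by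
  by_cases hp' : p = ∞
  · subst hp'
    refine ⟨weightedLpNorm ∞ γ g, weightedLpNorm_ne_zero hd g.continuous hg0 hp γ, fun a _ => ?_⟩
    rw [divExp_top, ENNReal.rpow_zero, mul_one, weightedLpNorm, if_pos rfl, weightedLpNorm,
      if_pos rfl]
    exact (eLpNorm_comp_measurePreserving g.continuous.aestronglyMeasurable
      (measurePreserving_sub_right volume a)).ge
  have hP : 0 < p.toReal := ENNReal.toReal_pos hp hp'
  set I : ℝ≥0∞ := ∫⁻ x in Metric.ball (0 : Rd d) 1, ‖g x‖ₑ ^ p.toReal with hI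
  have hI0 : I ≠ 0 := by
    have hcont : Continuous fun x : Rd d => ‖g x‖ₑ ^ p.toReal :=
      ENNReal.continuous_rpow_const.comp g.continuous.enorm
    intro h0
    rw [hI, setLIntegral_eq_zero_iff Metric.isOpen_ball.measurableSet hcont.measurable] at h0
    have h1 : {x : Rd d | ‖g x‖ₑ ^ p.toReal ≠ 0} ∩ Metric.ball 0 1 = ∅ := by
      have hopen : IsOpen ({x : Rd d | ‖g x‖ₑ ^ p.toReal ≠ 0} ∩ Metric.ball 0 1) :=
        (isOpen_ne_fun hcont continuous_const).inter Metric.isOpen_ball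
      have h2 := ae_iff.1 h0
      refine (hopen.measure_eq_zero_iff volume).1 (measure_mono_null ?_ h2)
      intro x hx h
      exact hx.1 (h hx.2)
    have : (0 : Rd d) ∈ {x : Rd d | ‖g x‖ₑ ^ p.toReal ≠ 0} ∩ Metric.ball 0 1 := by
      refine ⟨?_, by simp⟩
      simp [hg0]
    rw [h1] at this
    exact this
  -- One factor `2 ^ |γ|` comes from Peetre's inequality with `1 + ‖x‖ ≤ 2`, the other from
  -- replacing `1 + ‖x + a‖` by `‖x + a‖`.
  set κ : ℝ≥0∞ := 4 ^ |γ| with hκ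
  have hκ0 : κ ≠ 0 := by simp [hκ, ENNReal.rpow_eq_zero_iff]
  have hκt : κ ≠ ∞ := by finiteness
  refine ⟨(κ⁻¹ * I) ^ (1 / p.toReal), ?_, fun a ha => ?_⟩
  · rw [Ne, ENNReal.rpow_eq_zero_iff_of_pos (by positivity)]
    exact mul_ne_zero (ENNReal.inv_ne_zero.2 hκt) hI0
  rw [weightedLpNorm_of_ne_top hd hp', divExp_eq_div, ← mul_one_div γ, ENNReal.rpow_mul,
    ← ENNReal.mul_rpow_of_nonneg _ _ (by positivity)]
  gcongr
  calc κ⁻¹ * I * (1 + ‖a‖ₑ) ^ γ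
      = ∫⁻ x in Metric.ball (0 : Rd d) 1, ‖g x‖ₑ ^ p.toReal * (κ⁻¹ * (1 + ‖a‖ₑ) ^ γ) := by
        rw [lintegral_mul_const' _ _ (ENNReal.mul_ne_top (ENNReal.inv_ne_top.2 hκ0)
          (bracket_rpow_ne_top _ _))]
        ring
    _ ≤ ∫⁻ x in Metric.ball (0 : Rd d) 1, ‖g x‖ₑ ^ p.toReal * ‖x + a‖ₑ ^ γ := by
        refine setLIntegral_mono' Metric.isOpen_ball.measurableSet fun x hx => ?_
        gcongr
        rw [ENNReal.inv_mul_le_iff hκ0 hκt]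
        have hx1 : ‖x‖ < 1 := by simpa using hx
        have hxa : 1 ≤ ‖x + a‖ₑ := by
          rw [← ofReal_norm, ← ENNReal.ofReal_one]
          refine ENNReal.ofReal_le_ofReal ?_
          have := norm_sub_norm_le a (-x)
          rw [norm_neg, sub_neg_eq_add, add_comm a x] at this
          linarith
        have hx2 : 1 + ‖x‖ₑ ≤ 2 := by
          have : ‖x‖ₑ ≤ 1 := by
            rw [← ofReal_norm, ← ENNReal.ofReal_one]
            exact ENNReal.ofReal_le_ofReal hx1.le
          calc 1 + ‖x‖ₑ ≤ 1 + 1 := by gcongr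
            _ = 2 := by norm_num
        calc (1 + ‖a‖ₑ) ^ γ ≤ (1 + ‖x + a‖ₑ) ^ γ * (1 + ‖a - (x + a)‖ₑ) ^ |γ| :=
              bracket_rpow_le _ _ _
          _ ≤ (2 ^ |γ| * ‖x + a‖ₑ ^ γ) * 2 ^ |γ| := by
              gcongr
              · exact bracket_rpow_le_enorm hxa γ
              · rw [sub_add_cancel_right, enorm_neg]; exact hx2
          _ = (2 ^ |γ| * 2 ^ |γ|) * ‖x + a‖ₑ ^ γ := by ring
          _ = _ := by
              rw [← ENNReal.mul_rpow_of_nonneg _ _ (abs_nonneg γ)]; norm_num [hκ]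
    _ ≤ ∫⁻ x, ‖g x‖ₑ ^ p.toReal * ‖x + a‖ₑ ^ γ := setLIntegral_le_lintegral _ _
    _ = ∫⁻ x, ‖g (x - a)‖ₑ ^ p.toReal * ‖x‖ₑ ^ γ := by
        rw [← lintegral_sub_right_eq_self _ a]; simp

end testNorms

/-! ### Band-limited test functions -/

section testFunctions
open scoped FourierTransform
variable {d : ℕ}

theorem exists_hat_eq (G : 𝓢(Rd d, ℂ)) :
    ∃ g : 𝓢(Rd d, ℂ), ∀ ξ, hat g ξ = unitaryConst d * G ((2 * Real.pi)⁻¹ • ξ) :=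
  ⟨𝓕⁻ G, fun ξ => by rw [hat_eq]; simp⟩

theorem exists_ne_zero_of_hat_ne_zero {g : 𝓢(Rd d, ℂ)} {ξ : Rd d} (h : hat g ξ ≠ 0) :
    ∃ x, g x ≠ 0 := by
  by_contra! h0
  exact h (by simp [hat, h0])

/-- There are nonzero Schwartz functions with spectrum in the annulus `3 / 4 ≤ ‖ξ‖ ≤ 1`. -/
theorem exists_annular_test_function (hd : 1 ≤ d) :
    ∃ g : 𝓢(Rd d, ℂ), (∃ x, g x ≠ 0) ∧ ∀ ξ, hat g ξ ≠ 0 → 3 / 4 ≤ ‖ξ‖ ∧ ‖ξ‖ ≤ 1 := by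
  have hnt : Nontrivial (Rd d) := by
    have : Nonempty (Fin d) := ⟨⟨0, hd⟩⟩
    infer_instance
  -- The annulus is centred at radius `7 / 8`. In the variable of `hat` the bump radius `1 / 64`
  -- becomes `2π / 64 < 1 / 8`.
  obtain ⟨e, he⟩ := exists_norm_eq (Rd d) (by norm_num : (0 : ℝ) ≤ 7 / 8)
  let b : ContDiffBump ((2 * Real.pi)⁻¹ • e) :=
    ⟨1 / 128, 1 / 64, by norm_num, by norm_num⟩
  have hsupp : HasCompactSupport (Complex.ofRealCLM ∘ b) := b.hasCompactSupport.comp_left rfl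
  have hsmooth : ContDiff ℝ (⊤ : ℕ∞) (Complex.ofRealCLM ∘ b) :=
    Complex.ofRealCLM.contDiff.comp b.contDiff
  obtain ⟨g, hg⟩ := exists_hat_eq (hsupp.toSchwartzMap hsmooth)
  have hpi : (0 : ℝ) < 2 * Real.pi := by positivity
  have hval : ∀ ξ, hat g ξ = unitaryConst d * (b ((2 * Real.pi)⁻¹ • ξ) : ℂ) := hg
  refine ⟨g, exists_ne_zero_of_hat_ne_zero (ξ := e) ?_, fun ξ hξ => ?_⟩
  · rw [hval, b.one_of_mem_closedBall (by simp [b])]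
    simpa using unitaryConst_ne_zero d
  · have h1 : b ((2 * Real.pi)⁻¹ • ξ) ≠ 0 := fun h => hξ (by rw [hval, h]; simp)
    have h2 : (2 * Real.pi)⁻¹ • ξ ∈ Metric.ball ((2 * Real.pi)⁻¹ • e) (1 / 64) := by
      have : (2 * Real.pi)⁻¹ • ξ ∈ Function.support b := h1
      rwa [b.support_eq] at this
    rw [mem_ball_iff_norm, ← smul_sub, norm_smul, norm_inv, Real.norm_of_nonneg hpi.le,
      inv_mul_lt_iff₀ hpi] at h2
    have h3 : ‖ξ - e‖ < 1 / 8 := by nlinarith [Real.pi_lt_four]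
    have h4 := abs_lt.1 ((abs_norm_sub_norm_le ξ e).trans_lt h3)
    rw [he] at h4
    constructor <;> linarith

/-- There are nonnegative Schwartz functions with spectrum in the unit ball, not vanishing at the
origin. -/
theorem exists_nonneg_test_function (d : ℕ) :
    ∃ g : 𝓢(Rd d, ℂ), (∀ x, ∃ r : ℝ, 0 ≤ r ∧ g x = r) ∧ g 0 ≠ 0 ∧ ∀ ξ, hat g ξ ≠ 0 → ‖ξ‖ ≤ 1 := by
  -- The test function is `𝓕 (H ∗ H) = (𝓕 H) ^ 2`, and `𝓕 H` is real because `H` is real and even.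
  -- The convolution is supported in radius `1 / 8`, which becomes `2π / 8 < 1` in the variable of
  -- `hat`.
  let b : ContDiffBump (0 : Rd d) := ⟨1 / 32, 1 / 16, by norm_num, by norm_num⟩
  have hsupp : HasCompactSupport (Complex.ofRealCLM ∘ b) := b.hasCompactSupport.comp_left rfl
  have hsmooth : ContDiff ℝ (⊤ : ℕ∞) (Complex.ofRealCLM ∘ b) :=
    Complex.ofRealCLM.contDiff.comp b.contDiff
  let H : 𝓢(Rd d, ℂ) := hsupp.toSchwartzMap hsmooth
  have hH : ∀ x, H x = (b x : ℂ) := fun _ => rfl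
  have hH0 : ∀ x, 1 / 16 ≤ ‖x‖ → H x = 0 := fun x hx => by
    rw [hH, b.zero_of_le_dist (by simpa [b] using hx), Complex.ofReal_zero]
  let K : 𝓢(Rd d, ℂ) := SchwartzMap.convolution (ContinuousLinearMap.mul ℂ ℂ) H H
  have hK : ∀ x, 1 / 8 ≤ ‖x‖ → K x = 0 := fun x hx => by
    rw [SchwartzMap.convolution_apply]
    change ∫ t, H t * H (x - t) = 0
    rw [integral_eq_zero_of_ae]
    refine ae_of_all _ fun t => ?_
    rcases le_or_gt (1 / 16) ‖t‖ with ht | ht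
    · simp [hH0 t ht]
    · have : 1 / 16 ≤ ‖x - t‖ := by
        have := norm_sub_norm_le x t
        linarith
      simp [hH0 _ this]
  have hreal : ∀ x, (starRingEnd ℂ) (𝓕 H x) = 𝓕 H x := fun x => by
    rw [SchwartzMap.fourier_coe, Real.fourier_eq', ← integral_conj, ← integral_neg_eq_self]
    refine integral_congr_ae (ae_of_all _ fun v => ?_)
    simp only [hH, smul_eq_mul, map_mul, Complex.conj_ofReal, ← Complex.exp_conj, b.neg]
    congr 2
    simp
  have hg : ∀ x, 𝓕 K x = 𝓕 H x * 𝓕 H x := fun x => by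
    simp [K, SchwartzMap.fourier_convolution]
  have hre : ∀ x, 𝓕 H x = ((𝓕 H x).re : ℂ) := fun x => (Complex.conj_eq_iff_re.1 (hreal x)).symm
  refine ⟨𝓕 K, fun x => ⟨(𝓕 H x).re * (𝓕 H x).re, mul_self_nonneg _, ?_⟩, ?_, fun ξ hξ => ?_⟩
  · rw [hg]
    conv_lhs => rw [hre x]
    push_cast
    rfl
  · rw [hg]
    refine mul_self_ne_zero.2 ?_
    rw [SchwartzMap.fourier_coe, Real.fourier_eq']
    simp only [inner_zero_right, mul_zero, Complex.ofReal_zero, zero_mul, Complex.exp_zero,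
      one_smul, hH]
    rw [integral_complex_ofReal, Complex.ofReal_ne_zero]
    exact (b.integral_pos (μ := volume)).ne'
  · by_contra! h1
    apply hξ
    have h2 : 𝓕 (𝓕 K) ((2 * Real.pi)⁻¹ • ξ) = K (-((2 * Real.pi)⁻¹ • ξ)) := by
      have := SchwartzMap.fourierInv_apply_eq (𝓕 K)
      have h3 := congrArg (fun u : 𝓢(Rd d, ℂ) => u (-((2 * Real.pi)⁻¹ • ξ))) this
      simpa using h3.symm
    have hpi : (0 : ℝ) < 2 * Real.pi := by positivity
    rw [hat_eq, h2, hK, mul_zero]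
    rw [norm_neg, norm_smul, norm_inv, Real.norm_of_nonneg hpi.le, inv_mul_eq_div,
      le_div_iff₀ hpi]
    nlinarith [Real.pi_lt_four]

end testFunctions

/-! ### Besov norms of the test functions -/

section necessity
variable {d : ℕ} {X : Type*} [NormedAddCommGroup X] [NormedSpace ℂ X]
  {φ : ℕ → 𝓢(Rd d, ℂ)} {s₀ s₁ : ℝ} {p₀ p₁ q₀ q₁ : ℝ≥0∞} {γ₀ γ₁ : ℝ}

theorem BesovEmbedding.exists_le (h : BesovEmbedding X φ s₀ s₁ p₀ p₁ q₀ q₁ γ₀ γ₁) :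
    ∃ C : ℝ≥0∞, C ≠ ∞ ∧ ∀ f : 𝓢'(Rd d, X),
      besovNorm φ s₁ p₁ q₁ γ₁ f ≤ C * besovNorm φ s₀ p₀ q₀ γ₀ f := by
  obtain ⟨-, C, hC⟩ := h
  -- A positive constant makes the right-hand side infinite when the source norm is infinite, so the
  -- bound extends to all `f`.
  refine ⟨C + 1, by finiteness, fun f => ?_⟩
  by_cases hf : besovNorm φ s₀ p₀ q₀ γ₀ f = ∞
  · rw [hf, ENNReal.mul_top (by simp)]
    exact le_top
  · exact (hC f (lt_top_iff_ne_top.2 hf)).trans (by gcongr; exact le_self_add)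

/-- On functions with spectrum in the unit ball the Besov norm is the weighted `L^p` norm. -/
theorem IsLittlewoodPaley.besovNorm_of_low_frequency [CompleteSpace X] (hφ : IsLittlewoodPaley φ)
    {v : X} (hv : ‖v‖ = 1) {h : 𝓢(Rd d, ℂ)} (hh : ∀ ξ, hat h ξ ≠ 0 → ‖ξ‖ ≤ 1) (s : ℝ)
    {p q : ℝ≥0∞} (hp : p ≠ 0) (hq : q ≠ 0) (γ : ℝ) :
    besovNorm φ s p q γ (tensorDist d v h) = weightedLpNorm p γ h := by
  have hve : ‖v‖ₑ = 1 := by rw [← ofReal_norm, hv, ENNReal.ofReal_one]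
  have h0 : ∀ x, lpPiece (φ 0) (tensorDist d v h) x = ((1 : ℂ) * h x) • v :=
    lpPiece_tensorDist v (φ 0) h 1 fun ξ => by
      by_cases hξ : hat h ξ = 0
      · simp [hξ]
      · rw [hφ.eq_one ξ (hh ξ hξ)]
  have hk : ∀ k, k ≠ 0 → ∀ x, lpPiece (φ k) (tensorDist d v h) x = ((0 : ℂ) * h x) • v :=
    fun k hk => lpPiece_tensorDist v (φ k) h 0 fun ξ => by
      by_cases hξ : hat h ξ = 0
      · simp [hξ]
      · have h1 := hh ξ hξ
        have hle : ∀ m : ℤ, m ≤ 0 → hat (φ 0) ((2 : ℝ) ^ m • ξ) = 1 := fun m hm => by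
          apply hφ.eq_one
          rw [norm_smul, Real.norm_of_nonneg (by positivity)]
          exact mul_le_one₀ (zpow_le_one_of_nonpos₀ (by norm_num) hm) (norm_nonneg _) h1
        rw [hφ.dyadic k (by omega), hle _ (by omega), hle _ (by omega), sub_self]
  rw [besovNorm]
  have hfun : (fun k : ℕ => (2 : ℝ≥0∞) ^ ((k : ℝ) * s) *
      weightedLpNorm p γ (lpPiece (φ k) (tensorDist d v h)))
      = fun k => if k = 0 then weightedLpNorm p γ h else 0 := by
    funext k
    split_ifs with hk0
    · subst hk0
      rw [weightedLpNorm_congr_enorm (g' := h) (fun x => by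
        rw [h0, one_mul, enorm_smul, hve, mul_one])]
      simp
    · rw [weightedLpNorm_congr_enorm (g' := fun _ : Rd d => (0 : ℂ)) (fun x => by
        rw [hk k hk0, zero_mul, zero_smul, enorm_zero, enorm_zero]), weightedLpNorm_zero hp,
        mul_zero]
  rw [hfun, seqNorm_single hq]

theorem weightedLpNorm_const_mul {p : ℝ≥0∞} (hp : p ≠ 0) (γ : ℝ) (a : ℂ) (g : Rd d → ℂ) :
    weightedLpNorm p γ (fun x => a * g x) = ‖a‖ₑ * weightedLpNorm p γ g := by
  by_cases hp' : p = ∞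
  · rw [weightedLpNorm, if_pos hp', weightedLpNorm, if_pos hp']
    exact eLpNorm_const_smul a g ∞ volume
  · have h0 := ENNReal.toReal_pos hp hp'
    rw [weightedLpNorm, if_neg hp', weightedLpNorm, if_neg hp']
    simp only [enorm_mul, ENNReal.mul_rpow_of_nonneg _ _ h0.le, mul_assoc]
    rw [lintegral_const_mul' _ _ (by finiteness), ENNReal.mul_rpow_of_nonneg _ _ (by positivity),
      ← ENNReal.rpow_mul, mul_one_div_cancel h0.ne', ENNReal.rpow_one]

/-- The Littlewood--Paley multipliers on functions with spectrum in a dyadic annulus. -/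
theorem IsLittlewoodPaley.hat_mul_hat_dilate (hφ : IsLittlewoodPaley φ) {g : 𝓢(Rd d, ℂ)}
    (hg : ∀ ξ, hat g ξ ≠ 0 → 3 / 4 ≤ ‖ξ‖ ∧ ‖ξ‖ ≤ 1) (j k : ℕ) (ξ : Rd d) :
    hat (φ j) ξ * hat (dilate (2 ^ k) (by positivity) g) ξ
      = (if j = k then 1 else 0) * hat (dilate (2 ^ k) (by positivity) g) ξ := by
  have h2 : ∀ m : ℕ, (0 : ℝ) < 2 ^ m := fun m => by positivity
  rw [hat_dilate (h2 k)]
  by_cases hξ : hat g (((2 : ℝ) ^ k)⁻¹ • ξ) = 0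
  · simp [hξ]
  congr 1
  obtain ⟨hl, hu⟩ := hg _ hξ
  rw [norm_smul, norm_inv, Real.norm_of_nonneg (h2 k).le, inv_mul_eq_div] at hl hu
  rw [le_div_iff₀ (h2 k)] at hl
  rw [div_le_one (h2 k)] at hu
  -- On `3/4 · 2 ^ k ≤ ‖ξ‖ ≤ 2 ^ k`: for `j > k` both terms of `φ̂ⱼ` equal one and cancel; for `j =
  -- k` the value is one, since the subtracted term, present when `k ≥ 1`, vanishes; for `j < k` the
  -- point is outside the support.
  rcases lt_trichotomy k j with hkj | rfl | hjk
  · have hkj' : (2 : ℝ) ^ k ≤ 2 ^ (j - 1) := pow_le_pow_right₀ (by norm_num) (by omega)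
    have hle : ∀ m : ℤ, m ≤ -(j : ℤ) + 1 → hat (φ 0) ((2 : ℝ) ^ m • ξ) = 1 := fun m hm => by
      apply hφ.eq_one
      rw [norm_smul, Real.norm_of_nonneg (by positivity)]
      calc (2 : ℝ) ^ m * ‖ξ‖ ≤ 2 ^ (-(j : ℤ) + 1) * 2 ^ (j - 1) := by
            gcongr
            · norm_num
            · exact hu.trans hkj'
        _ = 1 := by
            rw [← zpow_natCast, ← zpow_add₀ (by norm_num)]
            convert zpow_zero (2 : ℝ) using 2
            omega
    rw [if_neg hkj.ne', hφ.dyadic j (by omega), hle _ (by omega), hle _ (by omega), sub_self]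
  · rw [if_pos rfl]
    rcases Nat.eq_zero_or_pos k with rfl | hk
    · exact hφ.eq_one ξ (by simpa using hu)
    · rw [hφ.dyadic k hk, hφ.eq_one, hφ.eq_zero, sub_zero]
      · rw [norm_smul, Real.norm_of_nonneg (by positivity), zpow_add₀ (by norm_num), zpow_neg,
          zpow_natCast, zpow_one, mul_comm _ (2 : ℝ), mul_assoc, inv_mul_eq_div]
        rw [← le_div_iff₀ (h2 k)] at hl
        linarith
      · rw [norm_smul, Real.norm_of_nonneg (by positivity), zpow_neg, zpow_natCast,
          inv_mul_eq_div, div_le_one (h2 k)]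
        exact hu
  · rw [if_neg hjk.ne]
    apply hφ.hat_eq_zero
    have : (2 : ℝ) ^ (j + 1) ≤ 2 ^ k := pow_le_pow_right₀ (by norm_num) (by omega)
    rw [pow_succ] at this
    linarith

/-- The Besov norm of a lacunary sum of dilates of a function with spectrum in an annulus. -/
theorem IsLittlewoodPaley.besovNorm_lacunary [CompleteSpace X] (hφ : IsLittlewoodPaley φ)
    (hd : 1 ≤ d) {v : X} (hv : ‖v‖ = 1) {g : 𝓢(Rd d, ℂ)}
    (hg : ∀ ξ, hat g ξ ≠ 0 → 3 / 4 ≤ ‖ξ‖ ∧ ‖ξ‖ ≤ 1) (S : Finset ℕ) (a : ℕ → ℝ) (s : ℝ)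
    {p q : ℝ≥0∞} (hp : p ≠ 0) (hq : q ≠ 0) (γ : ℝ) :
    besovNorm φ s p q γ
      (∑ k ∈ S, tensorDist d v (((2 ^ a k : ℝ) : ℂ) • dilate (2 ^ k) (by positivity) g))
      = weightedLpNorm p γ g * seqNorm q fun j =>
        if j ∈ S then 2 ^ (a j + (j : ℝ) * (s - divExp (d + γ) p)) else 0 := by
  have hve : ‖v‖ₑ = 1 := by rw [← ofReal_norm, hv, ENNReal.ofReal_one]
  have hpc : ∀ j x, lpPiece (φ j) (∑ k ∈ S, tensorDist d v
      (((2 ^ a k : ℝ) : ℂ) • dilate (2 ^ k) (by positivity) g)) x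
      = (if j ∈ S then ((2 ^ a j : ℝ) : ℂ) * g ((2 : ℝ) ^ j • x) else 0) • v := fun j x => by
    rw [lpPiece_sum]
    have : ∀ k ∈ S, lpPiece (φ j) (tensorDist d v
        (((2 ^ a k : ℝ) : ℂ) • dilate (2 ^ k) (by positivity) g)) x
        = if j = k then (((2 ^ a j : ℝ) : ℂ) * g ((2 : ℝ) ^ j • x)) • v else 0 := fun k _ => by
      rw [lpPiece_tensorDist v (φ j) _ (if j = k then 1 else 0) fun ξ => by
        rw [hat_smul, mul_left_comm, hφ.hat_mul_hat_dilate hg, mul_left_comm]]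
      split_ifs with h
      · subst h
        rw [one_mul]
        rfl
      · simp
    rw [Finset.sum_congr rfl this, Finset.sum_ite_eq]
    split_ifs <;> simp
  rw [besovNorm, ← seqNorm_const_mul hq]
  congr 1
  funext j
  by_cases hj : j ∈ S
  · rw [if_pos hj, weightedLpNorm_congr_enorm (g' := fun x => ((2 ^ a j : ℝ) : ℂ) *
      (fun x => g ((2 : ℝ) ^ j • x)) x) (fun x => by
        rw [hpc, if_pos hj, enorm_smul, hve, mul_one]), weightedLpNorm_const_mul hp,
      weightedLpNorm_comp_smul hd hp γ g (by positivity)]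
    have h1 : ‖((2 ^ a j : ℝ) : ℂ)‖ₑ = 2 ^ a j := by
      rw [← ofReal_norm, Complex.norm_real, Real.norm_of_nonneg (by positivity),
        ← ENNReal.ofReal_rpow_of_pos (by norm_num)]
      norm_num
    have h2 : ENNReal.ofReal ((2 : ℝ) ^ j) = 2 ^ (j : ℝ) := by
      rw [ENNReal.ofReal_pow (by norm_num), ENNReal.rpow_natCast]
      norm_num
    have hadd : ∀ x y : ℝ, (2 : ℝ≥0∞) ^ (x + y) = 2 ^ x * 2 ^ y := fun x y =>
      ENNReal.rpow_add x y (by norm_num) (by norm_num)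
    rw [h1, h2, ← ENNReal.rpow_mul, show a j + (j : ℝ) * (s - divExp (d + γ) p)
      = (j : ℝ) * s + a j + (j : ℝ) * -divExp (d + γ) p by ring, hadd, hadd]
    ring
  · rw [if_neg hj, mul_zero, weightedLpNorm_congr_enorm (g' := fun _ : Rd d => (0 : ℂ)) (fun x => by
      rw [hpc, if_neg hj, zero_smul, enorm_zero, enorm_zero]), weightedLpNorm_zero hp, mul_zero]

theorem tendsto_natCast_add_one :
    Filter.Tendsto (fun n : ℕ => (n : ℝ) + 1) Filter.atTop Filter.atTop :=
  Filter.tendsto_atTop_add_const_right _ _ tendsto_natCast_atTop_atTop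

end necessity

/-! ### Necessary conditions by dilation, translation and lacunary sums -/

section necessaryConditions
variable {d : ℕ} {X : Type*} [NormedAddCommGroup X] [NormedSpace ℂ X] [CompleteSpace X]
  [Nontrivial X] {φ : ℕ → 𝓢(Rd d, ℂ)} {s₀ s₁ : ℝ} {p₀ p₁ q₀ q₁ : ℝ≥0∞} {γ₀ γ₁ : ℝ}

/-- An embedding gives an inequality of weighted `L^p` norms for low frequencies. -/
theorem BesovEmbedding.exists_low_frequency_le
    (h : BesovEmbedding X φ s₀ s₁ p₀ p₁ q₀ q₁ γ₀ γ₁) (hφ : IsLittlewoodPaley φ)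
    (hp₀ : p₀ ≠ 0) (hp₁ : p₁ ≠ 0) (hq₀ : q₀ ≠ 0) (hq₁ : q₁ ≠ 0) :
    ∃ C : ℝ≥0∞, C ≠ ∞ ∧ ∀ g : 𝓢(Rd d, ℂ), (∀ ξ, hat g ξ ≠ 0 → ‖ξ‖ ≤ 1) →
      weightedLpNorm p₁ γ₁ g ≤ C * weightedLpNorm p₀ γ₀ g := by
  obtain ⟨C, hC, hle⟩ := h.exists_le
  obtain ⟨v, hv⟩ := exists_norm_eq X zero_le_one
  refine ⟨C, hC, fun g hg => ?_⟩
  have := hle (tensorDist d v g)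
  rwa [hφ.besovNorm_of_low_frequency hv hg _ hp₁ hq₁,
    hφ.besovNorm_of_low_frequency hv hg _ hp₀ hq₀] at this

theorem hat_dilate_low_frequency {g : 𝓢(Rd d, ℂ)} (hg : ∀ ξ, hat g ξ ≠ 0 → ‖ξ‖ ≤ 1) {t : ℝ}
    (ht : 0 < t) (ht1 : t ≤ 1) (ξ : Rd d) (hξ : hat (dilate t ht.ne' g) ξ ≠ 0) : ‖ξ‖ ≤ 1 := by
  rw [hat_dilate ht] at hξ
  have h1 := hg _ (right_ne_zero_of_mul hξ)
  rw [norm_smul, norm_inv, Real.norm_of_nonneg ht.le, inv_mul_le_iff₀ ht] at h1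
  linarith

/-- Necessity of the condition on the homogeneities, by dilation to low frequencies. -/
theorem BesovEmbedding.divExp_add_le (h : BesovEmbedding X φ s₀ s₁ p₀ p₁ q₀ q₁ γ₀ γ₁)
    (hd : 1 ≤ d) (hφ : IsLittlewoodPaley φ) (hp₀ : p₀ ≠ 0) (hp₁ : p₁ ≠ 0) (hq₀ : q₀ ≠ 0)
    (hq₁ : q₁ ≠ 0) (hγ₀ : -(d : ℝ) < γ₀) : divExp (d + γ₁) p₁ ≤ divExp (d + γ₀) p₀ := by
  obtain ⟨C, hC, hle⟩ := h.exists_low_frequency_le hφ hp₀ hp₁ hq₀ hq₁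
  obtain ⟨g, -, hg0, hg⟩ := exists_nonneg_test_function d
  refine le_of_forall_rpow_le tendsto_natCast_add_one
    (A := weightedLpNorm p₁ γ₁ g) (D := C * weightedLpNorm p₀ γ₀ g)
    (weightedLpNorm_ne_zero hd g.continuous hg0 hp₁ γ₁)
    (ENNReal.mul_ne_top hC (weightedLpNorm_schwartz_ne_top hd g hp₀ hγ₀))
    (Filter.Eventually.of_forall fun n => ?_)
  have ht : (0 : ℝ) < ((n : ℝ) + 1)⁻¹ := by positivity
  have h1 := hle (dilate _ ht.ne' g)
    (hat_dilate_low_frequency hg ht (inv_le_one_of_one_le₀ (by simp)))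
  have h2 : ∀ (p : ℝ≥0∞) (γ : ℝ), p ≠ 0 → weightedLpNorm p γ (dilate _ ht.ne' g)
      = ENNReal.ofReal ((n : ℝ) + 1) ^ divExp (d + γ) p * weightedLpNorm p γ g := fun p γ hp => by
    refine (weightedLpNorm_comp_smul hd hp γ g ht).trans ?_
    rw [ENNReal.ofReal_inv_of_pos (by positivity), ENNReal.inv_rpow, ENNReal.rpow_neg, inv_inv]
  rw [h2 _ _ hp₁, h2 _ _ hp₀] at h1
  rw [mul_comm, mul_assoc, mul_comm (weightedLpNorm p₀ γ₀ g)]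
  exact h1

/-- Necessity of the condition on the weights, by translation to infinity. -/
theorem BesovEmbedding.divExp_le (h : BesovEmbedding X φ s₀ s₁ p₀ p₁ q₀ q₁ γ₀ γ₁)
    (hd : 1 ≤ d) (hφ : IsLittlewoodPaley φ) (hp₀ : p₀ ≠ 0) (hp₁ : p₁ ≠ 0) (hq₀ : q₀ ≠ 0)
    (hq₁ : q₁ ≠ 0) (hγ₀ : -(d : ℝ) < γ₀) : divExp γ₁ p₁ ≤ divExp γ₀ p₀ := by
  obtain ⟨C, hC, hle⟩ := h.exists_low_frequency_le hφ hp₀ hp₁ hq₀ hq₁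
  obtain ⟨g, -, hg0, hg⟩ := exists_nonneg_test_function d
  obtain ⟨c, hc, hlow⟩ := le_weightedLpNorm_translate hd g hg0 hp₁ γ₁
  obtain ⟨K, hK, hup⟩ := weightedLpNorm_translate_le hd g hp₀ hγ₀
  have hnt : Nontrivial (Rd d) := by
    have : Nonempty (Fin d) := ⟨⟨0, hd⟩⟩
    infer_instance
  -- The translation `a` has norm `n`, so `n + 1` is its bracket; the lower bound for translates
  -- requires `n ≥ 2`.
  refine le_of_forall_rpow_le tendsto_natCast_add_one hc (ENNReal.mul_ne_top hC hK)
    (Filter.eventually_atTop.2 ⟨2, fun n hn => ?_⟩)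
  obtain ⟨a, ha⟩ := exists_norm_eq (Rd d) n.cast_nonneg
  have hae : ENNReal.ofReal ((n : ℝ) + 1) = 1 + ‖a‖ₑ := by
    rw [add_comm, ENNReal.ofReal_add zero_le_one n.cast_nonneg, ENNReal.ofReal_one, ← ofReal_norm,
      ha]
  have h1 := hle (g.compSubConstCLM ℂ a) fun ξ hξ => hg ξ (by
    rw [hat_translate] at hξ
    exact right_ne_zero_of_mul hξ)
  rw [hae, mul_assoc]
  exact (hlow a (by rw [ha]; exact_mod_cast hn)).trans (h1.trans (by gcongr; exact hup a))

/-- Necessity of the condition on the smoothness parameters, by dilation to high frequencies. -/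
theorem BesovEmbedding.smoothness_le (h : BesovEmbedding X φ s₀ s₁ p₀ p₁ q₀ q₁ γ₀ γ₁)
    (hd : 1 ≤ d) (hφ : IsLittlewoodPaley φ) (hp₀ : p₀ ≠ 0) (hp₁ : p₁ ≠ 0) (hq₀ : q₀ ≠ 0)
    (hq₁ : q₁ ≠ 0) (hγ₀ : -(d : ℝ) < γ₀) :
    s₁ - divExp (d + γ₁) p₁ ≤ s₀ - divExp (d + γ₀) p₀ := by
  obtain ⟨C, hC, hle⟩ := h.exists_le
  obtain ⟨v, hv⟩ := exists_norm_eq X zero_le_one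
  obtain ⟨g, ⟨x, hx⟩, hg⟩ := exists_annular_test_function hd
  refine le_of_forall_rpow_le (tendsto_pow_atTop_atTop_of_one_lt one_lt_two)
    (A := weightedLpNorm p₁ γ₁ g) (D := C * weightedLpNorm p₀ γ₀ g)
    (weightedLpNorm_ne_zero hd g.continuous hx hp₁ γ₁)
    (ENNReal.mul_ne_top hC (weightedLpNorm_schwartz_ne_top hd g hp₀ hγ₀))
    (Filter.Eventually.of_forall fun n => ?_)
  have h1 := (hφ.besovNorm_lacunary hd hv hg {n} 0 s₁ hp₁ hq₁ γ₁).symm.trans_le (hle _)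
  rw [hφ.besovNorm_lacunary hd hv hg {n} 0 s₀ hp₀ hq₀ γ₀] at h1
  have h2 : ∀ (q : ℝ≥0∞) (τ : ℝ), q ≠ 0 → seqNorm q (fun j : ℕ => if j ∈ ({n} : Finset ℕ) then
      (2 : ℝ≥0∞) ^ ((0 : ℕ → ℝ) j + (j : ℝ) * τ) else 0) = ENNReal.ofReal (2 ^ n) ^ τ :=
    fun q τ hq => by
      rw [← seqNorm_single hq n (ENNReal.ofReal (2 ^ n) ^ τ)]
      congr 1
      funext j
      simp only [Finset.mem_singleton]
      split_ifs with hj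
      · subst hj
        rw [ENNReal.ofReal_pow (by norm_num), ← ENNReal.rpow_natCast, ← ENNReal.rpow_mul]
        simp
      · rfl
  rw [h2 _ _ hq₁, h2 _ _ hq₀, ← mul_assoc] at h1
  exact h1

/-- Necessity of the condition on the microscopic parameters in the sharp case, by lacunary sums. -/
theorem BesovEmbedding.microscopic_le (h : BesovEmbedding X φ s₀ s₁ p₀ p₁ q₀ q₁ γ₀ γ₁)
    (hd : 1 ≤ d) (hφ : IsLittlewoodPaley φ) (hp₀ : p₀ ≠ 0) (hp₁ : p₁ ≠ 0) (hq₀ : q₀ ≠ 0)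
    (hq₁ : q₁ ≠ 0) (hγ₀ : -(d : ℝ) < γ₀)
    (hs : s₁ - divExp (d + γ₁) p₁ = s₀ - divExp (d + γ₀) p₀) : q₀ ≤ q₁ := by
  obtain ⟨C, hC, hle⟩ := h.exists_le
  obtain ⟨v, hv⟩ := exists_norm_eq X zero_le_one
  obtain ⟨g, ⟨x, hx⟩, hg⟩ := exists_annular_test_function hd
  have key : (q₁⁻¹).toReal ≤ (q₀⁻¹).toReal := by
    refine le_of_forall_rpow_le tendsto_natCast_add_one
      (A := weightedLpNorm p₁ γ₁ g) (D := C * weightedLpNorm p₀ γ₀ g)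
      (weightedLpNorm_ne_zero hd g.continuous hx hp₁ γ₁)
      (ENNReal.mul_ne_top hC (weightedLpNorm_schwartz_ne_top hd g hp₀ hγ₀))
      (Filter.Eventually.of_forall fun n => ?_)
    -- The amplitudes give all frequencies equal size in the source norm, and by `hs` in the target
    -- norm as well. With `n + 1` frequencies the norms are multiples of `(n + 1) ^ (1 / q)`.
    set a : ℕ → ℝ := fun j => -((j : ℝ) * (s₀ - divExp (d + γ₀) p₀)) with ha
    have h1 := (hφ.besovNorm_lacunary hd hv hg (Finset.range (n + 1)) a s₁ hp₁ hq₁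
      γ₁).symm.trans_le (hle _)
    rw [hφ.besovNorm_lacunary hd hv hg (Finset.range (n + 1)) a s₀ hp₀ hq₀ γ₀, hs] at h1
    simp only [ha, neg_add_cancel, ENNReal.rpow_zero, Finset.mem_range] at h1
    rw [seqNorm_indicator hq₁ (by omega), seqNorm_indicator hq₀ (by omega), ← mul_assoc] at h1
    have hn : ENNReal.ofReal ((n : ℝ) + 1) = ((n + 1 : ℕ) : ℝ≥0∞) := by
      rw [← Nat.cast_succ, ENNReal.ofReal_natCast]
    rw [hn]
    exact h1
  rw [ENNReal.toReal_le_toReal (ENNReal.inv_ne_top.2 hq₁) (ENNReal.inv_ne_top.2 hq₀),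
    ENNReal.inv_le_inv] at key
  exact key

end necessaryConditions

/-! ### Dyadic sums and scale invariance -/

section critical
variable {d : ℕ}

theorem sum_rpow_le_rpow_sum {ι : Type*} (S : Finset ι) (a : ι → ℝ≥0∞) {p : ℝ} (hp : 1 ≤ p) :
    ∑ i ∈ S, a i ^ p ≤ (∑ i ∈ S, a i) ^ p := by
  classical
  induction S using Finset.induction_on with
  | empty => simp
  | insert i S hi ih =>
    rw [Finset.sum_insert hi, Finset.sum_insert hi]
    exact (add_le_add_right ih _).trans (ENNReal.add_rpow_le_rpow_add _ _ hp)

theorem tsum_int_rpow_neg_abs_ne_top {α : ℝ} (hα : 0 < α) :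
    ∑' i : ℤ, (2 : ℝ≥0∞) ^ (-(α * |(i : ℝ)|)) ≠ ∞ := by
  have hr0 : (0 : ℝ) < 2 ^ (-α) := by positivity
  have hr1 : (2 : ℝ) ^ (-α) < 1 := Real.rpow_lt_one_of_one_lt_of_neg one_lt_two (by linarith)
  have hpow : ∀ n : ℕ, (2 : ℝ) ^ (-(α * |(n : ℝ)|)) = (2 ^ (-α)) ^ n := fun n => by
    rw [abs_of_nonneg n.cast_nonneg, ← neg_mul, Real.rpow_mul_natCast (by norm_num)]
  have hs : Summable fun i : ℤ => (2 : ℝ) ^ (-(α * |(i : ℝ)|)) := by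
    refine Summable.of_nat_of_neg ?_ ?_
    · refine (summable_geometric_of_lt_one hr0.le hr1).congr fun n => ?_
      rw [← hpow]
      simp
    · refine (summable_geometric_of_lt_one hr0.le hr1).congr fun n => ?_
      rw [← hpow]
      simp
  have h2 : ∀ i : ℤ, (2 : ℝ≥0∞) ^ (-(α * |(i : ℝ)|))
      = ENNReal.ofReal ((2 : ℝ) ^ (-(α * |(i : ℝ)|))) := fun i => by
    rw [← ENNReal.ofReal_rpow_of_pos (by norm_num)]
    norm_num
  simp only [h2]
  exact hs.tsum_ofReal_ne_top

/-- A function with power decay at the origin and at infinity has bounded dyadic sums. -/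
theorem sum_dyadic_le {α : ℝ} (hα : 0 < α) {A : ℝ≥0∞} (hA : A ≠ ∞) {Θ : Rd d → ℝ≥0∞}
    (h0 : ∀ y, Θ y ≤ A * ‖y‖ₑ ^ α) (h1 : ∀ y, y ≠ 0 → Θ y ≤ A * ‖y‖ₑ ^ (-α)) :
    ∃ C : ℝ≥0∞, C ≠ ∞ ∧ ∀ (n : ℕ) (x : Rd d),
      ∑ j ∈ Finset.range n, Θ (((2 : ℝ) ^ j)⁻¹ • x) ≤ C := by
  set T : ℝ≥0∞ := ∑' i : ℤ, (2 : ℝ≥0∞) ^ (-(α * |(i : ℝ)|)) with hT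
  have hTt : T ≠ ∞ := tsum_int_rpow_neg_abs_ne_top hα
  refine ⟨A * 2 ^ α * T, by finiteness, fun n x => ?_⟩
  by_cases hx : x = 0
  · subst hx
    have : Θ 0 = 0 := by
      have := h0 0
      rwa [enorm_zero, ENNReal.zero_rpow_of_pos hα, mul_zero, nonpos_iff_eq_zero] at this
    simp [this]
  have hx0 : 0 < ‖x‖ := norm_pos_iff.2 hx
  -- Then `2 ^ (-j) x` has norm between `2 ^ (m - j)` and `2 ^ (m - j + 1)`. The two decay bounds
  -- give a two-sided geometric series in `m - j`, and `2 ^ α` pays for the rounding.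
  set m : ℤ := Int.log 2 ‖x‖ with hm
  have hml : (2 : ℝ) ^ m ≤ ‖x‖ := by exact_mod_cast Int.zpow_log_le_self (by norm_num) hx0
  have hmu : ‖x‖ ≤ (2 : ℝ) ^ (m + 1) := by
    exact_mod_cast (Int.lt_zpow_succ_log_self (b := 2) (by norm_num) ‖x‖).le
  have hterm : ∀ j : ℕ, Θ (((2 : ℝ) ^ j)⁻¹ • x)
      ≤ A * 2 ^ α * 2 ^ (-(α * |((m - j : ℤ) : ℝ)|)) := fun j => by
    have hnorm : ‖((2 : ℝ) ^ j)⁻¹ • x‖ = ((2 : ℝ) ^ j)⁻¹ * ‖x‖ := by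
      rw [norm_smul, norm_inv, norm_pow, Real.norm_ofNat]
    have hz : ∀ l : ℤ, ((2 : ℝ) ^ j)⁻¹ * 2 ^ l = 2 ^ (l - j : ℤ) := fun l => by
      rw [zpow_sub₀ (by norm_num), zpow_natCast, inv_mul_eq_div]
    have he : ∀ l : ℤ, ENNReal.ofReal ((2 : ℝ) ^ l) = 2 ^ (l : ℝ) := fun l => by
      rw [← Real.rpow_intCast, ← ENNReal.ofReal_rpow_of_pos (by norm_num)]
      norm_num
    have hl : (2 : ℝ≥0∞) ^ ((m - j : ℤ) : ℝ) ≤ ‖((2 : ℝ) ^ j)⁻¹ • x‖ₑ := by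
      rw [← he, ← hz, ← ofReal_norm, hnorm]
      gcongr
    have hu : ‖((2 : ℝ) ^ j)⁻¹ • x‖ₑ ≤ (2 : ℝ≥0∞) ^ (((m - j : ℤ) : ℝ) + 1) := by
      rw [show ((m - j : ℤ) : ℝ) + 1 = ((m + 1 - j : ℤ) : ℝ) by push_cast; ring, ← he, ← hz,
        ← ofReal_norm, hnorm]
      gcongr
    rw [mul_assoc, ← ENNReal.rpow_add _ _ (by norm_num) (by norm_num)]
    rcases le_total (0 : ℝ) ((m - j : ℤ) : ℝ) with hi | hi
    · refine (h1 _ (by simpa using hx)).trans ?_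
      gcongr
      rw [abs_of_nonneg hi]
      calc ‖((2 : ℝ) ^ j)⁻¹ • x‖ₑ ^ (-α) ≤ ((2 : ℝ≥0∞) ^ ((m - j : ℤ) : ℝ)) ^ (-α) :=
            ennreal_rpow_le_rpow_of_nonpos hl (by linarith)
        _ = 2 ^ (((m - j : ℤ) : ℝ) * -α) := by rw [ENNReal.rpow_mul]
        _ ≤ _ := ENNReal.rpow_le_rpow_of_exponent_le (by norm_num) (by linarith)
    · refine (h0 _).trans ?_
      gcongr
      rw [abs_of_nonpos hi]
      calc ‖((2 : ℝ) ^ j)⁻¹ • x‖ₑ ^ α ≤ ((2 : ℝ≥0∞) ^ (((m - j : ℤ) : ℝ) + 1)) ^ α := by gcongr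
        _ = 2 ^ ((((m - j : ℤ) : ℝ) + 1) * α) := by rw [ENNReal.rpow_mul]
        _ ≤ _ := ENNReal.rpow_le_rpow_of_exponent_le (by norm_num) (by linarith)
  calc ∑ j ∈ Finset.range n, Θ (((2 : ℝ) ^ j)⁻¹ • x)
      ≤ ∑ j ∈ Finset.range n, A * 2 ^ α * 2 ^ (-(α * |((m - j : ℤ) : ℝ)|)) :=
        Finset.sum_le_sum fun j _ => hterm j
    _ = A * 2 ^ α * ∑ j ∈ Finset.range n, 2 ^ (-(α * |((m - j : ℤ) : ℝ)|)) := by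
        rw [Finset.mul_sum]
    _ ≤ A * 2 ^ α * T := by
        gcongr
        refine (ENNReal.sum_le_tsum _).trans ?_
        exact ENNReal.tsum_comp_le_tsum_of_injective (f := fun j : ℕ => (m - j : ℤ))
          (fun a b hab => by simpa using hab) fun i : ℤ => (2 : ℝ≥0∞) ^ (-(α * |(i : ℝ)|))

/-- The scale invariance of `∫ (t^α G(t x))^P ‖x‖^(α P - d) dx`. -/
theorem lintegral_scale_invariant {α P γ : ℝ} (hP : 0 ≤ P) (hγ : d + γ = α * P) (G : Rd d → ℝ≥0∞)
    {t : ℝ} (ht : 0 < t) :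
    ∫⁻ x, (ENNReal.ofReal t ^ α * G (t • x)) ^ P * ‖x‖ₑ ^ γ = ∫⁻ x, G x ^ P * ‖x‖ₑ ^ γ := by
  have ht0 : ENNReal.ofReal t ≠ 0 := by simpa using ht
  have htt : ENNReal.ofReal t ≠ ∞ := ENNReal.ofReal_ne_top
  have hfin : ∀ r : ℝ, ENNReal.ofReal t ^ r ≠ ∞ := fun r =>
    ENNReal.rpow_ne_top_of_ne_zero ht0 htt
  have h1 : ∀ x : Rd d, (ENNReal.ofReal t ^ α * G (t • x)) ^ P * ‖x‖ₑ ^ γ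
      = ENNReal.ofReal t ^ (d : ℝ) * (G (t • x) ^ P * ‖t • x‖ₑ ^ γ) := fun x => by
    rw [enorm_smul_of_pos ht, ENNReal.mul_rpow_of_ne_top htt (by simp),
      ENNReal.mul_rpow_of_nonneg _ _ hP, ← ENNReal.rpow_mul, ← hγ,
      ENNReal.rpow_add _ _ ht0 htt]
    ring
  simp only [h1]
  rw [lintegral_const_mul' _ _ (hfin _),
    lintegral_comp_smul (fun y : Rd d => G y ^ P * ‖y‖ₑ ^ γ) ht, ← mul_assoc,
    ← ENNReal.rpow_add _ _ ht0 htt]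
  simp

end critical

/-! ### Equal homogeneities: superposition of dilates -/

section critical
variable {d : ℕ}

/-- The sum `∑_{j < n} 2^(-jα) g(2^(-j) x)`, whose terms have the same weighted `L^p` norm for the
weights of homogeneity `α`. -/
def dyadicSum (α : ℝ) (g : 𝓢(Rd d, ℂ)) (n : ℕ) : 𝓢(Rd d, ℂ) :=
  ∑ j ∈ Finset.range n,
    ((((2 : ℝ) ^ j)⁻¹ ^ α : ℝ) : ℂ) • dilate ((2 : ℝ) ^ j)⁻¹ (by positivity) g

theorem hat_dyadicSum_low_frequency {g : 𝓢(Rd d, ℂ)} (hg : ∀ ξ, hat g ξ ≠ 0 → ‖ξ‖ ≤ 1) (α : ℝ)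
    (n : ℕ) (ξ : Rd d) (hξ : hat (dyadicSum α g n) ξ ≠ 0) : ‖ξ‖ ≤ 1 := by
  have hsum : hat (dyadicSum α g n) ξ = ∑ j ∈ Finset.range n,
      hat (((((2 : ℝ) ^ j)⁻¹ ^ α : ℝ) : ℂ) • dilate ((2 : ℝ) ^ j)⁻¹ (by positivity) g) ξ := by
    simp only [hat_eq, dyadicSum]
    rw [← SchwartzMap.fourierTransformCLM_apply (𝕜 := ℂ), map_sum]
    simp [Finset.mul_sum]
  rw [hsum] at hξ
  obtain ⟨j, -, hj⟩ := Finset.exists_ne_zero_of_sum_ne_zero hξ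
  rw [hat_smul] at hj
  exact hat_dilate_low_frequency hg (by positivity)
    (inv_le_one_of_one_le₀ (one_le_pow₀ (by norm_num))) ξ (right_ne_zero_of_mul hj)

/-- Nonnegativity of `g` excludes cancellation between the dilates. -/
theorem enorm_dyadicSum {g : 𝓢(Rd d, ℂ)} (hg : ∀ x, ∃ r : ℝ, 0 ≤ r ∧ g x = r) (α : ℝ) (n : ℕ)
    (x : Rd d) : ‖dyadicSum α g n x‖ₑ = ∑ j ∈ Finset.range n,
      ENNReal.ofReal ((2 : ℝ) ^ j)⁻¹ ^ α * ‖g (((2 : ℝ) ^ j)⁻¹ • x)‖ₑ := by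
  choose r hr0 hr using hg
  have h1 : dyadicSum α g n x = ((∑ j ∈ Finset.range n,
      ((2 : ℝ) ^ j)⁻¹ ^ α * r (((2 : ℝ) ^ j)⁻¹ • x) : ℝ) : ℂ) := by
    rw [dyadicSum, sum_apply, Complex.ofReal_sum]
    refine Finset.sum_congr rfl fun j _ => ?_
    rw [smul_apply, dilate_apply, hr, smul_eq_mul, ← Complex.ofReal_mul]
  have hpos : ∀ j ∈ Finset.range n, 0 ≤ ((2 : ℝ) ^ j)⁻¹ ^ α * r (((2 : ℝ) ^ j)⁻¹ • x) :=
    fun j _ => mul_nonneg (by positivity) (hr0 _)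
  rw [h1, ← ofReal_norm, Complex.norm_real, Real.norm_of_nonneg (Finset.sum_nonneg hpos),
    ENNReal.ofReal_sum_of_nonneg hpos]
  refine Finset.sum_congr rfl fun j _ => ?_
  rw [hr, ← ofReal_norm (r _ : ℂ), Complex.norm_real, Real.norm_of_nonneg (hr0 _),
    ENNReal.ofReal_mul (by positivity), ENNReal.ofReal_rpow_of_pos (by positivity)]

/-- Superadditivity of `t ↦ t ^ p` discards the cross terms, and scale invariance makes the
remaining `n` integrals equal. -/
theorem le_weightedLpNorm_dyadicSum (hd : 1 ≤ d) {g : 𝓢(Rd d, ℂ)}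
    (hg : ∀ x, ∃ r : ℝ, 0 ≤ r ∧ g x = r) {p : ℝ≥0∞} (hp : 1 ≤ p) (hp' : p ≠ ∞) {γ : ℝ} (n : ℕ) :
    (n : ℝ≥0∞) ^ (1 / p.toReal) * weightedLpNorm p γ g
      ≤ weightedLpNorm p γ (dyadicSum (divExp (d + γ) p) g n) := by
  have hP : 1 ≤ p.toReal := by
    rw [← ENNReal.toReal_one]
    exact ENNReal.toReal_mono hp' hp
  have hP0 : 0 < p.toReal := by linarith
  have hγ : d + γ = divExp (d + γ) p * p.toReal := by rw [divExp_eq_div]; field_simp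
  rw [weightedLpNorm_of_ne_top hd hp', weightedLpNorm_of_ne_top hd hp',
    ← ENNReal.mul_rpow_of_nonneg _ _ (by positivity)]
  gcongr
  calc (n : ℝ≥0∞) * ∫⁻ x, ‖g x‖ₑ ^ p.toReal * ‖x‖ₑ ^ γ
      = ∑ j ∈ Finset.range n, ∫⁻ x, (ENNReal.ofReal ((2 : ℝ) ^ j)⁻¹ ^ divExp (d + γ) p *
          ‖g (((2 : ℝ) ^ j)⁻¹ • x)‖ₑ) ^ p.toReal * ‖x‖ₑ ^ γ := by
        rw [Finset.sum_congr rfl fun j _ => lintegral_scale_invariant hP0.le hγ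
          (fun x => ‖g x‖ₑ) (by positivity : (0 : ℝ) < ((2 : ℝ) ^ j)⁻¹)]
        simp
    _ = ∫⁻ x, ∑ j ∈ Finset.range n, (ENNReal.ofReal ((2 : ℝ) ^ j)⁻¹ ^ divExp (d + γ) p *
          ‖g (((2 : ℝ) ^ j)⁻¹ • x)‖ₑ) ^ p.toReal * ‖x‖ₑ ^ γ := by
        rw [lintegral_finsetSum]
        intro j _
        have := g.continuous.measurable
        fun_prop
    _ ≤ _ := by
        refine lintegral_mono fun x => ?_
        simp only
        rw [← Finset.sum_mul, enorm_dyadicSum hg]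
        gcongr
        exact sum_rpow_le_rpow_sum _ _ hP

/-- With `S` the sum of the dilates, `S ‖x‖ ^ α` is bounded uniformly in `n`, so `S ^ P ‖x‖ ^ γ` is
at most a constant times `S ‖x‖ ^ (α - d)`. The latter integral is linear in `S` and scale
invariant, hence equal to `n` times a constant, finite because `α > 0`. -/
theorem weightedLpNorm_dyadicSum_le (hd : 1 ≤ d) {g : 𝓢(Rd d, ℂ)}
    (hg : ∀ x, ∃ r : ℝ, 0 ≤ r ∧ g x = r) {p : ℝ≥0∞} (hp : 1 ≤ p) (hp' : p ≠ ∞) {γ : ℝ}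
    (hγ : -(d : ℝ) < γ) :
    ∃ C : ℝ≥0∞, C ≠ ∞ ∧ ∀ n : ℕ, weightedLpNorm p γ (dyadicSum (divExp (d + γ) p) g n)
      ≤ C * (n : ℝ≥0∞) ^ (1 / p.toReal) := by
  have hP : 1 ≤ p.toReal := by
    rw [← ENNReal.toReal_one]
    exact ENNReal.toReal_mono hp' hp
  have hP0 : 0 < p.toReal := by linarith
  set P : ℝ := p.toReal with hPdef
  set α : ℝ := divExp (d + γ) p with hα
  have hγα : d + γ = α * P := by rw [hα, divExp_eq_div, ← hPdef]; field_simp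
  have hα0 : 0 < α := by
    rw [hα, divExp_eq_div]
    exact div_pos (by linarith) hP0
  have hnt : Nontrivial (Rd d) := by
    have : Nonempty (Fin d) := ⟨⟨0, hd⟩⟩
    infer_instance
  -- Decay of order `2 α` leaves `‖y‖ ^ (-α)` after multiplication by `‖y‖ ^ α`.
  obtain ⟨A, hA, hAg⟩ := enorm_le_bracket g (2 * α)
  have hbr : ∀ y : Rd d, (1 + ‖y‖ₑ) ^ (-(2 * α)) ≤ 1 := fun y => by
    simpa using bracket_rpow_le_rpow y (by linarith : -(2 * α) ≤ 0)
  obtain ⟨C, hC, hsum⟩ := sum_dyadic_le (d := d) hα0 hA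
    (Θ := fun y => ‖y‖ₑ ^ α * ‖g y‖ₑ)
    (fun y => by
      rw [mul_comm]
      gcongr
      exact (hAg y).trans (mul_le_of_le_one_right' (hbr y)))
    (fun y hy => by
      have hy0 : ‖y‖ₑ ≠ 0 := by simpa using hy
      calc ‖y‖ₑ ^ α * ‖g y‖ₑ ≤ ‖y‖ₑ ^ α * (A * ‖y‖ₑ ^ (-(2 * α))) := by
            gcongr
            exact (hAg y).trans (mul_le_mul' le_rfl
              (ennreal_rpow_le_rpow_of_nonpos le_add_self (by linarith)))
        _ = A * ‖y‖ₑ ^ (-α) := by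
            rw [mul_left_comm, ← ENNReal.rpow_add _ _ hy0 (by simp)]
            congr 2
            ring)
  set B : ℝ≥0∞ := ∫⁻ x, ‖g x‖ₑ ^ (1 : ℝ) * ‖x‖ₑ ^ (α - d) with hB
  have hBt : B ≠ ∞ := by
    have := weightedLpNorm_schwartz_ne_top hd g (p := 1) one_ne_zero
      (γ := α - d) (by linarith)
    rw [weightedLpNorm_of_ne_top hd ENNReal.one_ne_top] at this
    simpa [hB] using this
  refine ⟨(C ^ (P - 1) * B) ^ (1 / P), by
    have : 0 ≤ P - 1 := by linarith
    finiteness, fun n => ?_⟩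
  rw [weightedLpNorm_of_ne_top hd hp', ← ENNReal.mul_rpow_of_nonneg _ _ (by positivity)]
  gcongr
  calc ∫⁻ x, ‖dyadicSum α g n x‖ₑ ^ P * ‖x‖ₑ ^ γ
      ≤ ∫⁻ x, C ^ (P - 1) * ∑ j ∈ Finset.range n, (ENNReal.ofReal ((2 : ℝ) ^ j)⁻¹ ^ α *
          ‖g (((2 : ℝ) ^ j)⁻¹ • x)‖ₑ) ^ (1 : ℝ) * ‖x‖ₑ ^ (α - d) := by
        refine lintegral_mono_ae ?_
        filter_upwards [Measure.ae_ne volume (0 : Rd d)] with x hx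
        have hx0 : ‖x‖ₑ ≠ 0 := by simpa using hx
        have hxt : ‖x‖ₑ ≠ ∞ := by simp
        simp only [ENNReal.rpow_one]
        rw [← Finset.sum_mul, enorm_dyadicSum hg]
        set S : ℝ≥0∞ := ∑ j ∈ Finset.range n, ENNReal.ofReal ((2 : ℝ) ^ j)⁻¹ ^ α *
          ‖g (((2 : ℝ) ^ j)⁻¹ • x)‖ₑ with hS
        have hSC : S * ‖x‖ₑ ^ α ≤ C := by
          refine le_trans (le_of_eq ?_) (hsum n x)
          rw [hS, Finset.sum_mul]
          refine Finset.sum_congr rfl fun j _ => ?_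
          rw [enorm_smul_of_pos (by positivity), ENNReal.mul_rpow_of_nonneg _ _ hα0.le]
          ring
        have hP1 : 0 ≤ P - 1 := by linarith
        calc S ^ P * ‖x‖ₑ ^ γ = (S * ‖x‖ₑ ^ α) ^ (P - 1) * (S * ‖x‖ₑ ^ (α - d)) := by
              rw [ENNReal.mul_rpow_of_nonneg _ _ hP1, ← ENNReal.rpow_mul,
                show γ = α * (P - 1) + (α - d) by linarith, ENNReal.rpow_add _ _ hx0 hxt,
                show S ^ P = S ^ (P - 1) * S by
                  conv_lhs => rw [show P = (P - 1) + 1 by ring]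
                  rw [ENNReal.rpow_add_of_nonneg _ _ hP1 zero_le_one, ENNReal.rpow_one]]
              ring
          _ ≤ _ := by gcongr
    _ = C ^ (P - 1) * ∑ j ∈ Finset.range n, ∫⁻ x, (ENNReal.ofReal ((2 : ℝ) ^ j)⁻¹ ^ α *
          ‖g (((2 : ℝ) ^ j)⁻¹ • x)‖ₑ) ^ (1 : ℝ) * ‖x‖ₑ ^ (α - d) := by
        rw [lintegral_const_mul' _ _ (by
          have : 0 ≤ P - 1 := by linarith
          finiteness), lintegral_finsetSum]
        intro j _
        have := g.continuous.measurable
        fun_prop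
    _ = C ^ (P - 1) * B * n := by
        rw [Finset.sum_congr rfl fun j _ => lintegral_scale_invariant (α := α) (P := 1)
          (γ := α - d) zero_le_one (by ring) (fun x => ‖g x‖ₑ)
          (by positivity : (0 : ℝ) < ((2 : ℝ) ^ j)⁻¹)]
        rw [Finset.sum_const, Finset.card_range, nsmul_eq_mul, ← hB]
        ring

/-- Necessity of `p₀ ≤ p₁` for equal homogeneities, by superposition of dilates. -/
theorem BesovEmbedding.exponent_le {X : Type*} [NormedAddCommGroup X] [NormedSpace ℂ X]
    [CompleteSpace X] [Nontrivial X] {φ : ℕ → 𝓢(Rd d, ℂ)} {s₀ s₁ : ℝ} {p₀ p₁ q₀ q₁ : ℝ≥0∞}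
    {γ₀ γ₁ : ℝ} (h : BesovEmbedding X φ s₀ s₁ p₀ p₁ q₀ q₁ γ₀ γ₁) (hd : 1 ≤ d)
    (hφ : IsLittlewoodPaley φ) (hp₀ : 1 ≤ p₀) (hp₁ : 1 ≤ p₁) (hp₀' : p₀ ≠ ∞) (hp₁' : p₁ ≠ ∞)
    (hq₀ : q₀ ≠ 0) (hq₁ : q₁ ≠ 0) (hγ₀ : -(d : ℝ) < γ₀)
    (hα : divExp (d + γ₁) p₁ = divExp (d + γ₀) p₀) : p₀ ≤ p₁ := by
  have hz₀ : p₀ ≠ 0 := (one_pos.trans_le hp₀).ne'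
  have hz₁ : p₁ ≠ 0 := (one_pos.trans_le hp₁).ne'
  obtain ⟨C, hC, hle⟩ := h.exists_low_frequency_le hφ hz₀ hz₁ hq₀ hq₁
  obtain ⟨g, hnn, hg0, hg⟩ := exists_nonneg_test_function d
  obtain ⟨K, hK, hup⟩ := weightedLpNorm_dyadicSum_le hd hnn hp₀ hp₀' hγ₀
  have key : 1 / p₁.toReal ≤ 1 / p₀.toReal := by
    refine le_of_forall_rpow_le tendsto_natCast_atTop_atTop
      (weightedLpNorm_ne_zero hd g.continuous hg0 hz₁ γ₁) (ENNReal.mul_ne_top hC hK)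
      (Filter.Eventually.of_forall fun n => ?_)
    have h1 := le_weightedLpNorm_dyadicSum hd hnn hp₁ hp₁' (γ := γ₁) n
    -- Equal homogeneities let the same dyadic sum serve both norms.
    rw [hα] at h1
    rw [ENNReal.ofReal_natCast, mul_comm, mul_assoc]
    exact h1.trans ((hle _ (hat_dyadicSum_low_frequency hg _ n)).trans (by gcongr; exact hup n))
  rw [one_div_le_one_div (ENNReal.toReal_pos hz₁ hp₁') (ENNReal.toReal_pos hz₀ hp₀')] at key
  exact (ENNReal.toReal_le_toReal hp₀' hp₁').1 key

end critical

end WeightedBesov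

end

/-! ### The characterization -/

theorem theorem1p1 {d : ℕ} (hd : 1 ≤ d)
    {X : Type*} [NormedAddCommGroup X] [NormedSpace ℂ X] [CompleteSpace X] [Nontrivial X]
    (φ : ℕ → 𝓢(WeightedBesov.Rd d, ℂ)) (hφ : WeightedBesov.IsLittlewoodPaley φ)
    (p₀ p₁ q₀ q₁ : ℝ≥0∞) (hp₀ : 1 < p₀) (hp₁ : 1 < p₁) (hq₀ : 1 ≤ q₀) (hq₁ : 1 ≤ q₁)
    (s₀ s₁ γ₀ γ₁ : ℝ) (hγ₀ : -(d : ℝ) < γ₀) (hγ₁ : -(d : ℝ) < γ₁) :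
    WeightedBesov.BesovEmbedding X φ s₀ s₁ p₀ p₁ q₀ q₁ γ₀ γ₁ ↔
      -- the trivial case; for `p₀ = p₁ = ∞` the weights do not enter the spaces
      ((γ₀ = γ₁ ∨ p₀ = ∞) ∧ p₀ = p₁ ∧ (s₀ > s₁ ∨ (s₀ = s₁ ∧ q₀ ≤ q₁))) ∨
      -- the subcritical case
      (WeightedBesov.divExp γ₁ p₁ ≤ WeightedBesov.divExp γ₀ p₀ ∧
        WeightedBesov.divExp (d + γ₁) p₁ < WeightedBesov.divExp (d + γ₀) p₀ ∧
        s₀ - WeightedBesov.divExp (d + γ₀) p₀ > s₁ - WeightedBesov.divExp (d + γ₁) p₁) ∨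
      -- the sharp case
      (WeightedBesov.divExp γ₁ p₁ ≤ WeightedBesov.divExp γ₀ p₀ ∧
        WeightedBesov.divExp (d + γ₁) p₁ < WeightedBesov.divExp (d + γ₀) p₀ ∧
        q₀ ≤ q₁ ∧
        s₀ - WeightedBesov.divExp (d + γ₀) p₀ = s₁ - WeightedBesov.divExp (d + γ₁) p₁) := by
  have hz₀ : p₀ ≠ 0 := (one_pos.trans hp₀).ne'
  have hz₁ : p₁ ≠ 0 := (one_pos.trans hp₁).ne'
  have hy₀ : q₀ ≠ 0 := (one_pos.trans_le hq₀).ne'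
  have hy₁ : q₁ ≠ 0 := (one_pos.trans_le hq₁).ne'
  constructor
  · intro h
    have hhom := h.divExp_add_le hd hφ hz₀ hz₁ hy₀ hy₁ hγ₀
    have hwt := h.divExp_le hd hφ hz₀ hz₁ hy₀ hy₁ hγ₀
    have hsm := h.smoothness_le hd hφ hz₀ hz₁ hy₀ hy₁ hγ₀
    have hmic := h.microscopic_le hd hφ hz₀ hz₁ hy₀ hy₁ hγ₀
    rcases hhom.lt_or_eq with hlt | heq
    · rcases hsm.lt_or_eq with hs | hs
      · exact Or.inr (Or.inl ⟨hwt, hlt, hs⟩)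
      · exact Or.inr (Or.inr ⟨hwt, hlt, hmic hs, hs.symm⟩)
    -- The homogeneity is zero for `p = ∞` and positive for finite `p`, so equality makes both
    -- exponents infinite or both finite.
    · have hexp : p₀ = p₁ ∧ (γ₀ = γ₁ ∨ p₀ = ∞) := by
        by_cases h₀ : p₀ = ∞
        · refine ⟨?_, Or.inr h₀⟩
          by_contra hne
          have h₁ : p₁ ≠ ∞ := fun h₁ => hne (h₀.trans h₁.symm)
          have hpos := ENNReal.toReal_pos hz₁ h₁
          rw [h₀, WeightedBesov.divExp_top, WeightedBesov.divExp_eq_div] at heq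
          exact (div_pos (by linarith) hpos).ne' heq
        · have hpos₀ := ENNReal.toReal_pos hz₀ h₀
          have h₁ : p₁ ≠ ∞ := fun h₁ => by
            rw [h₁, WeightedBesov.divExp_top, WeightedBesov.divExp_eq_div] at heq
            exact (div_pos (by linarith) hpos₀).ne heq
          have hpos₁ := ENNReal.toReal_pos hz₁ h₁
          have hle := h.exponent_le hd hφ hp₀.le hp₁.le h₀ h₁ hy₀ hy₁ hγ₀ heq
          have hd0 : (0 : ℝ) < d := by exact_mod_cast hd
          -- Subtracting the weight condition from the equality of homogeneities leaves `d / p₀ ≤ d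
          -- / p₁`.
          have hge : p₁ ≤ p₀ := by
            rw [WeightedBesov.divExp_eq_div, WeightedBesov.divExp_eq_div] at heq hwt
            rw [add_div, add_div] at heq
            have : (d : ℝ) / p₀.toReal ≤ d / p₁.toReal := by linarith
            rw [div_le_div_iff_of_pos_left hd0 hpos₀ hpos₁] at this
            exact (ENNReal.toReal_le_toReal h₁ h₀).1 this
          have hpe := le_antisymm hle hge
          refine ⟨hpe, Or.inl ?_⟩
          rw [hpe, WeightedBesov.divExp_eq_div, WeightedBesov.divExp_eq_div,
            div_left_inj' hpos₁.ne'] at heq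
          linarith
      refine Or.inl ⟨hexp.2, hexp.1, ?_⟩
      rw [heq] at hsm hmic
      rcases (by linarith : s₁ ≤ s₀).lt_or_eq with hs | hs
      · exact Or.inl hs
      · exact Or.inr ⟨hs.symm, hmic (by rw [hs])⟩
  · rintro (⟨hγ, rfl, hs⟩ | ⟨hγ, hδ, hs⟩ | ⟨hγ, hδ, hq, hs⟩)
    · refine WeightedBesov.besovEmbedding_of_pieces φ hq₀ hq₁ ENNReal.one_ne_top (δ := 0)
        (fun f k => ?_) ?_
      · rw [WeightedBesov.weightedLpNorm_eq_of_eq_or_top hγ]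
        simp
      · rw [add_zero]
        exact hs.imp id fun h => ⟨h.1.symm, h.2⟩
    · exact hφ.besovEmbedding hd hp₀ hp₁ hq₀ hq₁ hγ₁ hγ hδ (Or.inl hs)
    · exact hφ.besovEmbedding hd hp₀ hp₁ hq₀ hq₁ hγ₁ hγ hδ (Or.inr ⟨hs.symm, hq⟩)
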